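/- For a symmetric matrix $M\in\mathbb R^{n\times n}$ with zero diagonal and $\theta\in\mathbb R^n$, the Ising model $I_{(M,\theta)}$ is the law on $\{-1,1\}^n$ with $\mathbb P[X=x]\propto\exp(\theta\cdot x+\frac12 x\cdot Mx)$. For $S\subseteq[n]$, the censored model $\overline I_{S,(M,\theta)}$ is the law of $X_S=(X_i)_{i\in S}$ for $X\sim I_{(M,\theta)}$. For laws $P,Q$ on $\{-1,1\}^S$, $W(P,Q)=\inf\mathbb E\,\#\{i\in S: x_i\ne y_i\}$ is the earth-mover distance, the infimum being over all couplings $(x,y)$ of $P$ and $Q$. Algorithm $H(n,m,S,\rho_0,P)$, with sampling oracle $P$ on $\{-1,1\}^S$: draw $m$ independent samples $X^{(0)},\dots,X^{(m-1)}$ from $P$. For $v,u\in S$ let $\rho_{v,u}$ be the empirical (Pearson) correlation of coordinates $v$ and $u$ (taken to be $0$ if one of the two is constant on the samples). For $v\in S$ let $S_v=\{u\in S:u\ne v,\ |\rho_{v,u}|\ge\rho_0\}$ and $$f_v(x)=\frac{|\{i:X^{(i)}_v=1,\ X^{(i)}_{S_v}=x_{S_v}\}|}{|\{i:X^{(i)}_{S_v}=x_{S_v}\}|}$$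 (taken to be $0$ if the denominator is $0$). Start from $x=(1,\dots,1)\in\{-1,1\}^S$ and repeat $\lceil n\ln n\rceil$ times: choose $v\in S$ and $p\in[0,1]$ independently and uniformly at random, set $x_v=1$ if $p<f_v(x)$, and $x_v=-1$ otherwise. Return $x$. (If $S=\emptyset$, return the empty configuration.) Running time is counted in elementary steps (real arithmetic operations, square roots, logarithms, comparisons, memory accesses, random draws, oracle calls). **Theorem.** (i) $H\left(n,n,S,1/\ln\ln n,\cdot\right)$ runs in polynomial time: there are absolute constants $C,k$ such that for all $n\ge1$ and $S\subseteq[n]$ it always stops within $Cn^k$ steps. (ii) Let $b,d>0$ be constants with $bd<1/2$ and let $r=r(n)\to\infty$. There is a function $\varepsilon(n)=o(n)$, depending only on $b$, $d$ and $r$, such that the following holds for every $n\ge1$, every $\theta\in[-b,b]^n$, every symmetric $M\in\mathbb R^{n\times n}$ with zero diagonal, $|M_{i,j}|\le b$ for all $i,j$, at most $d$ nonzero entries in each row, such that every cycle of the graph with edges $\{\{i,j\}:M_{i,j}\ne0\}$ has length greater than $r(n)$, and every $S\subseteq[n]$. Write $Q=\overline I_{S,(M,\theta)}$ and, for a sequence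 $x=(x_1,x_2,\dots)$ of samples, let $P(H,x)$ be the law of the output of $H\left(n,n,S,1/\ln\ln n,Q\right)$ given that the samples it receives are $x_1,x_2,\dots$. Then $$\mathbb E_{x\sim Q^{\infty}}\big[W\big(Q,P(H,x)\big)\big]\le\varepsilon(n).$$ (For the finitely many $n$ for which $1/\ln\ln n$ is undefined or negative the bound is trivial, whatever value is used.) -/

import Mathlib

open MeasureTheory Filter Asymptotics
open scoped ENNReal

noncomputable section

/-! ### Ising models and censored Markov random fields -/

namespace Ising

/-- The spins `-1` and `1`. -/
abbrev Spin : Type := ℤˣ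

/-- The value of a spin as a real number. -/
def spinVal (s : Spin) : ℝ := ((s : ℤ) : ℝ)

/-- The unnormalised Ising weight `exp (θ · x + (1/2) x · M x)`. -/
def weight {n : ℕ} (M : Matrix (Fin n) (Fin n) ℝ) (θ : Fin n → ℝ) (x : Fin n → Spin) : ℝ :=
  Real.exp ((∑ i, θ i * spinVal (x i)) +
    (1 / 2) * ∑ i, spinVal (x i) * ∑ j, M i j * spinVal (x j))

theorem tsum_weight_ne_zero {n : ℕ} (M : Matrix (Fin n) (Fin n) ℝ) (θ : Fin n → ℝ) :
    (∑' x, ENNReal.ofReal (weight M θ x)) ≠ 0 := by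
  intro h
  have h1 := ENNReal.tsum_eq_zero.1 h (fun _ => 1)
  rw [ENNReal.ofReal_eq_zero] at h1
  exact absurd (Real.exp_pos _) (not_lt.2 h1)

theorem tsum_weight_ne_top {n : ℕ} (M : Matrix (Fin n) (Fin n) ℝ) (θ : Fin n → ℝ) :
    (∑' x, ENNReal.ofReal (weight M θ x)) ≠ ∞ := by
  rw [tsum_fintype]
  exact ENNReal.sum_ne_top.2 fun _ _ => ENNReal.ofReal_ne_top

/-- The Ising model with edge weights `M` and biases `θ`. -/
def isingModel {n : ℕ} (M : Matrix (Fin n) (Fin n) ℝ) (θ : Fin n → ℝ) : PMF (Fin n → Spin) :=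
  PMF.normalize (fun x => ENNReal.ofReal (weight M θ x))
    (tsum_weight_ne_zero M θ) (tsum_weight_ne_top M θ)

/-- The censored Markov random field with visible vertices `S`: the law of `X_S` for `X` drawn
from the Ising model. -/
def censored {n : ℕ} (S : Finset (Fin n)) (M : Matrix (Fin n) (Fin n) ℝ) (θ : Fin n → ℝ) :
    PMF (S → Spin) :=
  (isingModel M θ).map fun x i => x i

/-- The graph with an edge between `i ≠ j` whenever `M i j ≠ 0` (or `M j i ≠ 0`; `M` is
symmetric in all uses). -/
def interactionGraph {n : ℕ} (M : Matrix (Fin n) (Fin n) ℝ) : SimpleGraph (Fin n) :=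
  SimpleGraph.fromRel fun i j => M i j ≠ 0

/-- Symmetric, zero diagonal, entries bounded by `b`, at most `d` nonzero entries in each row,
biases in `[-b, b]`, and every cycle of the interaction graph is longer than `r`. -/
structure IsAdmissible {n : ℕ} (b d r : ℝ) (M : Matrix (Fin n) (Fin n) ℝ) (θ : Fin n → ℝ) :
    Prop where
  symm : M.IsSymm
  diag : ∀ i, M i i = 0
  entry_le : ∀ i j, |M i j| ≤ b
  sparse : ∀ i, ((Finset.univ.filter fun j => M i j ≠ 0).card : ℝ) ≤ d
  bias_le : ∀ i, |θ i| ≤ b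
  girth : ∀ (v : Fin n) (c : (interactionGraph M).Walk v v), c.IsCycle → r < (c.length : ℝ)

end Ising

/-! ### Earth-mover distance -/

/-- The earth-mover distance of two laws on `ι → α`: the infimum over all couplings of the expected
number of coordinates in which the two configurations differ. -/
def earthMover {ι α : Type} [Fintype ι] [DecidableEq α] (P Q : PMF (ι → α)) : ℝ≥0∞ :=
  ⨅ (μ : PMF ((ι → α) × (ι → α))) (_ : μ.map Prod.fst = P ∧ μ.map Prod.snd = Q),
    ∑' z, μ z * (hammingDist z.1 z.2 : ℝ≥0∞)

/-! ### Randomized algorithms with a sampling oracle and a step count -/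

/-- A randomized algorithm with access to an oracle that returns samples in `Ω`.
It stops with a value (`ret`), or it makes one step:
* `tick`: one elementary operation (an arithmetic operation, square root or logarithm of real
  numbers, a comparison, a Boolean operation, reading or writing one memory cell),
* `sample`: it asks the oracle for the next sample,
* `rand k`: it draws a uniformly random index in `{0, …, k}`,
* `coin q`: it draws `p` uniformly from `[0, 1]` and tests whether `p < q`. -/
inductive RandAlg (Ω : Type) (α : Type) : Type
  | ret (a : α) : RandAlg Ω α
  | tick (next : RandAlg Ω α) : RandAlg Ω α
  | sample (next : Ω → RandAlg Ω α) : RandAlg Ω α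
  | rand (k : ℕ) (next : Fin (k + 1) → RandAlg Ω α) : RandAlg Ω α
  | coin (q : ℝ) (next : Bool → RandAlg Ω α) : RandAlg Ω α

namespace RandAlg

variable {Ω α β ι : Type}

/-- Sequential composition. -/
protected def bind : RandAlg Ω α → (α → RandAlg Ω β) → RandAlg Ω β
  | ret a, f => f a
  | tick next, f => tick (next.bind f)
  | sample next, f => sample fun w => (next w).bind f
  | rand k next, f => rand k fun i => (next i).bind f
  | coin q next, f => coin q fun c => (next c).bind f

instance : Monad (RandAlg Ω) where
  pure := ret
  bind := RandAlg.bind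

/-- The law of the truth value of `p < q` for `p` uniform on `[0, 1]`. -/
def uniformBelow (q : ℝ) : PMF Bool :=
  PMF.ofFintype
    (fun c => if c then volume (Set.Icc (0 : ℝ) 1 ∩ Set.Iio q)
      else volume (Set.Icc (0 : ℝ) 1 \ Set.Iio q))
    (by
      rw [Fintype.sum_bool]
      simp only [if_true, Bool.false_eq_true, if_false]
      rw [measure_inter_add_sdiff _ measurableSet_Iio]
      simp)

/-- `A.law x` is the law of the output of `A` when the `i`-th sample that it receives is `x i`
(all other random choices being averaged over). -/
def law : RandAlg Ω α → (ℕ → Ω) → PMF α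
  | ret a, _ => PMF.pure a
  | tick next, x => next.law x
  | sample next, x => (next (x 0)).law fun i => x (i + 1)
  | rand k next, x => (PMF.uniformOfFintype (Fin (k + 1))).bind fun i => (next i).law x
  | coin q next, x => (uniformBelow q).bind fun c => (next c).law x

/-- `A.HaltsWithin t`: for all samples and all random choices, `A` stops after at most `t`
steps. -/
def HaltsWithin : RandAlg Ω α → ℕ → Prop
  | ret _, _ => True
  | tick _, 0 => False
  | sample _, 0 => False
  | rand _ _, 0 => False
  | coin _ _, 0 => False
  | tick next, t + 1 => next.HaltsWithin t
  | sample next, t + 1 => ∀ w, (next w).HaltsWithin t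
  | rand _ next, t + 1 => ∀ i, (next i).HaltsWithin t
  | coin _ next, t + 1 => ∀ c, (next c).HaltsWithin t

/-- The expected earth-mover distance between `P` and the law of the output of `A`, the expectation
being over the i.i.d. samples from `P` that `A` receives. -/
def learningError {V σ : Type} [Fintype V] [DecidableEq σ] [MeasurableSpace σ]
    (A : RandAlg (V → σ) (V → σ)) (P : PMF (V → σ)) : ℝ≥0∞ :=
  ∫⁻ x, earthMover P (A.law x) ∂(Measure.infinitePi fun _ : ℕ => P.toMeasure)

/-- One elementary operation with result `a`. -/
def op (a : α) : RandAlg Ω α := tick (ret a)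

/-- Draw the next sample. -/
def draw : RandAlg Ω Ω := sample ret

/-- Flip a coin: is `p < q` for a fresh uniform `p` in `[0, 1]`? -/
def flip (q : ℝ) : RandAlg Ω Bool := coin q ret

/-- The sum of the outputs of `g i` for `i` in the list. -/
def sumLoop (l : List ι) (g : ι → RandAlg Ω ℝ) : RandAlg Ω ℝ :=
  l.foldlM (fun s i => do
    let a ← g i
    op (s + a)) 0

/-- Fill a table indexed by the list `l`, one cell after the other. -/
def tabulate [DecidableEq ι] (l : List ι) (g : ι → RandAlg Ω β) (init : β) :
    RandAlg Ω (ι → β) :=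
  l.foldlM (fun tbl i => do
    let c ← g i
    op (Function.update tbl i c)) (fun _ => init)

end RandAlg

/-! ### The learning algorithm -/

namespace HighGirth

open RandAlg Ising

variable {Ω V : Type} [DecidableEq V]

/-- Approximate Glauber dynamics: `T` times, select a uniformly random vertex `v` of the list `vs`,
evaluate `q = f_v(x)`, draw `p` uniformly from `[0, 1]`, and set `x_v = 1` if `p < q` and `x_v = -1`
otherwise. Nothing is done if there are no vertices. -/
def approxGlauber (vs : List V) (f : V → (V → Spin) → RandAlg Ω ℝ) (x₀ : V → Spin) (T : ℕ) :
    RandAlg Ω (V → Spin) :=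
  match vs with
  | [] => pure x₀
  | v₀ :: rest =>
    (List.range T).foldlM (fun x _ => do
      let v ← rand rest.length fun i => ret ((v₀ :: rest).get i)
      let q ← f v x
      let c ← flip q
      op (Function.update x v (if c then 1 else -1))) x₀

/-- Draw `m` samples and store them. -/
def drawSamples (vs : List V) (m : ℕ) : RandAlg (V → Spin) (Fin m → V → Spin) :=
  tabulate (List.finRange m) (fun _ => do
    let x ← draw
    tabulate vs (fun v => op (x v)) 1) (fun _ => 1)

/-- The empirical (Pearson) correlation of the coordinates `v` and `u` of the samples `X`; it is `0`
if one of the two coordinates is constant on the samples. -/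
def empiricalCorrelation {m : ℕ} (X : Fin m → V → Spin) (v u : V) : RandAlg Ω ℝ := do
  let sv ← sumLoop (List.finRange m) fun i => op (spinVal (X i v))
  let su ← sumLoop (List.finRange m) fun i => op (spinVal (X i u))
  let svu ← sumLoop (List.finRange m) fun i => do
    let a ← op (spinVal (X i v))
    let b ← op (spinVal (X i u))
    op (a * b)
  let mv ← op (sv / m)
  let mu ← op (su / m)
  let mvu ← op (svu / m)
  let prod ← op (mv * mu)
  let cov ← op (mvu - prod)
  -- squares of spins equal `1`, so the empirical variances are `1 - mv ^ 2` and `1 - mu ^ 2`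
  let sqv ← op (mv * mv)
  let squ ← op (mu * mu)
  let varv ← op (1 - sqv)
  let varu ← op (1 - squ)
  let varProd ← op (varv * varu)
  let sd ← op (Real.sqrt varProd)
  op (cov / sd)

/-- The list of all `u ≠ v` in `vs` with `|ρ v u| ≥ ρ₀`. -/
def correlatedWith (vs : List V) (ρ : V → V → ℝ) (ρ₀ : ℝ) (v : V) : RandAlg Ω (List V) :=
  vs.foldlM (fun l u => do
    let ne ← op (decide (u ≠ v))
    let r ← op (ρ v u)
    let a ← op |r|
    let big ← op (decide (ρ₀ ≤ a))
    let both ← op (ne && big)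
    if both then op (u :: l) else pure l) []

/-- Does the stored sample `y` agree with `x` at all vertices of the list `l`? -/
def agreesOn (l : List V) (y x : V → Spin) : RandAlg Ω Bool :=
  l.foldlM (fun acc u => do
    let a ← op (y u)
    let b ← op (x u)
    let e ← op (decide (a = b))
    op (acc && e)) true

/-- The fraction of samples with `X_v = 1` among the samples that agree with `x` on `l`; it is `0`
if no sample agrees with `x` on `l`. -/
def empiricalConditional {m : ℕ} (X : Fin m → V → Spin) (l : List V) (v : V) (x : V → Spin) :
    RandAlg Ω ℝ := do
  let counts ← (List.finRange m).foldlM (fun (c : ℕ × ℕ) i => do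
    let ag ← agreesOn l (X i) x
    if ag then do
      let total ← op (c.2 + 1)
      let s ← op (X i v)
      let pos ← op (decide (s = 1))
      if pos then do
        let ones ← op (c.1 + 1)
        pure (ones, total)
      else pure (c.1, total)
    else pure c) (0, 0)
  op ((counts.1 : ℝ) / (counts.2 : ℝ))

/-- The algorithm `H(n, m, S, ρ₀, P)`, where `P` is the sampling oracle: draw `m` samples, compute
all empirical correlations of visible vertices, let `S_v` be the set of the visible vertices `u ≠ v`
with `|ρ_{v,u}| ≥ ρ₀`, let `f_v` be the empirical conditional probability of `X_v = 1` given
`X_{S_v}`, and run the approximate Glauber dynamics on the visible vertices from the all-ones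
configuration for `n ln n` steps (rounded up). The values of `f_v` are computed when needed. -/
def H (n m : ℕ) (S : Finset (Fin n)) (ρ₀ : ℝ) : RandAlg (S → Spin) (S → Spin) := do
  let vs : List S := (Finset.univ : Finset S).sort
  let X ← drawSamples vs m
  let ρ ← tabulate vs (fun v => tabulate vs (fun u => empiricalCorrelation X v u) 0) (fun _ => 0)
  let nbr ← tabulate vs (fun v => correlatedWith vs ρ ρ₀ v) []
  let ln ← op (Real.log n)
  let time ← op (n * ln)
  approxGlauber vs (fun v x => do
    let l ← op (nbr v)
    empiricalConditional X l v x) (fun _ => 1) ⌈time⌉₊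

end HighGirth

end

/-! The bound `bd < 1/2` puts the model in the Dobrushin uniqueness regime with a factor 2 to spare.
Flipping the spin at `j` moves the conditional probability at `i` by at most `|M i j|`, and the rows
of `|M|` sum to at most `α = bd < 1/2`. So the influence matrix contracts every weight that grows by
a factor at most 2 along edges (`Tame.dobrushin`). Averaging over free vertices does not increase
the weighted total oscillation (`Dobrushin.exists_oscBound`). Hence under every conditioning
covariances decay like `2 ^ (-distance)`, and the influence bounds survive the hiding of vertices.

The algorithm sees unconditional correlations, but Glauber dynamics needs the law of `X_v` given all
other visible spins, and a weakly correlated vertex might become influential after conditioning.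
Large girth rules this out (`abs_cov_le_of_reach`). Delete the first edge `ab` of a short path from
`a` to `u`. Every other route from `a` is long, so the spin at `a` becomes almost independent of
those at `b` and `u`, and the covariance of `a` and `u` is, up to a small error, `tanh (M a b)`
times a bounded factor times the covariance of `b` and `u` in the smaller model. The hyperbolic
tangent is the same with and without conditioning, and the other factor is bounded below when
nothing is conditioned. Induction along the path bounds the conditional covariance by a constant
times the unconditional one. The visible vertices outside `S_v` therefore have little joint
influence on `v`: the near ones because they are weakly correlated, the far ones by decay
(`Tame.abs_conditional_sub_le`).

When the empirical means are accurate, decay also confines `S_v` to a deterministic set whose size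
is bounded by a power of `ln ln n`. Every pattern on it has probability at least `n ^ (-1/8)` for
large `n`. Hoeffding's inequality at accuracy `n ^ (-1/4)`, with a union bound over polynomially
many test functions, makes `f_v` uniformly close to the true conditional probability
(`exists_tests`, `learningError_le`).

Finally, `Q` is stationary for the exact visible dynamics, which contracts with constant `2α < 1`.
Running exact and approximate dynamics with common randomness for `n ln n` steps leaves each vertex
in disagreement with probability at most `n ^ (-(1 - 2α)) + ε / (1 - 2α)`, where `ε` is the error of
the `f_v` (`Glauber.earthMover_law_le`). Summing over at most `n` vertices gives `o(n)`. -/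

set_option linter.unusedSectionVars false

noncomputable section

/-! ### Conditional averages and covariances for positive weights on spin configurations -/

namespace Gibbs

open Ising Function

variable {V : Type*} [Fintype V] [DecidableEq V]

/-- The configurations that agree with `x` off the set `F` of free vertices. -/
def cylinder (F : Finset V) (x : V → Spin) : Finset (V → Spin) :=
  Finset.univ.filter fun y => ∀ i, i ∉ F → y i = x i

/-- The expectation of `f` under the law with weights `w`, conditioned on the configuration being
equal to `x` off `F`. -/
def avg (w : (V → Spin) → ℝ) (F : Finset V) (x : V → Spin) (f : (V → Spin) → ℝ) : ℝ :=
  (∑ y ∈ cylinder F x, w y * f y) / ∑ y ∈ cylinder F x, w y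

/-- The indicator of spin `1` at vertex `i`. -/
def up (i : V) (x : V → Spin) : ℝ := if x i = 1 then 1 else 0

/-- `o i` bounds the change of `f` when the spin at `i` is flipped. -/
def OscBound (f : (V → Spin) → ℝ) (o : V → ℝ) : Prop :=
  ∀ x i, |f (update x i 1) - f (update x i (-1))| ≤ o i

theorem spin_cases (s : Spin) : s = 1 ∨ s = -1 := Int.units_eq_one_or s

theorem neg_one_ne_one : (-1 : Spin) ≠ 1 := by decide

theorem mem_cylinder {F : Finset V} {x y : V → Spin} :
    y ∈ cylinder F x ↔ ∀ i, i ∉ F → y i = x i := by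
  simp [cylinder]

theorem self_mem_cylinder (F : Finset V) (x : V → Spin) : x ∈ cylinder F x :=
  mem_cylinder.2 fun _ _ => rfl

theorem cylinder_congr {F : Finset V} {x y : V → Spin} (h : ∀ i, i ∉ F → y i = x i) :
    cylinder F y = cylinder F x := by
  ext z
  simp only [mem_cylinder]
  exact ⟨fun hz i hi => (hz i hi).trans (h i hi), fun hz i hi => (hz i hi).trans (h i hi).symm⟩

theorem cylinder_univ (x : V → Spin) : cylinder Finset.univ x = Finset.univ := by
  ext z
  simp [mem_cylinder]

theorem cylinder_singleton (i : V) (x : V → Spin) :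
    cylinder {i} x = {update x i 1, update x i (-1)} := by
  ext y
  simp only [mem_cylinder, Finset.mem_singleton, Finset.mem_insert]
  constructor
  · intro h
    rcases spin_cases (y i) with hi | hi
    · left
      funext j
      by_cases hj : j = i
      · subst hj; simp [hi]
      · simp [hj, h j hj]
    · right
      funext j
      by_cases hj : j = i
      · subst hj; simp [hi]
      · simp [hj, h j hj]
  · rintro (rfl | rfl) j hj <;> simp [hj]

section avg

variable {w : (V → Spin) → ℝ}

theorem sum_cylinder_pos (hw : ∀ x, 0 < w x) (F : Finset V) (x : V → Spin) :
    0 < ∑ y ∈ cylinder F x, w y :=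
  Finset.sum_pos (fun y _ => hw y) ⟨x, self_mem_cylinder F x⟩

theorem avg_boundary {F : Finset V} {x y : V → Spin} (h : ∀ i, i ∉ F → y i = x i)
    (f : (V → Spin) → ℝ) : avg w F y f = avg w F x f := by
  rw [avg, avg, cylinder_congr h]

theorem avg_congr {F : Finset V} {x : V → Spin} {f g : (V → Spin) → ℝ}
    (h : ∀ y ∈ cylinder F x, f y = g y) : avg w F x f = avg w F x g := by
  rw [avg, avg]
  congr 1
  exact Finset.sum_congr rfl fun y hy => by rw [h y hy]

theorem avg_add (F : Finset V) (x : V → Spin) (f g : (V → Spin) → ℝ) :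
    avg w F x (fun y => f y + g y) = avg w F x f + avg w F x g := by
  simp only [avg, mul_add, Finset.sum_add_distrib, add_div]

theorem avg_sub (F : Finset V) (x : V → Spin) (f g : (V → Spin) → ℝ) :
    avg w F x (fun y => f y - g y) = avg w F x f - avg w F x g := by
  simp only [avg, mul_sub, Finset.sum_sub_distrib, sub_div]

theorem avg_const_mul (F : Finset V) (x : V → Spin) (a : ℝ) (f : (V → Spin) → ℝ) :
    avg w F x (fun y => a * f y) = a * avg w F x f := by
  simp only [avg]
  rw [← mul_div_assoc, Finset.mul_sum]
  congr 1
  exact Finset.sum_congr rfl fun y _ => by ring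

theorem avg_const (hw : ∀ x, 0 < w x) (F : Finset V) (x : V → Spin) (a : ℝ) :
    avg w F x (fun _ => a) = a := by
  rw [avg, ← Finset.sum_mul, mul_comm, mul_div_assoc, div_self (sum_cylinder_pos hw F x).ne',
    mul_one]

theorem avg_of_const_on (hw : ∀ x, 0 < w x) {F : Finset V} {x : V → Spin} {f : (V → Spin) → ℝ}
    {a : ℝ} (h : ∀ y ∈ cylinder F x, f y = a) : avg w F x f = a := by
  rw [avg_congr h, avg_const hw]

theorem avg_mono (hw : ∀ x, 0 < w x) {F : Finset V} {x : V → Spin} {f g : (V → Spin) → ℝ}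
    (h : ∀ y ∈ cylinder F x, f y ≤ g y) : avg w F x f ≤ avg w F x g :=
  div_le_div_of_nonneg_right
    (Finset.sum_le_sum fun y hy => mul_le_mul_of_nonneg_left (h y hy) (hw y).le)
    (sum_cylinder_pos hw F x).le

theorem avg_le (hw : ∀ x, 0 < w x) {F : Finset V} {x : V → Spin} {f : (V → Spin) → ℝ} {a : ℝ}
    (h : ∀ y ∈ cylinder F x, f y ≤ a) : avg w F x f ≤ a :=
  (avg_mono hw h).trans_eq (avg_const hw F x a)

theorem le_avg (hw : ∀ x, 0 < w x) {F : Finset V} {x : V → Spin} {f : (V → Spin) → ℝ} {a : ℝ}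
    (h : ∀ y ∈ cylinder F x, a ≤ f y) : a ≤ avg w F x f :=
  (avg_const hw F x a).symm.trans_le (avg_mono hw h)

theorem avg_abs_le (hw : ∀ x, 0 < w x) {F : Finset V} {x : V → Spin} {f : (V → Spin) → ℝ} {a : ℝ}
    (h : ∀ y ∈ cylinder F x, |f y| ≤ a) : |avg w F x f| ≤ a :=
  abs_le.2 ⟨le_avg hw fun y hy => (abs_le.1 (h y hy)).1,
    avg_le hw fun y hy => (abs_le.1 (h y hy)).2⟩

theorem avg_mul_of_const_on {F : Finset V} {x : V → Spin} {f g : (V → Spin) → ℝ}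
    {a : ℝ} (h : ∀ y ∈ cylinder F x, g y = a) :
    avg w F x (fun y => g y * f y) = a * avg w F x f := by
  rw [avg_congr (g := fun y => a * f y) fun y hy => by rw [h y hy], avg_const_mul]

/-- The tower property of conditional expectations. -/
theorem avg_avg (hw : ∀ x, 0 < w x) {F' F : Finset V} (hF : F' ⊆ F) (x : V → Spin)
    (f : (V → Spin) → ℝ) : avg w F x (fun y => avg w F' y f) = avg w F x f := by
  rw [avg, avg]
  congr 1
  have h1 : ∀ y ∈ cylinder F x, w y * avg w F' y f =
      ∑ z ∈ cylinder F' y, w y * (w z * f z / ∑ u ∈ cylinder F' z, w u) := by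
    intro y _
    rw [avg, Finset.sum_div, Finset.mul_sum]
    refine Finset.sum_congr rfl fun z hz => ?_
    rw [cylinder_congr (mem_cylinder.1 hz)]
  -- Lying in the same `F'`-cylinder is a symmetric relation, so after exchanging the sums the
  -- weights over the cylinder of `z` cancel its normalising constant.
  rw [Finset.sum_congr rfl h1,
    Finset.sum_comm' (s' := fun z => cylinder F' z) (t' := cylinder F x)]
  · refine Finset.sum_congr rfl fun z _ => ?_
    rw [← Finset.sum_mul]
    exact mul_div_cancel₀ _ (sum_cylinder_pos hw F' z).ne'
  · intro y z
    simp only [mem_cylinder]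
    constructor
    · rintro ⟨h2, h3⟩
      exact ⟨fun i hi => (h3 i hi).symm,
        fun i hi => (h3 i fun h => hi (hF h)).trans (h2 i hi)⟩
    · rintro ⟨h2, h3⟩
      exact ⟨fun i hi => (h2 i fun h => hi (hF h)).trans (h3 i hi),
        fun i hi => (h2 i hi).symm⟩

theorem up_update_one (i : V) (x : V → Spin) : up i (update x i 1) = 1 := by simp [up]

theorem up_update_neg_one (i : V) (x : V → Spin) : up i (update x i (-1)) = 0 := by
  simp [up]

theorem up_nonneg (i : V) (x : V → Spin) : 0 ≤ up i x := by
  unfold up; split_ifs <;> norm_num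

theorem up_le_one (i : V) (x : V → Spin) : up i x ≤ 1 := by
  unfold up; split_ifs <;> norm_num

theorem avg_up_mem (hw : ∀ x, 0 < w x) (F : Finset V) (x : V → Spin) (i : V) :
    0 ≤ avg w F x (up i) ∧ avg w F x (up i) ≤ 1 :=
  ⟨le_avg hw fun y _ => up_nonneg i y, avg_le hw fun y _ => up_le_one i y⟩

/-- Conditioning on the spin at `i` first. -/
theorem avg_insert (hw : ∀ x, 0 < w x) (F : Finset V) (i : V) (x : V → Spin)
    (f : (V → Spin) → ℝ) :
    avg w (insert i F) x f = avg w (insert i F) x (up i) * avg w F (update x i 1) f +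
      (1 - avg w (insert i F) x (up i)) * avg w F (update x i (-1)) f := by
  have hb : ∀ y ∈ cylinder (insert i F) x, ∀ j, j ∉ F → y j = update x i (y i) j := by
    intro y hy j hj
    by_cases hji : j = i
    · subst hji; simp
    · rw [update_of_ne hji]
      exact mem_cylinder.1 hy j (by simp [hji, hj])
  have h : ∀ y ∈ cylinder (insert i F) x, avg w F y f =
      avg w F (update x i (-1)) f +
        (avg w F (update x i 1) f - avg w F (update x i (-1)) f) * up i y := by
    intro y hy
    rw [avg_boundary (hb y hy)]
    rcases spin_cases (y i) with h | h
    · rw [h, up, if_pos h]; ring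
    · rw [h, up, if_neg (h ▸ neg_one_ne_one)]; ring
  rw [← avg_avg hw (Finset.subset_insert i F) x f, avg_congr h, avg_add, avg_const hw,
    avg_const_mul]
  ring

/-- The covariance of the spin at `a` with `h`. -/
def cov (w : (V → Spin) → ℝ) (F : Finset V) (x : V → Spin) (a : V) (h : (V → Spin) → ℝ) : ℝ :=
  avg w F x (fun y => spinVal (y a) * h y) - avg w F x (fun y => spinVal (y a)) * avg w F x h

theorem spinVal_one : spinVal 1 = 1 := by simp [spinVal]

theorem spinVal_neg_one : spinVal (-1) = -1 := by simp [spinVal]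

theorem spinVal_mul_self (s : Spin) : spinVal s * spinVal s = 1 := by
  rcases spin_cases s with rfl | rfl <;> simp [spinVal_one, spinVal_neg_one]

theorem abs_spinVal (s : Spin) : |spinVal s| = 1 := by
  rcases spin_cases s with rfl | rfl <;> simp [spinVal_one, spinVal_neg_one]

theorem spinVal_eq_up (x : V → Spin) (i : V) : spinVal (x i) = 2 * up i x - 1 := by
  unfold up
  rcases spin_cases (x i) with h | h
  · rw [h, spinVal_one]; norm_num
  · rw [h, spinVal_neg_one, if_neg neg_one_ne_one]; norm_num

/-- Two functions of a two-valued variable have covariance `q (1 - q)` times the product of their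
jumps, and the jump of the spin is 2. This converts influences into covariances and back. -/
theorem cov_insert (hw : ∀ x, 0 < w x) {F : Finset V} {a : V} (ha : a ∉ F) (x : V → Spin)
    (h : (V → Spin) → ℝ) :
    cov w (insert a F) x a h =
      2 * avg w (insert a F) x (up a) * (1 - avg w (insert a F) x (up a)) *
        (avg w F (update x a 1) h - avg w F (update x a (-1)) h) := by
  have h1 : ∀ s, ∀ y ∈ cylinder F (update x a s), spinVal (y a) = spinVal s := by
    intro s y hy
    rw [mem_cylinder.1 hy a ha, update_self]
  rw [cov, avg_insert hw F a x fun y => spinVal (y a) * h y, avg_insert hw F a x h,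
    avg_insert hw F a x fun y => spinVal (y a), avg_mul_of_const_on (h1 1),
    avg_mul_of_const_on (h1 (-1)), avg_of_const_on hw (h1 1), avg_of_const_on hw (h1 (-1)),
    spinVal_one, spinVal_neg_one]
  ring

theorem cov_of_notMem (hw : ∀ x, 0 < w x) {F : Finset V} {a : V} (ha : a ∉ F) (x : V → Spin)
    (h : (V → Spin) → ℝ) : cov w F x a h = 0 := by
  have h1 : ∀ y ∈ cylinder F x, spinVal (y a) = spinVal (x a) := by
    intro y hy
    rw [mem_cylinder.1 hy a ha]
  rw [cov, avg_mul_of_const_on h1, avg_of_const_on hw h1, sub_self]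

theorem avg_up_of_single {c : ℝ} (hw : ∀ x, 0 < w x) {i : V}
    (hc : ∀ x, c ≤ avg w {i} x (up i) ∧ avg w {i} x (up i) ≤ 1 - c) {F : Finset V} (hi : i ∈ F)
    (x : V → Spin) : c ≤ avg w F x (up i) ∧ avg w F x (up i) ≤ 1 - c := by
  rw [← avg_avg hw (Finset.singleton_subset_iff.2 hi)]
  exact ⟨le_avg hw fun y _ => (hc y).1, avg_le hw fun y _ => (hc y).2⟩

end avg

/-! ### Oscillations of functions of the spins -/

section osc

theorem OscBound.nonneg {f : (V → Spin) → ℝ} {o : V → ℝ} (h : OscBound f o) (i : V) : 0 ≤ o i :=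
  (abs_nonneg _).trans (h (fun _ => 1) i)

theorem OscBound.update_le {f : (V → Spin) → ℝ} {o : V → ℝ} (h : OscBound f o) (x : V → Spin)
    (i : V) (s t : Spin) : |f (update x i s) - f (update x i t)| ≤ o i := by
  rcases spin_cases s with rfl | rfl <;> rcases spin_cases t with rfl | rfl
  · simpa using h.nonneg i
  · exact h x i
  · rw [abs_sub_comm]; exact h x i
  · simpa using h.nonneg i

/-- Change `x` into `y` one coordinate at a time. -/
theorem OscBound.abs_sub_le {f : (V → Spin) → ℝ} {o : V → ℝ} (h : OscBound f o)
    (x y : V → Spin) : |f x - f y| ≤ ∑ i, if x i ≠ y i then o i else 0 := by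
  have key : ∀ s : Finset V, ∀ x : V → Spin, (∀ i, i ∉ s → x i = y i) →
      |f x - f y| ≤ ∑ i ∈ s, if x i ≠ y i then o i else 0 := by
    intro s
    induction s using Finset.induction_on with
    | empty =>
      intro x hx
      have : x = y := funext fun i => hx i (Finset.notMem_empty i)
      simp [this]
    | insert j s hj ih =>
      intro x hx
      rw [Finset.sum_insert hj]
      have h1 := ih (update x j (y j)) fun i hi => by
        by_cases hij : i = j
        · subst hij; simp
        · rw [update_of_ne hij]; exact hx i (by simp [hij, hi])
      have h2 : ∑ i ∈ s, (if update x j (y j) i ≠ y i then o i else 0) =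
          ∑ i ∈ s, if x i ≠ y i then o i else 0 := by
        refine Finset.sum_congr rfl fun i hi => ?_
        rw [update_of_ne (ne_of_mem_of_not_mem hi hj)]
      rw [h2] at h1
      have h3 : |f x - f (update x j (y j))| ≤ if x j ≠ y j then o j else 0 := by
        by_cases hxy : x j = y j
        · rw [← hxy]; simp
        · rw [if_pos hxy]
          simpa using h.update_le x j (x j) (y j)
      calc |f x - f y| ≤ |f x - f (update x j (y j))| + |f (update x j (y j)) - f y| :=
            _root_.abs_sub_le _ _ _
        _ ≤ _ := add_le_add h3 h1
  exact key Finset.univ x fun i hi => absurd (Finset.mem_univ i) hi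

theorem OscBound.of_avg_boundary {w : (V → Spin) → ℝ} {F : Finset V} {f : (V → Spin) → ℝ}
    (x : V → Spin) {i : V} (hi : i ∈ F) (s t : Spin) :
    avg w F (update x i s) f = avg w F (update x i t) f :=
  avg_boundary (fun j hj => by
    have hji : j ≠ i := fun h => hj (h ▸ hi)
    rw [update_of_ne hji, update_of_ne hji]) f

end osc

/-! ### Dobrushin's condition and decay of covariances -/

section Dobrushin

variable {w : (V → Spin) → ℝ} {A : V → V → ℝ} {φ : V → ℝ} {α : ℝ}

/-- `A i j` bounds the influence of the spin at `j` on the conditional law of the spin at `i`,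
and the weights `φ` are contracted by `A` with the factor `α`. -/
structure Dobrushin (w : (V → Spin) → ℝ) (A : V → V → ℝ) (φ : V → ℝ) (α : ℝ) : Prop where
  weight_pos : ∀ x, 0 < w x
  influence : ∀ i, OscBound (fun x => avg w {i} x (up i)) (A i)
  pos : ∀ i, 0 < φ i
  contract : ∀ i, ∑ j, A i j * φ j ≤ α * φ i
  lt_one : α < 1

/-- Let `h` be the average over `F` of the single-site probability at `i`. The probability `q` of
spin 1 at `i` with `insert i F` free solves `q = q h(+) + (1 - q) h(-)`, because `h` may still
depend on the spin at `i`. Subtracting this equation for the two values at `u` leaves a factor of at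
least `1 - o i` in front of the change of `q`. -/
theorem up_oscBound_step {w : (V → Spin) → ℝ} (hw : ∀ x, 0 < w x) {F : Finset V} {i : V}
    {o : V → ℝ} (ho : OscBound (fun x => avg w F x fun y => avg w {i} y (up i)) o)
    (hi : o i < 1) {u : V} (hu : u ∉ insert i F) (x : V → Spin) :
    |avg w (insert i F) (update x u 1) (up i) - avg w (insert i F) (update x u (-1)) (up i)| ≤
      o u / (1 - o i) := by
  set h : (V → Spin) → ℝ := fun x => avg w F x fun y => avg w {i} y (up i) with hh
  have hui : u ≠ i := fun e => hu (by simp [e])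
  have key : ∀ z, avg w (insert i F) z (up i) =
      avg w (insert i F) z (up i) * h (update z i 1) +
        (1 - avg w (insert i F) z (up i)) * h (update z i (-1)) := by
    intro z
    conv_lhs =>
      rw [← avg_avg hw (Finset.singleton_subset_iff.2 (Finset.mem_insert_self i F)),
        avg_insert hw]
  have hq := fun z => avg_up_mem hw (insert i F) z i
  set x1 := update x u 1
  set x2 := update x u (-1)
  have e1 := key x1
  have e2 := key x2
  have b1 := hq x1
  have b2 := hq x2
  set q1 := avg w (insert i F) x1 (up i)
  set q2 := avg w (insert i F) x2 (up i)
  have d1 : |h (update x1 i 1) - h (update x2 i 1)| ≤ o u := by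
    rw [update_comm hui, update_comm hui]
    exact ho _ u
  have d2 : |h (update x1 i (-1)) - h (update x2 i (-1))| ≤ o u := by
    rw [update_comm hui, update_comm hui]
    exact ho _ u
  have d3 := ho x1 i
  change |h (update x1 i 1) - h (update x1 i (-1))| ≤ o i at d3
  rw [le_div_iff₀ (by linarith)]
  have hd : 0 < 1 - o i := by linarith
  have hpos : 1 - o i ≤ 1 - (h (update x1 i 1) - h (update x1 i (-1))) := by
    have := (abs_le.1 d3).2
    linarith
  have e3 : (q1 - q2) * (1 - (h (update x1 i 1) - h (update x1 i (-1)))) =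
      (1 - q2) * (h (update x1 i (-1)) - h (update x2 i (-1))) +
        q2 * (h (update x1 i 1) - h (update x2 i 1)) := by
    linear_combination e1 - e2
  calc |q1 - q2| * (1 - o i) ≤ |q1 - q2| * (1 - (h (update x1 i 1) - h (update x1 i (-1)))) :=
        mul_le_mul_of_nonneg_left hpos (abs_nonneg _)
    _ = |(q1 - q2) * (1 - (h (update x1 i 1) - h (update x1 i (-1))))| := by
        rw [abs_mul, abs_of_pos (hd.trans_le hpos)]
    _ ≤ |(1 - q2) * (h (update x1 i (-1)) - h (update x2 i (-1)))| +
          |q2 * (h (update x1 i 1) - h (update x2 i 1))| := by rw [e3]; exact abs_add_le _ _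
    _ ≤ (1 - q2) * o u + q2 * o u := by
        rw [abs_mul, abs_mul, abs_of_nonneg (by linarith [b2.2] : 0 ≤ 1 - q2),
          abs_of_nonneg b2.1]
        exact add_le_add (mul_le_mul_of_nonneg_left d2 (by linarith [b2.2]))
          (mul_le_mul_of_nonneg_left d1 b2.1)
    _ = o u := by ring

/-- Split according to the spin at `i`. Flipping `u` moves each branch by at most `o u`, and shifts
mass at most `o' u` between two branches that differ by at most `o i`. -/
theorem avg_oscBound_step {w : (V → Spin) → ℝ} (hw : ∀ x, 0 < w x) {F : Finset V} {i : V}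
    {f : (V → Spin) → ℝ} {o o' : V → ℝ} (ho : OscBound (fun x => avg w F x f) o) {u : V}
    (hui : u ≠ i) (x : V → Spin)
    (ho' : |avg w (insert i F) (update x u 1) (up i) -
      avg w (insert i F) (update x u (-1)) (up i)| ≤ o' u) :
    |avg w (insert i F) (update x u 1) f - avg w (insert i F) (update x u (-1)) f| ≤
      o u + o' u * o i := by
  rw [avg_insert hw F i (update x u 1) f, avg_insert hw F i (update x u (-1)) f]
  have b1 := avg_up_mem hw (insert i F) (update x u 1) i
  set q1 := avg w (insert i F) (update x u 1) (up i)
  set q2 := avg w (insert i F) (update x u (-1)) (up i)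
  have d1 := ho (update x i 1) u
  have d2 := ho (update x i (-1)) u
  have d3 := ho (update x u (-1)) i
  rw [update_comm hui.symm, update_comm hui.symm] at d1 d2
  simp only at d1 d2 d3
  set a1 := avg w F (update (update x u 1) i 1) f
  set a2 := avg w F (update (update x u 1) i (-1)) f
  set c1 := avg w F (update (update x u (-1)) i 1) f
  set c2 := avg w F (update (update x u (-1)) i (-1)) f
  have e : q1 * a1 + (1 - q1) * a2 - (q2 * c1 + (1 - q2) * c2) =
      q1 * (a1 - c1) + (1 - q1) * (a2 - c2) + (q1 - q2) * (c1 - c2) := by ring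
  rw [e]
  have m1 : |q1 * (a1 - c1)| ≤ q1 * o u := by
    rw [abs_mul, abs_of_nonneg b1.1]; exact mul_le_mul_of_nonneg_left d1 b1.1
  have m2 : |(1 - q1) * (a2 - c2)| ≤ (1 - q1) * o u := by
    rw [abs_mul, abs_of_nonneg (by linarith [b1.2] : 0 ≤ 1 - q1)]
    exact mul_le_mul_of_nonneg_left d2 (by linarith [b1.2])
  have m3 : |(q1 - q2) * (c1 - c2)| ≤ o' u * o i := by
    rw [abs_mul]
    exact mul_le_mul ho' d3 (abs_nonneg _) ((abs_nonneg _).trans ho')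
  calc _ ≤ |q1 * (a1 - c1)| + |(1 - q1) * (a2 - c2)| + |(q1 - q2) * (c1 - c2)| := abs_add_three _ _ _
    _ ≤ q1 * o u + (1 - q1) * o u + o' u * o i := by gcongr
    _ = _ := by ring

/-- Averaging over the spins in `F` does not increase the weighted sum of the oscillations. -/
theorem Dobrushin.exists_oscBound (hD : Dobrushin w A φ α) (F : Finset V) :
    ∀ (f : (V → Spin) → ℝ) (o : V → ℝ), OscBound f o →
      ∃ o', OscBound (fun x => avg w F x f) o' ∧ (∀ i ∈ F, o' i = 0) ∧
        ∑ i, φ i * o' i ≤ ∑ i, φ i * o i := by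
  have hw := hD.weight_pos
  induction F using Finset.induction_on with
  | empty =>
    intro f o ho
    refine ⟨o, fun x i => ?_, fun i hi => absurd hi (Finset.notMem_empty i), le_rfl⟩
    have h : ∀ y, avg w ∅ y f = f y := fun y => avg_of_const_on hw fun z hz => by
      rw [show z = y from funext fun j => mem_cylinder.1 hz j (Finset.notMem_empty j)]
    simp only [h]
    exact ho x i
  | insert i F hi ih =>
    intro f o ho
    -- The induction is used twice: for the single-site probability at `i`, which controls how
    -- freeing `i` reacts to the outside, and for `f` itself.
    obtain ⟨a, ha, -, haφ⟩ := ih _ _ (hD.influence i)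
    obtain ⟨h, hh, -, hhφ⟩ := ih f o ho
    have hc : ∑ j, φ j * a j ≤ α * φ i := by
      refine haφ.trans (le_trans (le_of_eq ?_) (hD.contract i))
      exact Finset.sum_congr rfl fun j _ => mul_comm _ _
    have hai : a i ≤ α := by
      have h1 : φ i * a i ≤ α * φ i :=
        (Finset.single_le_sum (f := fun j => φ j * a j)
          (fun j _ => mul_nonneg (hD.pos j).le (ha.nonneg j)) (Finset.mem_univ i)).trans hc
      rw [mul_comm] at h1
      exact le_of_mul_le_mul_right h1 (hD.pos i)
    have hai1 : a i < 1 := hai.trans_lt hD.lt_one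
    refine ⟨fun u => if u ∈ insert i F then 0 else h u + a u / (1 - a i) * h i, ?_,
      fun u hu => if_pos hu, ?_⟩
    · intro x u
      by_cases hu : u ∈ insert i F
      · simp only [if_pos hu]
        rw [OscBound.of_avg_boundary x hu 1 (-1), sub_self, abs_zero]
      · simp only [if_neg hu]
        exact avg_oscBound_step hw (o' := fun u => a u / (1 - a i)) hh
          (fun e => hu (by simp [e])) x (up_oscBound_step hw ha hai1 hu x)
    · have hsum : ∀ g : V → ℝ, (∀ u, 0 ≤ g u) →
          ∑ u, φ u * (if u ∈ insert i F then 0 else g u) ≤ ∑ u, φ u * g u - φ i * g i := by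
        intro g hg
        rw [← Finset.sum_erase_eq_sub (f := fun u => φ u * g u) (Finset.mem_univ i),
          ← Finset.add_sum_erase _ (fun u => φ u * (if u ∈ insert i F then 0 else g u))
            (Finset.mem_univ i)]
        simp only [Finset.mem_insert, true_or, if_true, mul_zero, zero_add]
        refine Finset.sum_le_sum fun u _ => ?_
        split_ifs
        · simpa using mul_nonneg (hD.pos u).le (hg u)
        · exact le_rfl
      have s1 := hsum h hh.nonneg
      have s2 := hsum a ha.nonneg
      have s3 : ∑ u, φ u * (if u ∈ insert i F then 0 else h u + a u / (1 - a i) * h i) =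
          ∑ u, φ u * (if u ∈ insert i F then 0 else h u) +
            (∑ u, φ u * (if u ∈ insert i F then 0 else a u)) / (1 - a i) * h i := by
        rw [Finset.sum_div, Finset.sum_mul, ← Finset.sum_add_distrib]
        refine Finset.sum_congr rfl fun u _ => ?_
        split_ifs <;> ring
      rw [s3]
      -- Without its own term, the weighted influence on `i` is at most `α φ i - φ i * a i ≤ φ i *
      -- (1 - a i)`. So what is redistributed from `h i` costs no more than the term `φ i * h i`
      -- that disappears.
      have s4 : (∑ u, φ u * (if u ∈ insert i F then 0 else a u)) / (1 - a i) ≤ φ i := by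
        rw [div_le_iff₀ (by linarith)]
        have := mul_le_mul_of_nonneg_right hD.lt_one.le (hD.pos i).le
        nlinarith
      have s5 := mul_le_mul_of_nonneg_right s4 (hh.nonneg i)
      linarith

/-- The weighted total influence on a vertex `i` of the spins off `F`. -/
theorem Dobrushin.exists_oscBound_up (hD : Dobrushin w A φ α) {F : Finset V} {i : V}
    (hi : i ∈ F) :
    ∃ o, OscBound (fun x => avg w F x (up i)) o ∧ (∀ j ∈ F, o j = 0) ∧
      ∑ j, φ j * o j ≤ α * φ i := by
  obtain ⟨o, h1, h2, h3⟩ := hD.exists_oscBound F _ _ (hD.influence i)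
  refine ⟨o, ?_, h2, h3.trans ((le_of_eq ?_).trans (hD.contract i))⟩
  · simpa only [avg_avg hD.weight_pos (Finset.singleton_subset_iff.2 hi)] using h1
  · exact Finset.sum_congr rfl fun j _ => mul_comm _ _

/-- Covariances decay: a function whose oscillations sit far from `a` is nearly uncorrelated with
the spin at `a`. -/
theorem Dobrushin.abs_cov_le (hD : Dobrushin w A φ α) (F : Finset V) (x : V → Spin) (a : V)
    {h : (V → Spin) → ℝ} {o : V → ℝ} (ho : OscBound h o) :
    |cov w F x a h| ≤ (∑ i, φ i * o i) / (2 * φ a) := by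
  have hpos := hD.pos a
  by_cases ha : a ∈ F
  -- With `a` held fixed and the rest of `F` averaged out, the oscillation left at `a` is at most
  -- the weighted total divided by `φ a`. The prefactor `2q(1 - q)` is at most `1/2`.
  · obtain ⟨o', h1, -, h3⟩ := hD.exists_oscBound (F.erase a) h o ho
    rw [← Finset.insert_erase ha, cov_insert hD.weight_pos (Finset.notMem_erase a F)]
    have hq := avg_up_mem hD.weight_pos (insert a (F.erase a)) x a
    set q := avg w (insert a (F.erase a)) x (up a)
    have h4 := h1 x a
    simp only at h4
    have h5 : φ a * o' a ≤ ∑ i, φ i * o i :=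
      (Finset.single_le_sum (f := fun j => φ j * o' j)
        (fun j _ => mul_nonneg (hD.pos j).le (h1.nonneg j)) (Finset.mem_univ a)).trans h3
    have h6 : 0 ≤ 2 * q * (1 - q) := by nlinarith
    have h7 : 2 * q * (1 - q) ≤ 1 / 2 := by nlinarith [sq_nonneg (2 * q - 1)]
    rw [abs_mul, abs_of_nonneg h6, le_div_iff₀ (by linarith)]
    have h8 := mul_le_mul h7 h4 (abs_nonneg _) (by norm_num)
    nlinarith
  · rw [cov_of_notMem hD.weight_pos ha, abs_zero]
    exact div_nonneg (Finset.sum_nonneg fun i _ => mul_nonneg (hD.pos i).le (ho.nonneg i))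
      (by linarith)

end Dobrushin

end Gibbs

end

noncomputable section

namespace Gibbs

open Ising Function

/-! ### Single-site conditional laws of the Ising model -/

section Field

variable {n : ℕ} {M : Matrix (Fin n) (Fin n) ℝ} {θ : Fin n → ℝ}

theorem weight_pos (M : Matrix (Fin n) (Fin n) ℝ) (θ : Fin n → ℝ) (x : Fin n → Spin) :
    0 < weight M θ x := Real.exp_pos _

/-- The local field at vertex `i`. -/
def field (M : Matrix (Fin n) (Fin n) ℝ) (θ : Fin n → ℝ) (i : Fin n) (x : Fin n → Spin) : ℝ :=
  θ i + ∑ j, M i j * spinVal (x j)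

/-- An Ising model in the Dobrushin uniqueness regime. -/
structure Tame (b α : ℝ) (M : Matrix (Fin n) (Fin n) ℝ) (θ : Fin n → ℝ) : Prop where
  symm : M.IsSymm
  diag : ∀ i, M i i = 0
  row_sum : ∀ i, ∑ j, |M i j| ≤ α
  bias_le : ∀ i, |θ i| ≤ b
  lt_half : α < 1 / 2
  nonneg : 0 ≤ α

/-- The exponent is affine in the spin at `i`: the zero diagonal removes the square, and by symmetry
the cross terms appear twice, cancelling the factor `1/2`. -/
theorem weight_update (hs : M.IsSymm) (hd : ∀ i, M i i = 0) (x : Fin n → Spin) (i : Fin n) :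
    ∃ C : ℝ, 0 < C ∧ ∀ s, weight M θ (update x i s) =
      C * Real.exp (spinVal s * field M θ i x) := by
  let z : Fin n → ℝ := fun j => if j = i then 0 else spinVal (x j)
  have hz : ∀ s j, spinVal (update x i s j) = z j + (if j = i then spinVal s else 0) := by
    intro s j
    by_cases hj : j = i
    · subst hj; simp [z]
    · simp [z, hj]
  refine ⟨Real.exp ((∑ j, θ j * z j) + (1 / 2) * ∑ a, z a * ∑ c, M a c * z c), Real.exp_pos _,
    fun s => ?_⟩
  rw [weight, ← Real.exp_add]
  congr 1
  have h1 : ∑ j, θ j * spinVal (update x i s j) = (∑ j, θ j * z j) + θ i * spinVal s := by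
    simp only [hz, mul_add, Finset.sum_add_distrib, mul_ite, mul_zero, Finset.sum_ite_eq',
      Finset.mem_univ, if_true]
  have h2 : ∀ a, ∑ c, M a c * spinVal (update x i s c) =
      (∑ c, M a c * z c) + M a i * spinVal s := by
    intro a
    simp only [hz, mul_add, Finset.sum_add_distrib, mul_ite, mul_zero, Finset.sum_ite_eq',
      Finset.mem_univ, if_true]
  have h3 : ∑ a, z a * M a i = ∑ c, M i c * z c :=
    Finset.sum_congr rfl fun a _ => by rw [hs.apply i a]; ring
  have h4 : ∑ c, M i c * z c = ∑ c, M i c * spinVal (x c) := by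
    refine Finset.sum_congr rfl fun c _ => ?_
    by_cases hc : c = i
    · subst hc; simp [hd]
    · simp [z, hc]
  have h5 : ∑ a, spinVal (update x i s a) * ∑ c, M a c * spinVal (update x i s c) =
      (∑ a, z a * ∑ c, M a c * z c) + 2 * (spinVal s * ∑ c, M i c * z c) := by
    have h6 : ∀ a, spinVal (update x i s a) * ∑ c, M a c * spinVal (update x i s c) =
        z a * (∑ c, M a c * z c) + z a * M a i * spinVal s +
          (if a = i then spinVal s * ((∑ c, M i c * z c) + M i i * spinVal s) else 0) := by
      intro a
      rw [h2, hz]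
      by_cases ha : a = i
      · subst ha; simp only [if_true]; ring
      · simp only [ha, if_false]; ring
    simp only [h6, Finset.sum_add_distrib, Finset.sum_ite_eq', Finset.mem_univ, if_true,
      ← Finset.sum_mul]
    rw [h3, hd i]
    ring
  rw [h1, h5, field, ← h4]
  ring

theorem avg_single_up (hs : M.IsSymm) (hd : ∀ i, M i i = 0) (x : Fin n → Spin) (i : Fin n) :
    avg (weight M θ) {i} x (up i) = Real.sigmoid (2 * field M θ i x) := by
  obtain ⟨C, hC, h⟩ := weight_update (θ := θ) hs hd x i
  have hne : update x i 1 ≠ update x i (-1) := fun e => by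
    have := congrFun e i
    simp at this
  rw [avg, cylinder_singleton, Finset.sum_pair hne, Finset.sum_pair hne, up_update_one,
    up_update_neg_one, h, h, spinVal_one, spinVal_neg_one, Real.sigmoid_def]
  set t := field M θ i x
  have e1 : Real.exp (-(2 * t)) = Real.exp (-1 * t) / Real.exp (1 * t) := by
    rw [← Real.exp_sub]; congr 1; ring
  rw [e1]
  have := Real.exp_pos (1 * t)
  have := Real.exp_pos (-1 * t)
  field_simp
  ring

/-- The derivative `σ (1 - σ)` is at most `1/4`. -/
theorem abs_sigmoid_sub_le (s t : ℝ) : |Real.sigmoid s - Real.sigmoid t| ≤ 1 / 4 * |s - t| := by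
  have := Convex.norm_image_sub_le_of_norm_hasDerivWithin_le (f := Real.sigmoid)
    (f' := fun x => Real.sigmoid x * (1 - Real.sigmoid x)) (s := Set.univ) (C := 1 / 4)
    (x := t) (y := s)
    (fun x _ => (Real.hasDerivAt_sigmoid x).hasDerivWithinAt) (fun x _ => ?_) convex_univ
    (Set.mem_univ _) (Set.mem_univ _)
  · simpa using this
  · have h1 := Real.sigmoid_pos x
    have h2 := Real.sigmoid_lt_one x
    rw [Real.norm_eq_abs, abs_of_nonneg (by nlinarith)]
    nlinarith [sq_nonneg (2 * Real.sigmoid x - 1)]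

theorem Tame.abs_entry_le {b α : ℝ} (h : Tame b α M θ) (i j : Fin n) : |M i j| ≤ α :=
  (Finset.single_le_sum (f := fun j => |M i j|) (fun _ _ => abs_nonneg _)
    (Finset.mem_univ j)).trans (h.row_sum i)

theorem Tame.abs_field_le {b α : ℝ} (h : Tame b α M θ) (i : Fin n) (x : Fin n → Spin) :
    |field M θ i x| ≤ b + α := by
  refine (abs_add_le _ _).trans (add_le_add (h.bias_le i) ((Finset.abs_sum_le_sum_abs _ _).trans
    (le_trans (le_of_eq ?_) (h.row_sum i))))
  exact Finset.sum_congr rfl fun j _ => by rw [abs_mul, abs_spinVal, mul_one]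

/-- Flipping `j` moves twice the local field by `4 * M i j`, which the Lipschitz constant `1/4` of
the sigmoid exactly absorbs. -/
theorem Tame.influence {b α : ℝ} (h : Tame b α M θ) (i : Fin n) :
    OscBound (fun x => avg (weight M θ) {i} x (up i)) fun j => |M i j| := by
  intro x j
  simp only [avg_single_up h.symm h.diag]
  refine (abs_sigmoid_sub_le _ _).trans ?_
  have h1 : ∀ s, field M θ i (update x j s) =
      field M θ i (update x j 1) + M i j * (spinVal s - 1) := by
    intro s
    rw [field, field, add_assoc]
    congr 1
    rw [← Finset.add_sum_erase _ _ (Finset.mem_univ j),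
      ← Finset.add_sum_erase _ (fun k => M i k * spinVal (update x j 1 k)) (Finset.mem_univ j),
      update_self, update_self, spinVal_one]
    rw [Finset.sum_congr rfl fun k hk => by
      rw [update_of_ne (Finset.ne_of_mem_erase hk), ← update_of_ne (Finset.ne_of_mem_erase hk) 1 x]]
    ring
  rw [h1 (-1), spinVal_neg_one]
  apply le_of_eq
  rw [show 2 * field M θ i (update x j 1) - 2 * (field M θ i (update x j 1) + M i j * (-1 - 1)) =
    4 * M i j by ring, abs_mul]
  norm_num
  ring

/-- A lower bound for the conditional probability of a spin given the others. -/
def floor (b α : ℝ) : ℝ := Real.sigmoid (-(2 * (b + α)))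

theorem floor_pos (b α : ℝ) : 0 < floor b α := Real.sigmoid_pos _

theorem Tame.floor_le {b α : ℝ} (h : Tame b α M θ) (i : Fin n) (x : Fin n → Spin) :
    floor b α ≤ avg (weight M θ) {i} x (up i) ∧
      avg (weight M θ) {i} x (up i) ≤ 1 - floor b α := by
  rw [avg_single_up h.symm h.diag, floor]
  have h1 := abs_le.1 (h.abs_field_le i x)
  constructor
  · exact Real.sigmoid_le (by linarith [h1.1])
  · rw [Real.sigmoid_neg, sub_sub_cancel]
    exact Real.sigmoid_le (by linarith [h1.2])

theorem Tame.floor_le_avg {b α : ℝ} (h : Tame b α M θ) {F : Finset (Fin n)} {i : Fin n}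
    (hi : i ∈ F) (x : Fin n → Spin) :
    floor b α ≤ avg (weight M θ) F x (up i) ∧ avg (weight M θ) F x (up i) ≤ 1 - floor b α :=
  avg_up_of_single (weight_pos M θ) (h.floor_le i) hi x

end Field

/-! ### Distances in the interaction graph and exponential decay -/

section Graph

variable {n : ℕ} {M : Matrix (Fin n) (Fin n) ℝ} {θ : Fin n → ℝ}

/-- There is a walk of length at most `k` from `i` to `j` in the interaction graph. -/
def Reach (M : Matrix (Fin n) (Fin n) ℝ) (k : ℕ) (i j : Fin n) : Prop :=
  ∃ p : (interactionGraph M).Walk i j, p.length ≤ k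

theorem Reach.mono {k l : ℕ} {i j : Fin n} (h : Reach M k i j) (hkl : k ≤ l) : Reach M l i j :=
  let ⟨p, hp⟩ := h
  ⟨p, hp.trans hkl⟩

theorem Reach.refl (k : ℕ) (i : Fin n) : Reach M k i i := ⟨.nil, Nat.zero_le k⟩

theorem Reach.trans {k l : ℕ} {i j m : Fin n} (h : Reach M k i j) (h' : Reach M l j m) :
    Reach M (k + l) i m :=
  let ⟨p, hp⟩ := h
  let ⟨q, hq⟩ := h'
  ⟨p.append q, by rw [SimpleGraph.Walk.length_append]; omega⟩

theorem adj_iff (hs : M.IsSymm) (hd : ∀ i, M i i = 0) {i j : Fin n} :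
    (interactionGraph M).Adj i j ↔ M i j ≠ 0 := by
  rw [interactionGraph, SimpleGraph.fromRel_adj]
  constructor
  · rintro ⟨-, h | h⟩
    · exact h
    · rwa [hs.apply i j] at h
  · intro h
    exact ⟨fun e => h (e ▸ hd i), Or.inl h⟩

theorem Reach.step (hs : M.IsSymm) (hd : ∀ i, M i i = 0) {k : ℕ} {t i j : Fin n}
    (h : Reach M k t i) (hij : M i j ≠ 0) : Reach M (k + 1) t j :=
  let ⟨p, hp⟩ := h
  ⟨p.concat ((adj_iff hs hd).2 hij), by rw [SimpleGraph.Walk.length_concat]; omega⟩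

-- Decompose by the first step of the walk: the ball of radius `k + 1` has at most `1 + d (d + 1) ^
-- k ≤ (d + 1) ^ (k + 1)` points.
open Classical in
theorem card_reach_le (hs : M.IsSymm) (hd : ∀ i, M i i = 0) {d : ℝ} (hd0 : 0 ≤ d)
    (hdeg : ∀ i, ((Finset.univ.filter fun j => M i j ≠ 0).card : ℝ) ≤ d) (k : ℕ) :
    ∀ i, ((Finset.univ.filter fun j => Reach M k i j).card : ℝ) ≤ (d + 1) ^ k := by
  induction k with
  | zero =>
    intro i
    have : (Finset.univ.filter fun j => Reach M 0 i j) ⊆ {i} := by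
      intro j hj
      obtain ⟨p, hp⟩ := (Finset.mem_filter.1 hj).2
      rw [Finset.mem_singleton]
      exact (SimpleGraph.Walk.eq_of_length_eq_zero (Nat.le_zero.1 hp)).symm
    have := Finset.card_le_card this
    simp only [pow_zero]
    exact_mod_cast this
  | succ k ih =>
    intro i
    have hsub : (Finset.univ.filter fun j => Reach M (k + 1) i j) ⊆
        {i} ∪ (Finset.univ.filter fun j => M i j ≠ 0).biUnion
          fun m => Finset.univ.filter fun j => Reach M k m j := by
      intro j hj
      obtain ⟨p, hp⟩ := (Finset.mem_filter.1 hj).2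
      rw [Finset.mem_union, Finset.mem_singleton, Finset.mem_biUnion]
      cases p with
      | nil => exact Or.inl rfl
      | @cons _ m _ hadj q =>
        refine Or.inr ⟨m, by simpa using (adj_iff hs hd).1 hadj, ?_⟩
        rw [SimpleGraph.Walk.length_cons] at hp
        exact Finset.mem_filter.2 ⟨Finset.mem_univ j, q, by omega⟩
    have h1 := (Finset.card_le_card hsub).trans (Finset.card_union_le _ _)
    have h2 : (((Finset.univ.filter fun j => M i j ≠ 0).biUnion
          fun m => Finset.univ.filter fun j => Reach M k m j).card : ℝ) ≤ d * (d + 1) ^ k := by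
      calc _ ≤ ((∑ m ∈ Finset.univ.filter fun j => M i j ≠ 0,
              (Finset.univ.filter fun j => Reach M k m j).card : ℕ) : ℝ) := by
            exact_mod_cast Finset.card_biUnion_le
        _ ≤ ∑ m ∈ Finset.univ.filter fun j => M i j ≠ 0, (d + 1) ^ k := by
            push_cast
            exact Finset.sum_le_sum fun m _ => ih m
        _ ≤ d * (d + 1) ^ k := by
            rw [Finset.sum_const, nsmul_eq_mul]
            exact mul_le_mul_of_nonneg_right (hdeg i) (by positivity)
    have h3 : (1 : ℝ) ≤ (d + 1) ^ k := one_le_pow₀ (by linarith)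
    rw [Finset.card_singleton] at h1
    calc _ ≤ ((1 + ((Finset.univ.filter fun j => M i j ≠ 0).biUnion
          fun m => Finset.univ.filter fun j => Reach M k m j).card : ℕ) : ℝ) := by
          exact_mod_cast h1
      _ ≤ 1 + d * (d + 1) ^ k := by push_cast; linarith
      _ ≤ (d + 1) ^ (k + 1) := by rw [pow_succ]; linarith

open Classical in
/-- The distance from `T` to `j` in the interaction graph, truncated at `R`. -/
def depth (M : Matrix (Fin n) (Fin n) ℝ) (R : ℕ) (T : Finset (Fin n)) (j : Fin n) : ℕ :=
  ((Finset.range R).filter fun k => ∀ t ∈ T, ¬ Reach M k t j).card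

theorem depth_of_mem {R : ℕ} {T : Finset (Fin n)} {t : Fin n} (ht : t ∈ T) :
    depth M R T t = 0 := by
  classical
  rw [depth, Finset.card_eq_zero, Finset.filter_eq_empty_iff]
  exact fun k _ h => h t ht (Reach.refl k t)

theorem depth_eq {R : ℕ} {T : Finset (Fin n)} {j : Fin n} (h : ∀ t ∈ T, ¬ Reach M R t j) :
    depth M R T j = R := by
  classical
  rw [depth, Finset.filter_true_of_mem, Finset.card_range]
  exact fun k hk t ht hr => h t ht (hr.mono (Finset.mem_range.1 hk).le)

/-- If `j` is not reached within `k + 1` steps then its neighbour `i` is not reached within `k`. The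
value `k = 0` accounts for the extra 1. -/
theorem depth_le (hs : M.IsSymm) (hd : ∀ i, M i i = 0) (R : ℕ) (T : Finset (Fin n)) {i j : Fin n}
    (hij : M i j ≠ 0) : depth M R T j ≤ depth M R T i + 1 := by
  classical
  have hsub : ((Finset.range R).filter fun k => ∀ t ∈ T, ¬ Reach M k t j) ⊆
      insert 0 (((Finset.range R).filter fun k => ∀ t ∈ T, ¬ Reach M k t i).image (· + 1)) := by
    intro k hk
    rw [Finset.mem_filter, Finset.mem_range] at hk
    rw [Finset.mem_insert, Finset.mem_image]
    rcases k with _ | k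
    · exact Or.inl rfl
    · refine Or.inr ⟨k, ?_, rfl⟩
      rw [Finset.mem_filter, Finset.mem_range]
      exact ⟨by omega, fun t ht hr => hk.2 t ht (hr.step hs hd hij)⟩
  calc _ = ((Finset.range R).filter fun k => ∀ t ∈ T, ¬ Reach M k t j).card := by
        rw [depth]
    _ ≤ _ := (Finset.card_le_card hsub).trans (Finset.card_insert_le _ _)
    _ ≤ _ := by
        rw [depth]
        exact Nat.add_le_add_right Finset.card_image_le 1

/-- Neighbouring weights differ by a factor at most 2, which doubles the contraction constant. This
is where row sums below `1/2`, and not merely below 1, are needed. -/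
theorem Tame.dobrushin {b α : ℝ} (h : Tame b α M θ) (R : ℕ) (T : Finset (Fin n)) :
    Dobrushin (weight M θ) (fun i j => |M i j|) (fun j => 2 ^ depth M R T j) (2 * α) where
  weight_pos := weight_pos M θ
  influence := h.influence
  pos i := by positivity
  contract i := by
    calc ∑ j, |M i j| * 2 ^ depth M R T j ≤ ∑ j, |M i j| * (2 * 2 ^ depth M R T i) := by
          refine Finset.sum_le_sum fun j _ => ?_
          by_cases hij : M i j = 0
          · simp [hij]
          · refine mul_le_mul_of_nonneg_left ?_ (abs_nonneg _)
            rw [← pow_succ']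
            exact pow_le_pow_right₀ (by norm_num) (depth_le h.symm h.diag R T hij)
      _ = (∑ j, |M i j|) * (2 * 2 ^ depth M R T i) := by rw [Finset.sum_mul]
      _ ≤ α * (2 * 2 ^ depth M R T i) :=
          mul_le_mul_of_nonneg_right (h.row_sum i) (by positivity)
      _ = 2 * α * 2 ^ depth M R T i := by ring
  lt_one := by linarith [h.lt_half]

/-- A function of the spins in `T` is nearly uncorrelated with the spin at a vertex far from
`T`. -/
theorem Tame.abs_cov_le_of_not_reach {b α : ℝ} (h : Tame b α M θ) (R : ℕ) {T : Finset (Fin n)}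
    {a : Fin n} (ha : ∀ t ∈ T, ¬ Reach M R t a) (F : Finset (Fin n)) (x : Fin n → Spin)
    {f : (Fin n → Spin) → ℝ} (hf : ∀ y, |f y| ≤ 1)
    (hfT : ∀ y i s, i ∉ T → f (update y i s) = f y) :
    |cov (weight M θ) F x a f| ≤ T.card / 2 ^ R := by
  -- All the oscillation of `f` sits on `T`, where the weight is 1, whereas the weight at `a` is `2
  -- ^ R`.
  have ho : OscBound f fun i => if i ∈ T then 2 else 0 := by
    intro y i
    by_cases hi : i ∈ T
    · simp only [if_pos hi]
      calc _ ≤ |f (update y i 1)| + |f (update y i (-1))| := abs_sub _ _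
        _ ≤ 1 + 1 := add_le_add (hf _) (hf _)
        _ = 2 := by norm_num
    · simp only [if_neg hi]
      rw [hfT y i 1 hi, hfT y i (-1) hi, sub_self, abs_zero]
  refine ((h.dobrushin R T).abs_cov_le F x a ho).trans (le_of_eq ?_)
  rw [depth_eq ha]
  have : ∑ i, (2 : ℝ) ^ depth M R T i * (if i ∈ T then 2 else 0) = 2 * T.card := by
    simp only [mul_ite, mul_zero]
    rw [Finset.sum_ite_mem, Finset.univ_inter, Finset.sum_congr rfl fun i hi => by
      rw [depth_of_mem hi], Finset.sum_const, nsmul_eq_mul]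
    ring
  rw [this]
  field_simp

end Graph

/-! ### Deleting an edge in a graph of large girth -/

section Edge

variable {n : ℕ} {M : Matrix (Fin n) (Fin n) ℝ} {θ : Fin n → ℝ} {a b : Fin n}

/-- The interaction matrix without the edge between `a` and `b`. -/
def deleteEdge (M : Matrix (Fin n) (Fin n) ℝ) (a b : Fin n) : Matrix (Fin n) (Fin n) ℝ :=
  fun i j => if (i = a ∧ j = b) ∨ (i = b ∧ j = a) then 0 else M i j

theorem deleteEdge_symm (hs : M.IsSymm) : (deleteEdge M a b).IsSymm := by
  refine Matrix.IsSymm.ext fun i j => ?_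
  rw [deleteEdge, deleteEdge, hs.apply]
  congr 1
  exact propext (by tauto)

theorem Tame.deleteEdge {β α : ℝ} (h : Tame β α M θ) (a b : Fin n) :
    Tame β α (Gibbs.deleteEdge M a b) θ where
  symm := deleteEdge_symm h.symm
  diag i := by rw [Gibbs.deleteEdge, h.diag, ite_self]
  row_sum i := le_trans (Finset.sum_le_sum fun j _ => by
    rw [Gibbs.deleteEdge]; split_ifs <;> simp) (h.row_sum i)
  bias_le := h.bias_le
  lt_half := h.lt_half
  nonneg := h.nonneg

theorem deleteEdge_graph_le (M : Matrix (Fin n) (Fin n) ℝ) (a b : Fin n) :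
    interactionGraph (deleteEdge M a b) ≤ interactionGraph M := by
  intro i j h
  rw [interactionGraph, SimpleGraph.fromRel_adj] at h ⊢
  refine ⟨h.1, h.2.imp ?_ ?_⟩ <;>
  · intro h' h0
    apply h'
    rw [deleteEdge, h0, ite_self]

theorem deleteEdge_not_adj : ¬ (interactionGraph (deleteEdge M a b)).Adj a b := by
  rw [interactionGraph, SimpleGraph.fromRel_adj]
  simp [deleteEdge]

/-- Every cycle of the interaction graph is longer than `r`. -/
def Girth (r : ℝ) (M : Matrix (Fin n) (Fin n) ℝ) : Prop :=
  ∀ (v : Fin n) (c : (interactionGraph M).Walk v v), c.IsCycle → r < (c.length : ℝ)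

theorem Girth.deleteEdge {r : ℝ} (h : Girth r M) (a b : Fin n) : Girth r (Gibbs.deleteEdge M a b) := by
  intro v c hc
  have := h v (c.mapLe (deleteEdge_graph_le M a b)) (hc.mapLe _)
  simpa using this

/-- A path from `b` back to `a` that avoids the edge `ab` closes up with this edge to a cycle of
length at most `k + 1`. -/
theorem Girth.lt_of_reach {r : ℝ} (h : Girth r M) (hab : (interactionGraph M).Adj a b) {k : ℕ}
    (hr : Reach (Gibbs.deleteEdge M a b) k b a) : r < k + 1 := by
  classical
  obtain ⟨p, hp⟩ := hr
  have hle := deleteEdge_graph_le M a b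
  have hc : (SimpleGraph.Walk.cons hab (p.bypass.mapLe hle)).IsCycle := by
    rw [SimpleGraph.Walk.cons_isCycle_iff]
    refine ⟨p.bypass_isPath.mapLe hle, fun hmem => ?_⟩
    rw [SimpleGraph.Walk.edges_mapLe_eq_edges] at hmem
    exact deleteEdge_not_adj (SimpleGraph.Walk.edges_subset_edgeSet _ hmem)
  have h1 := h a _ hc
  have h2 : p.bypass.length ≤ k := p.length_bypass_le_length.trans hp
  refine h1.trans_le ?_
  rw [SimpleGraph.Walk.length_cons]
  push_cast
  have h3 : ((p.bypass.mapLe hle).length : ℝ) = p.bypass.length := by simp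
  rw [h3]
  exact_mod_cast Nat.add_le_add_right h2 1

/-- Shorten the walk to a path. After its first edge a path never returns to `a`, so the rest
survives the deletion of that edge. -/
theorem Reach.exists_first_edge {k : ℕ} {u : Fin n} (h : Reach M (k + 1) a u) (hau : a ≠ u) :
    ∃ b, (interactionGraph M).Adj a b ∧ Reach (deleteEdge M a b) k b u := by
  classical
  obtain ⟨p, hp⟩ := h
  have h1 : p.bypass.length ≤ k + 1 := p.length_bypass_le_length.trans hp
  have h2 := p.bypass_isPath
  revert h1 h2
  generalize p.bypass = q
  intro h1 h2
  cases q with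
  | nil => exact absurd rfl hau
  | @cons _ b _ hadj q =>
    rw [SimpleGraph.Walk.cons_isPath_iff] at h2
    rw [SimpleGraph.Walk.length_cons] at h1
    refine ⟨b, hadj, q.transfer _ fun e he => ?_, by
      rw [SimpleGraph.Walk.length_transfer]; omega⟩
    have he' := q.edges_subset_edgeSet he
    induction e with
    | _ i j =>
    rw [SimpleGraph.mem_edgeSet] at he' ⊢
    have hi : i ≠ a := fun e => h2.2 (e ▸ q.fst_mem_support_of_mem_edges he)
    have hj : j ≠ a := fun e => h2.2 (e ▸ q.snd_mem_support_of_mem_edges he)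
    rw [interactionGraph, SimpleGraph.fromRel_adj] at he' ⊢
    simpa [deleteEdge, hi, hj] using he'

/-- The high-temperature identity `exp (t σ) = cosh t * (1 + σ * tanh t)` for `σ = ±1`, applied to
the product of the two end spins. -/
theorem weight_deleteEdge (hs : M.IsSymm) (hab : a ≠ b) (x : Fin n → Spin) :
    weight M θ x = Real.cosh (M a b) * (weight (deleteEdge M a b) θ x *
      (1 + Real.tanh (M a b) * (spinVal (x a) * spinVal (x b)))) := by
  have h1 : weight M θ x = weight (deleteEdge M a b) θ x *
      Real.exp (M a b * (spinVal (x a) * spinVal (x b))) := by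
    rw [weight, weight, ← Real.exp_add]
    congr 1
    have h2 : ∀ i, ∑ j, M i j * spinVal (x j) = ∑ j, deleteEdge M a b i j * spinVal (x j) +
        ((if i = a then M a b * spinVal (x b) else 0) +
          (if i = b then M a b * spinVal (x a) else 0)) := by
      intro i
      have h3 : ∀ j, M i j * spinVal (x j) = deleteEdge M a b i j * spinVal (x j) +
          ((if j = b then (if i = a then M a b * spinVal (x b) else 0) else 0) +
            (if j = a then (if i = b then M a b * spinVal (x a) else 0) else 0)) := by
        intro j
        rw [deleteEdge]
        by_cases hia : i = a
        · subst hia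
          by_cases hjb : j = b
          · subst hjb; simp [hab, hab.symm]
          · simp [hjb, hab]
        · by_cases hib : i = b
          · subst hib
            by_cases hja : j = a
            · subst hja; simp [hab, hab.symm, hs.apply]
            · simp [hja, hab.symm]
          · simp [hia, hib]
      rw [Finset.sum_congr rfl fun j _ => h3 j]
      simp only [Finset.sum_add_distrib, Finset.sum_ite_eq', Finset.mem_univ, if_true]
    simp only [h2, mul_add, Finset.sum_add_distrib, mul_ite, mul_zero, Finset.sum_ite_eq',
      Finset.mem_univ, if_true]
    ring
  rw [h1]
  have hc := (Real.cosh_pos (M a b)).ne'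
  have h4 : Real.cosh (M a b) * (1 + Real.tanh (M a b) * (spinVal (x a) * spinVal (x b))) =
      Real.exp (M a b * (spinVal (x a) * spinVal (x b))) := by
    rw [Real.tanh_eq_sinh_div_cosh]
    have h5 : spinVal (x a) * spinVal (x b) = 1 ∨ spinVal (x a) * spinVal (x b) = -1 := by
      rcases spin_cases (x a) with h | h <;> rcases spin_cases (x b) with h' | h' <;>
        simp [h, h', spinVal_one, spinVal_neg_one]
    generalize M a b = t at hc ⊢
    rcases h5 with h5 | h5 <;> rw [h5]
    · rw [mul_one, mul_one, ← Real.cosh_add_sinh]; field_simp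
    · rw [show t * -1 = -t by ring, ← Real.cosh_sub_sinh]; field_simp; ring
  rw [← h4]
  ring

end Edge

end Gibbs

end

noncomputable section

namespace Gibbs

open Ising Function

/-! ### Conditional against unconditional covariances -/

section Compare

variable {n : ℕ} {M : Matrix (Fin n) (Fin n) ℝ} {θ : Fin n → ℝ} {a b : Fin n}

/-- The spin at `u` as a function of the configuration. -/
def spinAt (u : Fin n) (y : Fin n → Spin) : ℝ := spinVal (y u)

theorem abs_spinAt (u : Fin n) (y : Fin n → Spin) : |spinAt u y| = 1 := abs_spinVal _

/-- Change of measure: averages with the edge become ratios of moments without it, and the constant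
`cosh` drops out. -/
theorem avg_eq_div_of_weight {w w₀ g : (Fin n → Spin) → ℝ} {κ : ℝ} (hκ : κ ≠ 0)
    (hw₀ : ∀ x, 0 < w₀ x) (h : ∀ x, w x = κ * (w₀ x * g x)) (F : Finset (Fin n))
    (x : Fin n → Spin) (f : (Fin n → Spin) → ℝ) :
    avg w F x f = avg w₀ F x (fun y => f y * g y) / avg w₀ F x g := by
  have hp := (sum_cylinder_pos hw₀ F x).ne'
  have h1 : ∑ y ∈ cylinder F x, w y * f y = κ * ∑ y ∈ cylinder F x, w₀ y * (f y * g y) := by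
    rw [Finset.mul_sum]
    exact Finset.sum_congr rfl fun y _ => by rw [h]; ring
  have h2 : ∑ y ∈ cylinder F x, w y = κ * ∑ y ∈ cylinder F x, w₀ y * g y := by
    rw [Finset.mul_sum]
    exact Finset.sum_congr rfl fun y _ => h y
  rw [avg, avg, avg, h1, h2, mul_div_mul_left _ _ hκ, div_div_div_cancel_right₀ hp]

/-- The covariance of two spins after adding an edge, in terms of moments of the model without
this edge. -/
theorem abs_edge_moments_le {t m mb mu mbu eb eu ebu η : ℝ} (ht : |t| ≤ 1 / 2) (hm : |m| ≤ 1)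
    (hmb : |mb| ≤ 1) (hmu : |mu| ≤ 1) (hmbu : |mbu| ≤ 1) (hb : |m * mb + eb| ≤ 1)
    (heb : |eb| ≤ η) (heu : |eu| ≤ η) (hebu : |ebu| ≤ η) :
    |(m * mu + eu + t * mbu) / (1 + t * (m * mb + eb)) -
        (m + t * mb) / (1 + t * (m * mb + eb)) *
          ((mu + t * (m * mbu + ebu)) / (1 + t * (m * mb + eb))) -
        t * (1 - m ^ 2) * (mbu - mb * mu) / (1 + t * (m * mb + eb)) ^ 2| ≤ 16 * η ∧
      1 / 2 ≤ 1 + t * (m * mb + eb) ∧ 1 + t * (m * mb + eb) ≤ 2 := by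
  have hη : 0 ≤ η := (abs_nonneg _).trans heb
  have htb : |t * (m * mb + eb)| ≤ 1 / 2 := by
    rw [abs_mul]; nlinarith [abs_nonneg t, abs_nonneg (m * mb + eb)]
  have hD1 : 1 / 2 ≤ 1 + t * (m * mb + eb) := by linarith [(abs_le.1 htb).1]
  have hD2 : 1 + t * (m * mb + eb) ≤ 2 := by linarith [(abs_le.1 htb).2]
  refine ⟨?_, hD1, hD2⟩
  set D := 1 + t * (m * mb + eb) with hD
  have hD0 : D ≠ 0 := by linarith
  -- If `a` were exactly independent of `b` and `u` the difference would vanish. Each term left over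
  -- carries one of the errors `eb`, `eu`, `ebu`, and `D ^ 2 ≥ 1/4` turns `4η` into `16η`.
  have e : (m * mu + eu + t * mbu) / D - (m + t * mb) / D * ((mu + t * (m * mbu + ebu)) / D) -
      t * (1 - m ^ 2) * (mbu - mb * mu) / D ^ 2 =
      (eu * D + (m * mu + t * mbu) * (t * eb) - (m + t * mb) * (t * ebu)) / D ^ 2 := by
    field_simp
    rw [hD]
    ring
  rw [e, abs_div, abs_of_nonneg (sq_nonneg D), div_le_iff₀ (by positivity)]
  have b1 : |eu * D| ≤ 2 * η := by
    rw [abs_mul, abs_of_nonneg (by linarith : (0 : ℝ) ≤ D)]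
    nlinarith [abs_nonneg eu]
  have b2 : |m * mu + t * mbu| ≤ 3 / 2 := by
    refine (abs_add_le _ _).trans ?_
    rw [abs_mul, abs_mul]
    have := mul_le_mul hm hmu (abs_nonneg _) zero_le_one
    have := mul_le_mul ht hmbu (abs_nonneg _) (by norm_num)
    linarith
  have b3 : |m + t * mb| ≤ 3 / 2 := by
    refine (abs_add_le _ _).trans ?_
    rw [abs_mul]
    have := mul_le_mul ht hmb (abs_nonneg _) (by norm_num)
    linarith
  have b4 : ∀ z, |z| ≤ η → |t * z| ≤ 1 / 2 * η := fun z hz => by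
    rw [abs_mul]; exact mul_le_mul ht hz (abs_nonneg _) (by norm_num)
  have b5 : |(m * mu + t * mbu) * (t * eb)| ≤ 3 / 2 * (1 / 2 * η) := by
    rw [abs_mul]; exact mul_le_mul b2 (b4 _ heb) (abs_nonneg _) (by norm_num)
  have b6 : |(m + t * mb) * (t * ebu)| ≤ 3 / 2 * (1 / 2 * η) := by
    rw [abs_mul]; exact mul_le_mul b3 (b4 _ hebu) (abs_nonneg _) (by norm_num)
  have b7 : |eu * D + (m * mu + t * mbu) * (t * eb) - (m + t * mb) * (t * ebu)| ≤ 4 * η := by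
    refine (abs_sub _ _).trans ((add_le_add_left (abs_add_le _ _) _).trans ?_)
    linarith
  have b8 : 1 / 4 ≤ D ^ 2 := by nlinarith
  nlinarith

/-- The hyperbolic tangent is a rescaled sigmoid, so the Lipschitz bound for the latter applies. -/
theorem abs_tanh_le (t : ℝ) : |Real.tanh t| ≤ |t| := by
  have h1 : Real.tanh t = 2 * (Real.sigmoid (2 * t) - Real.sigmoid 0) := by
    rw [Real.tanh_eq_sinh_div_cosh, Real.sigmoid_def, Real.sigmoid_zero, Real.sinh_eq,
      Real.cosh_eq, show -(2 * t) = -t - t by ring, Real.exp_sub]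
    have := Real.exp_pos t
    have := Real.exp_pos (-t)
    field_simp
    ring
  rw [h1, abs_mul, abs_two]
  have := abs_sigmoid_sub_le (2 * t) 0
  rw [sub_zero, abs_mul, abs_two] at this
  linarith

/-- Deleting the first edge of a short path from `a` to `u` in a graph of large girth: the
covariance of the spins at `a` and `u` is a multiple of the covariance of the spins at `b` and `u`
without this edge, up to a small error. -/
theorem Tame.cov_deleteEdge {β α : ℝ} (h : Tame β α M θ) (hab : a ≠ b) {R : ℕ} {u : Fin n}
    (hb : ¬ Reach (Gibbs.deleteEdge M a b) R b a) (hu : ¬ Reach (Gibbs.deleteEdge M a b) R u a)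
    (F : Finset (Fin n)) (x : Fin n → Spin) :
    ∃ D : ℝ, 1 / 2 ≤ D ∧ D ≤ 2 ∧
      |cov (weight M θ) F x a (spinAt u) - Real.tanh (M a b) *
        (1 - avg (weight (Gibbs.deleteEdge M a b) θ) F x (spinAt a) ^ 2) *
          cov (weight (Gibbs.deleteEdge M a b) θ) F x b (spinAt u) / D ^ 2| ≤
        16 * (2 / 2 ^ R) := by
  set M₀ := Gibbs.deleteEdge M a b
  have h₀ : Tame β α M₀ θ := h.deleteEdge a b
  have hw₀ := weight_pos M₀ θ
  set t := Real.tanh (M a b)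
  have ht : |t| ≤ 1 / 2 := ((abs_tanh_le _).trans (h.abs_entry_le a b)).trans h.lt_half.le
  set A : ((Fin n → Spin) → ℝ) → ℝ := avg (weight M₀ θ) F x with hA
  have hAle : ∀ f : (Fin n → Spin) → ℝ, (∀ y, |f y| ≤ 1) → |A f| ≤ 1 :=
    fun f hf => avg_abs_le hw₀ fun y _ => hf y
  -- Without the edge, `a` is far from both `b` and `u`, so its spin nearly decouples from every
  -- bounded function of their two spins, including the product.
  have hT : ∀ v ∈ ({b, u} : Finset (Fin n)), ¬ Reach M₀ R v a := by
    intro v hv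
    rcases Finset.mem_insert.1 hv with rfl | hv
    · exact hb
    · rw [Finset.mem_singleton.1 hv]; exact hu
  have hcov : ∀ f : (Fin n → Spin) → ℝ, (∀ y, |f y| ≤ 1) →
      (∀ y i s, i ∉ ({b, u} : Finset (Fin n)) → f (update y i s) = f y) →
      |A (fun y => spinVal (y a) * f y) - A (spinAt a) * A f| ≤ 2 / 2 ^ R := by
    intro f hf hf'
    refine (h₀.abs_cov_le_of_not_reach R hT F x hf hf').trans ?_
    gcongr
    exact_mod_cast Finset.card_le_two
  have hprod : ∀ y : Fin n → Spin, |spinVal (y b) * spinVal (y u)| ≤ 1 := fun y => by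
    rw [abs_mul, abs_spinVal, abs_spinVal, mul_one]
  have hne : ∀ {i : Fin n}, i ∉ ({b, u} : Finset (Fin n)) → b ≠ i ∧ u ≠ i := by
    intro i hi
    simp only [Finset.mem_insert, Finset.mem_singleton, not_or] at hi
    exact ⟨fun e => hi.1 e.symm, fun e => hi.2 e.symm⟩
  have heb := hcov (spinAt b) (fun y => (abs_spinAt b y).le) fun y i s hi => by
    rw [spinAt, spinAt, update_of_ne (hne hi).1]
  have heu := hcov (spinAt u) (fun y => (abs_spinAt u y).le) fun y i s hi => by
    rw [spinAt, spinAt, update_of_ne (hne hi).2]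
  have hebu := hcov (fun y => spinVal (y b) * spinVal (y u)) hprod fun y i s hi => by
    rw [update_of_ne (hne hi).1, update_of_ne (hne hi).2]
  set m := A (spinAt a)
  set mb := A (spinAt b) with hmb
  set mu := A (spinAt u) with hmu
  set mbu := A fun y => spinVal (y b) * spinVal (y u) with hmbu
  set eb := A (fun y => spinVal (y a) * spinAt b y) - m * mb with hebd
  set eu := A (fun y => spinVal (y a) * spinAt u y) - m * mu with heud
  set ebu := A (fun y => spinVal (y a) * (spinVal (y b) * spinVal (y u))) - m * mbu with hebud
  have hb1 : m * mb + eb = A (fun y => spinVal (y a) * spinAt b y) := by rw [hebd]; ring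
  obtain ⟨h1, h2, h3⟩ := abs_edge_moments_le (m := m) (mb := mb) (mu := mu) (mbu := mbu) ht
    (hAle _ fun y => (abs_spinAt a y).le) (hAle _ fun y => (abs_spinAt b y).le)
    (hAle _ fun y => (abs_spinAt u y).le) (hAle _ hprod)
    (by
      rw [hb1]
      refine hAle _ fun y => ?_
      rw [abs_mul, abs_spinVal, abs_spinAt, mul_one]) heb heu hebu
  refine ⟨_, h2, h3, le_trans (le_of_eq ?_) h1⟩
  have hdiv := fun f => avg_eq_div_of_weight (Real.cosh_pos (M a b)).ne' hw₀
    (weight_deleteEdge (θ := θ) h.symm hab) F x f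
  have hadd : ∀ f g : (Fin n → Spin) → ℝ, A (fun y => f y + g y) = A f + A g :=
    avg_add F x
  have hmul : ∀ (κ : ℝ) (f : (Fin n → Spin) → ℝ), A (fun y => κ * f y) = κ * A f :=
    avg_const_mul F x
  have hAD : A (fun y => 1 + t * (spinVal (y a) * spinVal (y b))) = 1 + t * (m * mb + eb) := by
    rw [hadd, hmul, hA, avg_const hw₀, hb1]; rfl
  -- A spin squares to 1, so against the edge factor a spin at `a` is traded for a spin at `b`. This
  -- expresses all moments with the edge through those without it.
  have hsq : ∀ y : Fin n → Spin, spinVal (y a) * spinVal (y a) = 1 := fun y => spinVal_mul_self _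
  have hAau : A (fun y => spinVal (y a) * spinAt u y * (1 + t * (spinVal (y a) * spinVal (y b)))) =
      m * mu + eu + t * mbu := by
    rw [show m * mu + eu = A (fun y => spinVal (y a) * spinAt u y) by rw [heud]; ring, hmbu,
      ← hmul, ← hadd]
    congr 1
    funext y
    rw [spinAt]
    linear_combination t * spinVal (y u) * spinVal (y b) * hsq y
  have hAa : A (fun y => spinVal (y a) * (1 + t * (spinVal (y a) * spinVal (y b)))) =
      m + t * mb := by
    rw [hmb, ← hmul, show m = A (spinAt a) from rfl, ← hadd]
    congr 1
    funext y
    rw [spinAt, spinAt]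
    linear_combination t * spinVal (y b) * hsq y
  have hAu : A (fun y => spinAt u y * (1 + t * (spinVal (y a) * spinVal (y b)))) =
      mu + t * (m * mbu + ebu) := by
    rw [show m * mbu + ebu = A (fun y => spinVal (y a) * (spinVal (y b) * spinVal (y u))) by
      rw [hebud]; ring, hmu, ← hmul, ← hadd]
    congr 1
    funext y
    rw [spinAt]
    ring
  have hc0 : cov (weight M₀ θ) F x b (spinAt u) = mbu - mb * mu := rfl
  rw [hc0, cov, hdiv, hdiv, hdiv]
  change |A _ / A _ - A _ / A _ * (A _ / A _) - _| = _
  rw [hAD, hAau, hAa, hAu]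

theorem one_sub_sq_avg_spinAt (hw : ∀ x, 0 < weight M θ x) (F : Finset (Fin n)) (x : Fin n → Spin)
    (a : Fin n) : 1 - avg (weight M θ) F x (spinAt a) ^ 2 =
      4 * avg (weight M θ) F x (up a) * (1 - avg (weight M θ) F x (up a)) := by
  have : avg (weight M θ) F x (spinAt a) = 2 * avg (weight M θ) F x (up a) - 1 := by
    rw [← avg_const_mul, ← avg_const hw F x 1, ← avg_sub]
    exact avg_congr fun y _ => spinVal_eq_up y a
  rw [this]
  ring

theorem cov_self (hw : ∀ x, 0 < weight M θ x) (F : Finset (Fin n)) (x : Fin n → Spin) (a : Fin n) :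
    cov (weight M θ) F x a (spinAt a) = 1 - avg (weight M θ) F x (spinAt a) ^ 2 := by
  rw [cov, avg_of_const_on hw (f := fun y => spinVal (y a) * spinAt a y) (a := 1)
    fun y _ => spinVal_mul_self _, sq]
  rfl

theorem floor_le_half {b α : ℝ} (h : Tame b α M θ) (i : Fin n) : floor b α ≤ 1 / 2 := by
  have := h.floor_le i fun _ => 1
  linarith [this.1, this.2]

/-- The variance is `4q(1 - q)` with `q` between `c` and `1 - c` for the floor `c ≤ 1/2`, hence at
least `4c(1 - c) ≥ 2c`. -/
theorem Tame.variance_ge {b α : ℝ} (h : Tame b α M θ) (x : Fin n → Spin) (a : Fin n) :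
    2 * floor b α ≤ 1 - avg (weight M θ) Finset.univ x (spinAt a) ^ 2 := by
  rw [one_sub_sq_avg_spinAt (weight_pos M θ)]
  have h1 := h.floor_le_avg (Finset.mem_univ a) x
  have h2 := floor_le_half h a
  set q := avg (weight M θ) Finset.univ x (up a)
  have := floor_pos b α
  nlinarith [mul_nonneg (sub_nonneg.2 h1.1) (sub_nonneg.2 h1.2)]

/-- One edge of the induction; primes mark the conditioned model. The unconditioned relation gives
`|t| |C₀| ≤ (2 / c)(|C| + 16η)` and the conditioned one gives `|C'| ≤ 4 |t| |C₀'| + 16η`. Keeping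
`|t|` attached to the covariances avoids dividing by it, for the edge weight may be arbitrarily
small. The additive error does not grow because the surplus `16η`, multiplied by `K ≥ 16`, absorbs
the new errors. -/
theorem compare_step {c t C C' C₀ C₀' v v' D D' η K L : ℝ} (hc : 0 < c) (hc2 : c ≤ 1 / 2)
    (hη : 0 ≤ η) (ht : |t| ≤ 1 / 2) (hv : 2 * c ≤ v) (hv' : 0 ≤ v') (hv1 : v' ≤ 1)
    (hD : 1 / 2 ≤ D) (hD2 : D ≤ 2) (hD' : 1 / 2 ≤ D') (hK : K = 8 / c) (hL : 1 ≤ L)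
    (h : |C - t * v * C₀ / D ^ 2| ≤ 16 * η) (h' : |C' - t * v' * C₀' / D' ^ 2| ≤ 16 * η)
    (ih : |C₀'| ≤ L * (|C₀| + 32 * η)) : |C'| ≤ K * L * (|C| + 32 * η) := by
  have hKc : K * c = 8 := by rw [hK]; field_simp
  have hK16 : 16 ≤ K := by
    rw [hK, le_div_iff₀ hc]; linarith
  have h1 : |t| * |C₀| * c ≤ 2 * (|C| + 16 * η) := by
    have e1 : |t * v * C₀ / D ^ 2| ≤ |C| + 16 * η := by
      have := abs_sub_abs_le_abs_sub (t * v * C₀ / D ^ 2) C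
      rw [abs_sub_comm] at this
      linarith
    rw [abs_div, abs_mul, abs_mul, abs_of_nonneg (sq_nonneg D),
      abs_of_nonneg (by linarith : 0 ≤ v), div_le_iff₀ (by positivity)] at e1
    have e2 : D ^ 2 ≤ 4 := by nlinarith
    have e3 : (|C| + 16 * η) * D ^ 2 ≤ (|C| + 16 * η) * 4 :=
      mul_le_mul_of_nonneg_left e2 (by positivity)
    have e4 : |t| * (2 * c) * |C₀| ≤ |t| * v * |C₀| := by gcongr
    nlinarith
  have h2 : |C'| ≤ 4 * (|t| * |C₀'|) + 16 * η := by
    have e1 : |t * v' * C₀' / D' ^ 2| ≤ 4 * (|t| * |C₀'|) := by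
      rw [abs_div, abs_mul, abs_mul, abs_of_nonneg (sq_nonneg D'), abs_of_nonneg hv',
        div_le_iff₀ (by positivity)]
      have e2 : 1 / 4 ≤ D' ^ 2 := by nlinarith
      have e3 : |t| * v' * |C₀'| ≤ |t| * |C₀'| := by
        have : |t| * v' ≤ |t| * 1 := mul_le_mul_of_nonneg_left hv1 (abs_nonneg _)
        rw [mul_one] at this
        exact mul_le_mul_of_nonneg_right this (abs_nonneg _)
      have e4 : 0 ≤ |t| * |C₀'| := by positivity
      nlinarith
    have := abs_sub_abs_le_abs_sub C' (t * v' * C₀' / D' ^ 2)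
    linarith
  have h3 : |t| * |C₀'| ≤ L * (|t| * |C₀|) + L * (16 * η) := by
    calc |t| * |C₀'| ≤ |t| * (L * (|C₀| + 32 * η)) :=
          mul_le_mul_of_nonneg_left ih (abs_nonneg _)
      _ = L * (|t| * |C₀|) + L * (|t| * (32 * η)) := by ring
      _ ≤ L * (|t| * |C₀|) + L * (1 / 2 * (32 * η)) := by gcongr
      _ = _ := by ring
  have h4 : |t| * |C₀| ≤ K / 4 * (|C| + 16 * η) := by
    rw [hK, show 8 / c / 4 * (|C| + 16 * η) = (2 * (|C| + 16 * η)) / c by ring, le_div_iff₀ hc]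
    exact h1
  have h5 : L * (|t| * |C₀|) ≤ L * (K / 4 * (|C| + 16 * η)) :=
    mul_le_mul_of_nonneg_left h4 (by linarith)
  have h6 : |C'| ≤ L * (K * (|C| + 16 * η)) + L * (64 * η) + 16 * η := by
    nlinarith
  have h7 : 16 * η ≤ L * (16 * η) := by nlinarith
  have h8 : L * (5 * (16 * η)) ≤ L * (K * (16 * η)) := by
    have : 5 * (16 * η) ≤ K * (16 * η) := by nlinarith
    exact mul_le_mul_of_nonneg_left this (by linarith)
  nlinarith

/-- In a graph of large girth, conditioning increases the covariance of two spins at a bounded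
distance by at most a constant factor, up to a small error. -/
theorem abs_cov_le_of_reach {β α r : ℝ} {R : ℕ} (k : ℕ) :
    ∀ {M : Matrix (Fin n) (Fin n) ℝ} {a u : Fin n}, Tame β α M θ → Girth r M →
      (R : ℝ) + k ≤ r → Reach M k a u → ∀ (F : Finset (Fin n)) (x x' : Fin n → Spin),
        |cov (weight M θ) F x a (spinAt u)| ≤ (8 / floor β α) ^ (k + 1) *
          (|cov (weight M θ) Finset.univ x' a (spinAt u)| + 32 * (2 / 2 ^ R)) := by
  have hc := floor_pos β α
  have hη : (0 : ℝ) ≤ 2 / 2 ^ R := by positivity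
  -- For `u = a` the covariances are variances: at most 1 under conditioning, at least twice the
  -- floor without.
  have base : ∀ (k : ℕ) {M : Matrix (Fin n) (Fin n) ℝ} {a : Fin n}, Tame β α M θ →
      ∀ (F : Finset (Fin n)) (x x' : Fin n → Spin),
        |cov (weight M θ) F x a (spinAt a)| ≤ (8 / floor β α) ^ (k + 1) *
          (|cov (weight M θ) Finset.univ x' a (spinAt a)| + 32 * (2 / 2 ^ R)) := by
    intro k M a h F x x'
    have hw := weight_pos M θ
    have h1 : |cov (weight M θ) F x a (spinAt a)| ≤ 1 := by
      rw [cov_self hw]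
      have h2 : |avg (weight M θ) F x (spinAt a)| ≤ 1 :=
        avg_abs_le hw fun y _ => (abs_spinAt a y).le
      rw [abs_of_nonneg] <;> nlinarith [sq_nonneg (avg (weight M θ) F x (spinAt a)), abs_le.1 h2]
    have h2 : 2 * floor β α ≤ |cov (weight M θ) Finset.univ x' a (spinAt a)| := by
      rw [cov_self hw]
      exact (h.variance_ge x' a).trans (le_abs_self _)
    have h3 := floor_le_half h a
    have h4 : 1 ≤ (8 / floor β α) := by rw [le_div_iff₀ hc]; linarith
    have h5 : 8 / floor β α ≤ (8 / floor β α) ^ (k + 1) := le_self_pow₀ h4 (by omega)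
    calc _ ≤ (1 : ℝ) := h1
      _ ≤ 8 / floor β α * (2 * floor β α) := by field_simp; norm_num
      _ ≤ (8 / floor β α) ^ (k + 1) *
          (|cov (weight M θ) Finset.univ x' a (spinAt a)| + 32 * (2 / 2 ^ R)) := by
        gcongr
        linarith
  induction k with
  | zero =>
    intro M a u h _ _ hr
    obtain ⟨p, hp⟩ := hr
    have := SimpleGraph.Walk.eq_of_length_eq_zero (Nat.le_zero.1 hp)
    subst this
    exact base 0 h
  | succ k ih =>
    intro M a u h hg hR hr F x x'
    by_cases hau : a = u
    · subst hau
      exact base (k + 1) h F x x'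
    · obtain ⟨b, hadj, hbu⟩ := hr.exists_first_edge hau
      push_cast at hR
      have h₀ := h.deleteEdge a b
      -- A return to `a` within `R` steps, from `b` directly or from `u` after the at most `k` steps
      -- from `b`, would close a cycle of length at most `R + k + 1 ≤ r`.
      have hb : ¬ Reach (Gibbs.deleteEdge M a b) R b a := fun hr' => by
        have := hg.lt_of_reach hadj hr'
        have : (0 : ℝ) ≤ k := Nat.cast_nonneg k
        linarith
      have hu : ¬ Reach (Gibbs.deleteEdge M a b) R u a := fun hr' => by
        have := hg.lt_of_reach hadj (hbu.trans hr')
        push_cast at this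
        linarith
      obtain ⟨D', hD', -, e'⟩ := h.cov_deleteEdge hadj.ne hb hu F x
      obtain ⟨D, hD, hD2, e⟩ := h.cov_deleteEdge hadj.ne hb hu Finset.univ x'
      have hK : (1 : ℝ) ≤ 8 / floor β α := by
        rw [le_div_iff₀ hc]; linarith [floor_le_half h a]
      have hv : |avg (weight (Gibbs.deleteEdge M a b) θ) F x (spinAt a)| ≤ 1 :=
        avg_abs_le (weight_pos _ θ) fun y _ => (abs_spinAt a y).le
      rw [pow_succ' _ (k + 1)]
      exact compare_step hc (floor_le_half h a) hη
        (((abs_tanh_le _).trans (h.abs_entry_le a b)).trans h.lt_half.le)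
        (h₀.variance_ge x' a) (by nlinarith [abs_le.1 hv])
        (by nlinarith [sq_nonneg (avg (weight (Gibbs.deleteEdge M a b) θ) F x (spinAt a))])
        hD hD2 hD' rfl (one_le_pow₀ hK) e e'
        (ih h₀ (hg.deleteEdge a b) (by linarith) hbu F x x')

end Compare

end Gibbs

end

noncomputable section

namespace Gibbs

open Ising Function

/-! ### Conditioning on the correlated visible vertices only -/

section Bias

variable {n : ℕ} {M : Matrix (Fin n) (Fin n) ℝ} {θ : Fin n → ℝ}

/-- The free vertices when the visible vertices other than `v` are fixed. -/
def hidden (S : Finset (Fin n)) (v : Fin n) : Finset (Fin n) := insert v Sᶜ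

theorem mem_hidden {S : Finset (Fin n)} {v i : Fin n} : i ∈ hidden S v ↔ i = v ∨ i ∉ S := by
  simp [hidden]

/-- The indicator of the configurations that agree with `x` on `l`. -/
def agree (l : Finset (Fin n)) (x y : Fin n → Spin) : ℝ := if ∀ u ∈ l, y u = x u then 1 else 0

theorem agree_nonneg (l : Finset (Fin n)) (x y : Fin n → Spin) : 0 ≤ agree l x y := by
  unfold agree; split_ifs <;> norm_num

theorem agree_congr {l : Finset (Fin n)} {x y z : Fin n → Spin} (h : ∀ u ∈ l, y u = z u) :
    agree l x y = agree l x z := by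
  unfold agree
  congr 1
  exact propext (forall₂_congr fun u hu => by rw [h u hu])

/-- By `cov_insert` the covariance is `2q(1 - q)` times the jump of the mean spin, which is twice
the jump of the probability; and `2q(1 - q)` is at least the floor. -/
theorem abs_avg_up_sub_le {b α : ℝ} (h : Tame b α M θ) {F : Finset (Fin n)} {u : Fin n}
    (hu : u ∉ F) (v : Fin n) (x : Fin n → Spin) :
    |avg (weight M θ) F (update x u 1) (up v) - avg (weight M θ) F (update x u (-1)) (up v)| ≤
      |cov (weight M θ) (insert u F) x u (spinAt v)| / (2 * floor b α) := by
  have hw := weight_pos M θ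
  have hs : ∀ y, avg (weight M θ) F y (spinAt v) = 2 * avg (weight M θ) F y (up v) - 1 := by
    intro y
    rw [← avg_const_mul, ← avg_const hw F y 1, ← avg_sub]
    exact avg_congr fun z _ => spinVal_eq_up z v
  rw [cov_insert hw hu, hs, hs]
  have h1 := h.floor_le_avg (Finset.mem_insert_self u F) x
  have h2 := floor_pos b α
  have h3 := floor_le_half h u
  set q := avg (weight M θ) (insert u F) x (up u)
  set g := avg (weight M θ) F (update x u 1) (up v)
  set g' := avg (weight M θ) F (update x u (-1)) (up v)
  rw [show 2 * g - 1 - (2 * g' - 1) = 2 * (g - g') by ring, abs_mul, abs_mul _ (g - g'), abs_two,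
    le_div_iff₀ (by linarith)]
  have h4 : floor b α ≤ 2 * q * (1 - q) := by
    nlinarith [mul_nonneg (sub_nonneg.2 h1.1) (sub_nonneg.2 h1.2)]
  rw [abs_of_nonneg (h2.le.trans h4)]
  nlinarith [mul_le_mul_of_nonneg_right h4 (abs_nonneg (g - g'))]

/-- The visible vertices that are weakly correlated with `v` have little joint influence on it. -/
theorem Tame.abs_conditional_sub_le {b α r d κ : ℝ} (h : Tame b α M θ) (hg : Girth r M)
    (hd0 : 0 ≤ d) (hdeg : ∀ i, ((Finset.univ.filter fun j => M i j ≠ 0).card : ℝ) ≤ d)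
    {R ℓ : ℕ} (hR : (R : ℝ) + ℓ ≤ r) {S : Finset (Fin n)} {v : Fin n} {l : Finset (Fin n)}
    (x₀ : Fin n → Spin) (hκ0 : 0 ≤ κ)
    (hκ : ∀ u ∈ S, u ≠ v → u ∉ l → |cov (weight M θ) Finset.univ x₀ u (spinAt v)| ≤ κ)
    {x y : Fin n → Spin} (hxy : ∀ u ∈ l, x u = y u) :
    |avg (weight M θ) (hidden S v) x (up v) - avg (weight M θ) (hidden S v) y (up v)| ≤
      1 / 2 ^ ℓ + (d + 1) ^ ℓ *
        ((8 / floor b α) ^ (ℓ + 1) * (κ + 32 * (2 / 2 ^ R)) / (2 * floor b α)) := by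
  classical
  set B := (8 / floor b α) ^ (ℓ + 1) * (κ + 32 * (2 / 2 ^ R)) / (2 * floor b α)
  have hc := floor_pos b α
  have hB : 0 ≤ B := by positivity
  have hvF : v ∈ hidden S v := mem_hidden.2 (Or.inl rfl)
  obtain ⟨o, ho, hoF, hosum⟩ := (h.dobrushin ℓ {v}).exists_oscBound_up hvF
  rw [depth_of_mem (Finset.mem_singleton_self v), pow_zero, mul_one] at hosum
  -- Two bounds are merged: `B`, from the comparison of covariances, at vertices near `v` and
  -- outside `l`, and the Dobrushin bound `o` elsewhere. Only vertices outside `l` will matter.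
  have ho' : OscBound (fun x => avg (weight M θ) (hidden S v) x (up v))
      fun j => if j ∉ l ∧ Reach M ℓ v j then B else o j := by
    intro z u
    by_cases hu : u ∉ l ∧ Reach M ℓ v u
    · simp only [if_pos hu]
      by_cases huF : u ∈ hidden S v
      · rw [OscBound.of_avg_boundary z huF 1 (-1), sub_self, abs_zero]
        exact hB
      · have huF' := huF
        rw [mem_hidden, not_or, not_not] at huF'
        refine (abs_avg_up_sub_le h huF v z).trans ?_
        refine div_le_div_of_nonneg_right ?_ (by linarith)
        obtain ⟨p, hp⟩ := hu.2
        refine (abs_cov_le_of_reach ℓ h hg hR ⟨p.reverse, by simpa using hp⟩ _ z x₀).trans ?_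
        gcongr
        exact hκ u huF'.2 huF'.1 hu.1
    · simp only [if_neg hu]
      exact ho z u
  refine (ho'.abs_sub_le x y).trans ?_
  -- A vertex beyond distance `ℓ` has weight `2 ^ ℓ`, so all of these together contribute at most `2
  -- ^ (-ℓ)` of the weighted sum. The near ones are merely counted.
  have h1 : ∀ j, (if x j ≠ y j then (if j ∉ l ∧ Reach M ℓ v j then B else o j) else 0) ≤
      1 / 2 ^ ℓ * (2 ^ depth M ℓ {v} j * o j) + (if Reach M ℓ v j then B else 0) := by
    intro j
    have hoj := ho.nonneg j
    have h0 : 0 ≤ 1 / 2 ^ ℓ * (2 ^ depth M ℓ {v} j * o j) := by positivity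
    have h0' : 0 ≤ if Reach M ℓ v j then B else 0 := by split_ifs <;> simp [hB]
    by_cases hj : x j ≠ y j
    · rw [if_pos hj]
      have hjl : j ∉ l := fun hjl => hj (hxy j hjl)
      by_cases hr : Reach M ℓ v j
      · rw [if_pos ⟨hjl, hr⟩, if_pos hr]
        linarith
      · rw [if_neg fun h => hr h.2, if_neg hr, depth_eq fun t ht => by
          rw [Finset.mem_singleton.1 ht]; exact hr]
        field_simp
        linarith
    · rw [if_neg hj]
      linarith
  refine (Finset.sum_le_sum fun j _ => h1 j).trans ?_
  rw [Finset.sum_add_distrib, ← Finset.mul_sum, ← Finset.sum_filter, Finset.sum_const,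
    nsmul_eq_mul]
  refine add_le_add ?_ (mul_le_mul_of_nonneg_right (card_reach_le h.symm h.diag hd0 hdeg ℓ v) hB)
  have h2 : 2 * α ≤ 1 := by linarith [h.lt_half]
  calc _ ≤ 1 / 2 ^ ℓ * (1 : ℝ) := by gcongr; exact hosum.trans h2
    _ = _ := mul_one _

/-- The indicator depends on visible spins other than `v` only, so it can be pulled out of the
conditional average given those spins. -/
theorem avg_up_mul_agree {S : Finset (Fin n)} {v : Fin n}
    {l : Finset (Fin n)} (hl : l ⊆ S.erase v) (x x₀ : Fin n → Spin) :
    avg (weight M θ) Finset.univ x₀ (fun y => up v y * agree l x y) =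
      avg (weight M θ) Finset.univ x₀
        fun y => avg (weight M θ) (hidden S v) y (up v) * agree l x y := by
  rw [← avg_avg (weight_pos M θ) (Finset.subset_univ (hidden S v))]
  refine avg_congr fun y _ => ?_
  rw [avg_congr (g := fun z => agree l x z * up v z) fun z _ => mul_comm _ _,
    avg_mul_of_const_on (a := agree l x y), mul_comm]
  intro z hz
  refine agree_congr fun u hu => mem_cylinder.1 hz u ?_
  have := Finset.mem_erase.1 (hl hu)
  rw [mem_hidden]
  simpa [not_or] using this

theorem avg_up_mul_agree_erase (S : Finset (Fin n)) (v : Fin n) (x x₀ : Fin n → Spin) :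
    avg (weight M θ) Finset.univ x₀ (fun y => up v y * agree (S.erase v) x y) =
      avg (weight M θ) (hidden S v) x (up v) *
        avg (weight M θ) Finset.univ x₀ (agree (S.erase v) x) := by
  rw [avg_up_mul_agree le_rfl, ← avg_const_mul]
  refine avg_congr fun y _ => ?_
  by_cases h : ∀ u ∈ S.erase v, y u = x u
  · congr 1
    refine avg_boundary (fun i hi => h i ?_) _
    rw [mem_hidden] at hi
    simpa [not_or] using hi
  · rw [agree, if_neg h, mul_zero, mul_zero]

/-- Conditioning on a set `l` of visible vertices instead of all of them. -/
theorem abs_avg_up_mul_agree_sub_le {S : Finset (Fin n)} {v : Fin n} {l : Finset (Fin n)}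
    (hl : l ⊆ S.erase v) {x x₀ : Fin n → Spin} {δ : ℝ}
    (hδ : ∀ y, (∀ u ∈ l, y u = x u) →
      |avg (weight M θ) (hidden S v) y (up v) - avg (weight M θ) (hidden S v) x (up v)| ≤ δ) :
    |avg (weight M θ) Finset.univ x₀ (fun y => up v y * agree l x y) -
      avg (weight M θ) (hidden S v) x (up v) * avg (weight M θ) Finset.univ x₀ (agree l x)| ≤
      δ * avg (weight M θ) Finset.univ x₀ (agree l x) := by
  rw [avg_up_mul_agree hl, ← avg_const_mul, ← avg_sub]
  have h1 : ∀ y, |avg (weight M θ) (hidden S v) y (up v) * agree l x y -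
      avg (weight M θ) (hidden S v) x (up v) * agree l x y| ≤ δ * agree l x y := by
    intro y
    rw [← sub_mul, abs_mul, abs_of_nonneg (agree_nonneg l x y)]
    by_cases h : ∀ u ∈ l, y u = x u
    · exact mul_le_mul_of_nonneg_right (hδ y h) (agree_nonneg l x y)
    · rw [agree, if_neg h, mul_zero, mul_zero]
  have hw := weight_pos M θ
  rw [abs_le, ← neg_mul, ← avg_const_mul, ← avg_const_mul]
  exact ⟨avg_mono hw fun y _ => by linarith [(abs_le.1 (h1 y)).1],
    avg_mono hw fun y _ => (abs_le.1 (h1 y)).2⟩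

/-- Prescribe the spins one at a time: given all other spins, each takes the prescribed value with
probability at least the floor. -/
theorem Tame.floor_pow_le {b α : ℝ} (h : Tame b α M θ) (l : Finset (Fin n))
    (x x₀ : Fin n → Spin) :
    floor b α ^ l.card ≤ avg (weight M θ) Finset.univ x₀ (agree l x) := by
  have hw := weight_pos M θ
  induction l using Finset.induction_on with
  | empty =>
    rw [avg_of_const_on hw (a := 1) fun y _ => by simp [agree]]
    simp
  | insert i l hi ih =>
    rw [Finset.card_insert_of_notMem hi, pow_succ', ← avg_avg hw (Finset.subset_univ {i})]
    refine (mul_le_mul_of_nonneg_left ih (floor_pos b α).le).trans ?_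
    rw [← avg_const_mul]
    refine avg_mono hw fun y _ => ?_
    have h1 : ∀ z ∈ cylinder {i} y, agree (insert i l) x z =
        agree l x y * (if x i = 1 then up i z else 1 - up i z) := by
      intro z hz
      rw [agree_congr (l := l) (y := y) (z := z) fun u hu => (mem_cylinder.1 hz u fun hui => hi
        (Finset.mem_singleton.1 hui ▸ hu)).symm]
      simp only [agree, Finset.forall_mem_insert, up]
      rcases spin_cases (x i) with hx | hx <;> rcases spin_cases (z i) with hz | hz <;>
        simp [hx, hz]
    rw [avg_congr h1, avg_const_mul, mul_comm]
    refine mul_le_mul_of_nonneg_left ?_ (agree_nonneg l x y)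
    have h2 := h.floor_le i y
    split_ifs with hx
    · exact h2.1
    · rw [avg_sub, avg_const hw]
      linarith [h2.2]

end Bias

/-! ### The censored law and its conditional probabilities -/

section Censored

variable {n : ℕ} {M : Matrix (Fin n) (Fin n) ℝ} {θ : Fin n → ℝ} {S : Finset (Fin n)}

/-- Extension of a configuration on the visible vertices. -/
def extend (z : S → Spin) (i : Fin n) : Spin := if h : i ∈ S then z ⟨i, h⟩ else 1

theorem extend_coe (z : S → Spin) (i : S) : extend z i = z i := by
  simp [extend]

theorem isingModel_apply (M : Matrix (Fin n) (Fin n) ℝ) (θ : Fin n → ℝ) (x : Fin n → Spin) :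
    isingModel M θ x = ENNReal.ofReal (weight M θ x / ∑ y, weight M θ y) := by
  rw [isingModel, PMF.normalize_apply, tsum_fintype,
    ← ENNReal.ofReal_sum_of_nonneg fun y _ => (weight_pos M θ y).le,
    ENNReal.ofReal_div_of_pos (Finset.sum_pos (fun y _ => weight_pos M θ y) ⟨x, Finset.mem_univ x⟩),
    div_eq_mul_inv]

/-- The bridge between the laws of the statement and the averages of the proof. The boundary `x₀` is
arbitrary since all vertices are free. -/
theorem sum_censored (h : (S → Spin) → ℝ) (x₀ : Fin n → Spin) :
    ∑ z, (censored S M θ z).toReal * h z =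
      avg (weight M θ) Finset.univ x₀ fun y => h fun i => y i := by
  have h1 : ∀ z, (censored S M θ z).toReal =
      ∑ y, if z = (fun i : S => y i) then weight M θ y / ∑ y, weight M θ y else 0 := by
    intro z
    rw [censored, PMF.map_apply, tsum_fintype, ENNReal.toReal_sum]
    · refine Finset.sum_congr rfl fun y _ => ?_
      split_ifs
      · rw [isingModel_apply, ENNReal.toReal_ofReal (div_nonneg (weight_pos M θ y).le
          (Finset.sum_nonneg fun y _ => (weight_pos M θ y).le))]
      · rfl
    · intro y _
      split_ifs
      · exact PMF.apply_ne_top _ _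
      · exact ENNReal.zero_ne_top
  rw [avg, cylinder_univ, Finset.sum_div]
  simp only [h1, Finset.sum_mul]
  rw [Finset.sum_comm]
  refine Finset.sum_congr rfl fun y _ => ?_
  simp only [ite_mul, zero_mul, Finset.sum_ite_eq', Finset.mem_univ, if_true]
  ring

/-- The conditional probability of spin `1` at `v` given the other visible spins. -/
def conditional (M : Matrix (Fin n) (Fin n) ℝ) (θ : Fin n → ℝ) (v : S) (z : S → Spin) : ℝ :=
  avg (weight M θ) (hidden S v) (extend z) (up (v : Fin n))

theorem conditional_mem (v : S) (z : S → Spin) :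
    0 ≤ conditional M θ v z ∧ conditional M θ v z ≤ 1 :=
  avg_up_mem (weight_pos M θ) _ _ _

/-- The oscillation bound survives averaging over the hidden spins, so the visible dynamics inherits
a Dobrushin condition although the censored law is no Ising model on `S`. -/
theorem Tame.conditional_contract {b α : ℝ} (h : Tame b α M θ) (v : S) :
    ∃ o : S → ℝ, (∀ u, 0 ≤ o u) ∧ ∑ u, o u ≤ 2 * α ∧ ∀ z z' : S → Spin,
      |conditional M θ v z - conditional M θ v z'| ≤ ∑ u, if z u ≠ z' u then o u else 0 := by
  have hvF : (v : Fin n) ∈ hidden S v := mem_hidden.2 (Or.inl rfl)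
  -- Truncating distances at 0 makes every weight equal to 1, so the bound is on the plain total
  -- influence.
  obtain ⟨o, ho, hoF, hosum⟩ := (h.dobrushin 0 {(v : Fin n)}).exists_oscBound_up hvF
  have hdep : ∀ j, depth M 0 {(v : Fin n)} j = 0 := fun j => by simp [depth]
  simp only [hdep, pow_zero, one_mul, mul_one] at hosum
  have hsum : ∀ f : Fin n → ℝ, (∀ i, i ∉ S → f i = 0) → ∑ i, f i = ∑ u : S, f u := by
    intro f hf
    rw [Finset.sum_coe_sort S f]
    exact (Finset.sum_subset (Finset.subset_univ S) fun i _ hi => hf i hi).symm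
  have hoS : ∀ i, i ∉ S → o i = 0 := fun i hi => hoF i (mem_hidden.2 (Or.inr hi))
  refine ⟨fun u => o u, fun u => ho.nonneg u, by rw [← hsum o hoS]; exact hosum, fun z z' => ?_⟩
  refine (ho.abs_sub_le (extend z) (extend z')).trans (le_of_eq ?_)
  rw [hsum _ fun i hi => by simp [hoS i hi]]
  simp only [extend_coe]

/-- The two masses add up to the probability that the visible spins other than `v` agree with `z`,
so this is the definition of a conditional probability. It provides stationarity of the exact
dynamics. -/
theorem censored_update {v : S} (z : S → Spin) :
    (censored S M θ (update z v 1)).toReal = conditional M θ v z *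
        ((censored S M θ (update z v 1)).toReal + (censored S M θ (update z v (-1))).toReal) := by
  have h1 : ∀ z', (censored S M θ z').toReal = avg (weight M θ) Finset.univ (fun _ => 1)
      fun y => if (fun i : S => y i) = z' then (1 : ℝ) else 0 := by
    intro z'
    rw [← sum_censored (fun z => if z = z' then (1 : ℝ) else 0)]
    simp
  have h2 : ∀ (y : Fin n → Spin) s, (if (fun i : S => y i) = update z v s then (1 : ℝ) else 0) =
      (if y v = s then 1 else 0) * agree (S.erase v) (extend z) y := by
    intro y s
    have : (fun i : S => y i) = update z v s ↔ y v = s ∧ ∀ u ∈ S.erase v, y u = extend z u := by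
      rw [funext_iff]
      constructor
      · intro h
        refine ⟨by simpa using h v, fun u hu => ?_⟩
        rw [Finset.mem_erase] at hu
        have h' := h ⟨u, hu.2⟩
        rw [update_of_ne fun e => hu.1 (congrArg Subtype.val e)] at h'
        rw [← extend_coe z ⟨u, hu.2⟩] at h'
        exact h'
      · rintro ⟨h, h'⟩ u
        by_cases huv : u = v
        · subst huv; simpa using h
        · rw [update_of_ne huv, ← extend_coe z u]
          exact h' u (Finset.mem_erase.2 ⟨fun e => huv (Subtype.ext e), u.2⟩)
    simp only [this, agree, ite_and, ite_mul, one_mul, zero_mul]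
  have h3 : (censored S M θ (update z v 1)).toReal = avg (weight M θ) Finset.univ (fun _ => 1)
      fun y => up (v : Fin n) y * agree (S.erase v) (extend z) y := by
    rw [h1]
    exact avg_congr fun y _ => h2 y 1
  have h4 : (censored S M θ (update z v 1)).toReal + (censored S M θ (update z v (-1))).toReal =
      avg (weight M θ) Finset.univ (fun _ => 1) (agree (S.erase v) (extend z)) := by
    rw [h1, h1, ← avg_add]
    refine avg_congr fun y _ => ?_
    rw [h2, h2, ← add_mul]
    rcases spin_cases (y v) with h | h <;> simp [h]
  rw [h4, h3, avg_up_mul_agree_erase]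
  rfl

end Censored

end Gibbs

end

noncomputable section

namespace Glauber

open Ising Function RandAlg

/-! ### Expectations under discrete laws -/

section Expectation

variable {α β : Type}

/-- The expectation of a nonnegative function. -/
def expect (p : PMF α) (F : α → ℝ≥0∞) : ℝ≥0∞ := ∑' a, p a * F a

theorem expect_bind (p : PMF α) (f : α → PMF β) (F : β → ℝ≥0∞) :
    expect (p.bind f) F = expect p fun a => expect (f a) F := by
  simp only [expect, PMF.bind_apply, ← ENNReal.tsum_mul_right, ← ENNReal.tsum_mul_left]
  rw [ENNReal.tsum_comm]
  exact tsum_congr fun a => tsum_congr fun b => mul_assoc _ _ _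

theorem expect_pure (a : α) (F : α → ℝ≥0∞) : expect (PMF.pure a) F = F a := by
  rw [expect, tsum_eq_single a fun b hb => by rw [PMF.pure_apply_of_ne _ _ hb, zero_mul],
    PMF.pure_apply_self, one_mul]

theorem expect_map (p : PMF α) (f : α → β) (F : β → ℝ≥0∞) :
    expect (p.map f) F = expect p fun a => F (f a) := by
  rw [PMF.map, expect_bind]
  simp only [comp_apply, expect_pure]

theorem expect_mono (p : PMF α) {F G : α → ℝ≥0∞} (h : ∀ a, F a ≤ G a) : expect p F ≤ expect p G :=
  ENNReal.tsum_le_tsum fun a => by gcongr; exact h a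

theorem expect_const (p : PMF α) (c : ℝ≥0∞) : expect p (fun _ => c) = c := by
  rw [expect, ENNReal.tsum_mul_right, PMF.tsum_coe, one_mul]

theorem expect_add (p : PMF α) (F G : α → ℝ≥0∞) :
    expect p (fun a => F a + G a) = expect p F + expect p G := by
  simp only [expect, mul_add]
  exact ENNReal.tsum_add

theorem expect_const_mul (p : PMF α) (c : ℝ≥0∞) (F : α → ℝ≥0∞) :
    expect p (fun a => c * F a) = c * expect p F := by
  simp only [expect, ← ENNReal.tsum_mul_left]
  exact tsum_congr fun a => mul_left_comm _ _ _

theorem expect_sum {ι : Type} (p : PMF α) (s : Finset ι) (F : ι → α → ℝ≥0∞) :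
    expect p (fun a => ∑ i ∈ s, F i a) = ∑ i ∈ s, expect p (F i) := by
  classical
  induction s using Finset.induction_on with
  | empty => simp only [Finset.sum_empty]; exact expect_const p 0
  | insert i s hi ih => simp only [Finset.sum_insert hi, expect_add, ih]

end Expectation

/-! ### Coupling two biased coins through one uniform variable -/

section Coin

theorem measurable_decide_lt (q : ℝ) : Measurable fun t : ℝ => decide (t < q) := by
  refine measurable_to_bool ?_
  have : (fun t : ℝ => decide (t < q)) ⁻¹' {true} = Set.Iio q := by ext t; simp
  rw [this]
  exact measurableSet_Iio

theorem measurable_coins (p q : ℝ) :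
    Measurable fun t : ℝ => (decide (t < p), decide (t < q)) :=
  (measurable_decide_lt p).prodMk (measurable_decide_lt q)

theorem uniformBelow_apply (q : ℝ) (c : Bool) :
    uniformBelow q c = volume.restrict (Set.Icc (0 : ℝ) 1) {t | decide (t < q) = c} := by
  have h1 : MeasurableSet {t : ℝ | decide (t < q) = c} :=
    measurable_decide_lt q (measurableSet_singleton c)
  rw [uniformBelow, PMF.ofFintype_apply, Measure.restrict_apply h1]
  cases c
  · simp only [Bool.false_eq_true, if_false]
    congr 1
    ext t
    simp [and_comm]
  · simp only [if_true]
    congr 1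
    ext t
    simp [and_comm]

theorem uniformBelow_true {q : ℝ} (h1 : q ≤ 1) : uniformBelow q true = ENNReal.ofReal q := by
  rw [uniformBelow, PMF.ofFintype_apply, if_pos rfl]
  have : Set.Icc (0 : ℝ) 1 ∩ Set.Iio q = Set.Ico 0 q := by
    ext t
    simp only [Set.mem_inter_iff, Set.mem_Icc, Set.mem_Iio, Set.mem_Ico]
    constructor
    · rintro ⟨⟨h, -⟩, h'⟩; exact ⟨h, h'⟩
    · rintro ⟨h, h'⟩; exact ⟨⟨h, by linarith⟩, h'⟩
  rw [this, Real.volume_Ico, sub_zero]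

theorem uniformBelow_false {q : ℝ} (h0 : 0 ≤ q) : uniformBelow q false = ENNReal.ofReal (1 - q) := by
  rw [uniformBelow, PMF.ofFintype_apply, if_neg Bool.false_ne_true]
  have : Set.Icc (0 : ℝ) 1 \ Set.Iio q = Set.Icc q 1 := by
    ext t
    simp only [Set.mem_sdiff, Set.mem_Icc, Set.mem_Iio, not_lt]
    constructor
    · rintro ⟨⟨-, h⟩, h'⟩; exact ⟨h', h⟩
    · rintro ⟨h, h'⟩; exact ⟨⟨by linarith, h'⟩, h⟩
  rw [this, Real.volume_Icc]

/-- The joint law of the truth values of `t < p` and `t < q` for `t` uniform on `[0, 1]`. -/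
def coinCoupling (p q : ℝ) : PMF (Bool × Bool) :=
  haveI : IsProbabilityMeasure (volume.restrict (Set.Icc (0 : ℝ) 1)) := ⟨by simp⟩
  haveI : IsProbabilityMeasure ((volume.restrict (Set.Icc (0 : ℝ) 1)).map
      fun t => (decide (t < p), decide (t < q))) :=
    Measure.isProbabilityMeasure_map (measurable_coins p q).aemeasurable
  ((volume.restrict (Set.Icc (0 : ℝ) 1)).map fun t => (decide (t < p), decide (t < q))).toPMF

theorem coinCoupling_toMeasure (p q : ℝ) (s : Set (Bool × Bool)) :
    (coinCoupling p q).toMeasure s =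
      volume.restrict (Set.Icc (0 : ℝ) 1) {t | (decide (t < p), decide (t < q)) ∈ s} := by
  rw [coinCoupling, Measure.toPMF_toMeasure, Measure.map_apply (measurable_coins p q)
    s.toFinite.measurableSet]
  rfl

theorem coinCoupling_fst (p q : ℝ) : (coinCoupling p q).map Prod.fst = uniformBelow p := by
  ext c
  rw [← PMF.toMeasure_apply_singleton _ _ (measurableSet_singleton c),
    PMF.toMeasure_map_apply _ _ _ measurable_fst (measurableSet_singleton c),
    coinCoupling_toMeasure, uniformBelow_apply]
  rfl

theorem coinCoupling_snd (p q : ℝ) : (coinCoupling p q).map Prod.snd = uniformBelow q := by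
  ext c
  rw [← PMF.toMeasure_apply_singleton _ _ (measurableSet_singleton c),
    PMF.toMeasure_map_apply _ _ _ measurable_snd (measurableSet_singleton c),
    coinCoupling_toMeasure, uniformBelow_apply]
  rfl

/-- The coins disagree only when the common uniform variable falls between `p` and `q`. -/
theorem expect_coinCoupling_ne_le (p q : ℝ) :
    expect (coinCoupling p q) (fun c => if c.1 ≠ c.2 then 1 else 0) ≤ ENNReal.ofReal |p - q| := by
  have h : expect (coinCoupling p q) (fun c => if c.1 ≠ c.2 then 1 else 0) =
      (coinCoupling p q).toMeasure {c | c.1 ≠ c.2} := by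
    rw [PMF.toMeasure_apply _ (Set.toFinite _).measurableSet, expect]
    refine tsum_congr fun c => ?_
    by_cases hc : c.1 ≠ c.2 <;> simp [Set.indicator, hc]
  rw [h, coinCoupling_toMeasure]
  have hsub : {t : ℝ | (decide (t < p), decide (t < q)) ∈ {c : Bool × Bool | c.1 ≠ c.2}} ⊆
      Set.Ico (min p q) (max p q) := by
    intro t ht
    have ht' : ¬ (t < p ↔ t < q) := by simpa using ht
    rw [Set.mem_Ico, min_le_iff, lt_max_iff]
    constructor
    · by_contra h
      push Not at h
      exact ht' ⟨fun _ => h.2, fun _ => h.1⟩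
    · by_contra h
      push Not at h
      exact ht' ⟨fun h' => absurd h' (not_lt.2 h.1), fun h' => absurd h' (not_lt.2 h.2)⟩
  refine (Measure.restrict_apply_le _ _).trans ((measure_mono hsub).trans ?_)
  rw [Real.volume_Ico, max_sub_min_eq_abs, abs_sub_comm]

end Coin

/-! ### Stationarity and contraction of Glauber dynamics -/

section Dynamics

variable {V : Type} [Fintype V] [DecidableEq V]

/-- The spin chosen according to a coin flip. -/
def spinOf (c : Bool) : Spin := if c then 1 else -1

/-- Resample the spin at `v`: it becomes `1` with probability `f v x`. -/
def siteStep (f : V → (V → Spin) → ℝ) (v : V) (x : V → Spin) : PMF (V → Spin) :=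
  (uniformBelow (f v x)).map fun c => update x v (spinOf c)

/-- One step of the dynamics: resample the spin at a uniformly random vertex. -/
def step {k : ℕ} (e : Fin (k + 1) → V) (f : V → (V → Spin) → ℝ) (x : V → Spin) : PMF (V → Spin) :=
  (PMF.uniformOfFintype (Fin (k + 1))).bind fun i => siteStep f (e i) x

/-- The law after `T` steps of the dynamics from `x₀`. -/
def law {k : ℕ} (e : Fin (k + 1) → V) (f : V → (V → Spin) → ℝ) (x₀ : V → Spin) :
    ℕ → PMF (V → Spin)
  | 0 => PMF.pure x₀
  | T + 1 => (law e f x₀ T).bind (step e f)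

/-- Resampling a spin from its conditional law given the others preserves the joint law. -/
theorem bind_siteStep {Q : PMF (V → Spin)} {g : V → (V → Spin) → ℝ} {v : V}
    (hg : ∀ z, 0 ≤ g v z ∧ g v z ≤ 1) (hgv : ∀ z s, g v (update z v s) = g v z)
    (hQ : ∀ z, (Q (update z v 1)).toReal =
      g v z * ((Q (update z v 1)).toReal + (Q (update z v (-1))).toReal)) :
    Q.bind (siteStep g v) = Q := by
  ext z
  set κ : ℝ≥0∞ := if z v = 1 then ENNReal.ofReal (g v z) else ENNReal.ofReal (1 - g v z) with hκ
  -- Only the two configurations equal to `z` off `v` can lead to `z`, and both do so with the same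
  -- probability `κ`, since `g v` ignores the spin at `v`.
  have h1 : ∀ y, siteStep g v y z =
      (if y = update z v 1 then κ else 0) + (if y = update z v (-1) then κ else 0) := by
    intro y
    have hne : ∀ s t : Spin, s ≠ t → update z v s ≠ update z v t := fun s t hst e =>
      hst (by simpa using congrFun e v)
    rw [siteStep, PMF.map_apply, tsum_bool]
    by_cases hy : ∀ u, u ≠ v → y u = z u
    · have hyz : ∀ s, update y v s = update z v s := by
        intro s
        funext u
        by_cases huv : u = v
        · subst huv; simp
        · rw [update_of_ne huv, update_of_ne huv, hy u huv]
      have hgy : g v y = g v z := by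
        rw [← hgv y 1, hyz, hgv]
      have hy1 : y = update z v (y v) := by rw [← hyz, update_eq_self]
      have hzs : ∀ s, z = update y v s ↔ z v = s := by
        intro s
        rw [hyz]
        constructor
        · intro h; rw [h]; simp
        · rintro rfl; simp
      simp only [hzs, hgy, uniformBelow_true (hg z).2, uniformBelow_false (hg z).1, spinOf]
      have e1 : (if y = update z v 1 then κ else 0) + (if y = update z v (-1) then κ else 0) = κ := by
        rcases Gibbs.spin_cases (y v) with h | h
        · rw [h] at hy1
          rw [if_pos hy1, hy1, if_neg (hne _ _ (by decide)), add_zero]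
        · rw [h] at hy1
          rw [if_pos hy1, hy1, if_neg (hne _ _ (by decide)), zero_add]
      rw [e1, hκ]
      rcases Gibbs.spin_cases (z v) with h | h <;> simp [h]
    · have h2 : ∀ s, z ≠ update y v s := fun s h => hy fun u hu => by
        rw [h, update_of_ne hu]
      have h3 : ∀ s, y ≠ update z v s := fun s h => hy fun u hu => by
        rw [h, update_of_ne hu]
      simp [h2, h3]
  rw [PMF.bind_apply, tsum_fintype]
  simp only [h1, mul_add, mul_ite, mul_zero, Finset.sum_add_distrib, Finset.sum_ite_eq',
    Finset.mem_univ, if_true]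
  have hQz := hQ z
  have ht : ∀ y, Q y = ENNReal.ofReal (Q y).toReal := fun y =>
    (ENNReal.ofReal_toReal (PMF.apply_ne_top _ _)).symm
  rw [← add_mul, hκ, ht (update z v 1), ht (update z v (-1)),
    ← ENNReal.ofReal_add ENNReal.toReal_nonneg ENNReal.toReal_nonneg]
  have hnn : 0 ≤ (Q (update z v 1)).toReal + (Q (update z v (-1))).toReal :=
    add_nonneg ENNReal.toReal_nonneg ENNReal.toReal_nonneg
  rcases Gibbs.spin_cases (z v) with h | h
  · rw [if_pos h, ← ENNReal.ofReal_mul hnn, mul_comm, ← hQz,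
      show update z v 1 = z by rw [← h, update_eq_self], ← ht]
  · rw [if_neg (h ▸ Gibbs.neg_one_ne_one), ← ENNReal.ofReal_mul hnn]
    rw [show ((Q (update z v 1)).toReal + (Q (update z v (-1))).toReal) * (1 - g v z) =
      (Q (update z v (-1))).toReal by linear_combination hQz,
      show update z v (-1) = z by rw [← h, update_eq_self], ← ht]

theorem bind_step {k : ℕ} (e : Fin (k + 1) → V) {Q : PMF (V → Spin)} {g : V → (V → Spin) → ℝ}
    (h : ∀ v, Q.bind (siteStep g v) = Q) : Q.bind (step e g) = Q := by
  rw [show step e g = fun x => (PMF.uniformOfFintype (Fin (k + 1))).bind fun i =>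
    siteStep g (e i) x from rfl, PMF.bind_comm]
  simp only [h]
  exact PMF.bind_const _ _

/-- The coupled step of two dynamics. -/
def coupledStep {k : ℕ} (e : Fin (k + 1) → V) (g f : V → (V → Spin) → ℝ)
    (z : (V → Spin) × (V → Spin)) : PMF ((V → Spin) × (V → Spin)) :=
  (PMF.uniformOfFintype (Fin (k + 1))).bind fun i =>
    (coinCoupling (g (e i) z.1) (f (e i) z.2)).map fun c =>
      (update z.1 (e i) (spinOf c.1), update z.2 (e i) (spinOf c.2))

theorem coupledStep_fst {k : ℕ} (e : Fin (k + 1) → V) (g f : V → (V → Spin) → ℝ)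
    (z : (V → Spin) × (V → Spin)) : (coupledStep e g f z).map Prod.fst = step e g z.1 := by
  rw [coupledStep, step, PMF.map_bind]
  congr 1
  funext i
  rw [siteStep, ← coinCoupling_fst _ (f (e i) z.2), PMF.map_comp, PMF.map_comp]
  rfl

theorem coupledStep_snd {k : ℕ} (e : Fin (k + 1) → V) (g f : V → (V → Spin) → ℝ)
    (z : (V → Spin) × (V → Spin)) : (coupledStep e g f z).map Prod.snd = step e f z.2 := by
  rw [coupledStep, step, PMF.map_bind]
  congr 1
  funext i
  rw [siteStep, ← coinCoupling_snd (g (e i) z.1), PMF.map_comp, PMF.map_comp]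
  rfl

/-- The probability that the two configurations differ at `v`. -/
def mismatch (μ : PMF ((V → Spin) × (V → Spin))) (v : V) : ℝ≥0∞ :=
  expect μ fun z => if z.1 v ≠ z.2 v then 1 else 0

theorem expect_uniform {k : ℕ} (F : Fin (k + 1) → ℝ≥0∞) :
    expect (PMF.uniformOfFintype (Fin (k + 1))) F = ((k + 1 : ℕ) : ℝ≥0∞)⁻¹ * ∑ i, F i := by
  rw [expect, tsum_fintype, Finset.mul_sum]
  refine Finset.sum_congr rfl fun i _ => ?_
  rw [PMF.uniformOfFintype_apply, Fintype.card_fin]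

/-- With probability `1 / (k + 1)` the vertex is resampled, and then it mismatches with probability
at most `ε` plus the influences of the mismatched vertices, at most `ε + a m` on average. Otherwise
nothing changes there. -/
theorem mismatch_bind_le {k : ℕ} {e : Fin (k + 1) → V} (he : Bijective e)
    {g f : V → (V → Spin) → ℝ} {a ε m : ℝ} (ha0 : 0 ≤ a) (hε : 0 ≤ ε) (hm : 0 ≤ m)
    (hfg : ∀ v x, |f v x - g v x| ≤ ε) {v : V} {o : V → ℝ} (ho0 : ∀ u, 0 ≤ o u)
    (hoa : ∑ u, o u ≤ a)
    (hg : ∀ z z' : V → Spin, |g v z - g v z'| ≤ ∑ u, if z u ≠ z' u then o u else 0)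
    {μ : PMF ((V → Spin) × (V → Spin))} (hμ : ∀ u, mismatch μ u ≤ ENNReal.ofReal m) :
    mismatch (μ.bind (coupledStep e g f)) v ≤
      ENNReal.ofReal ((1 - (1 - a) / (k + 1 : ℕ)) * m + ε / (k + 1 : ℕ)) := by
  obtain ⟨j, rfl⟩ := he.2 v
  have hcoin : ∀ z : (V → Spin) × (V → Spin),
      expect (coinCoupling (g (e j) z.1) (f (e j) z.2)) (fun c => if c.1 ≠ c.2 then 1 else 0) ≤
        ENNReal.ofReal ε + ∑ u, ENNReal.ofReal (o u) * (if z.1 u ≠ z.2 u then 1 else 0) := by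
    intro z
    refine (expect_coinCoupling_ne_le _ _).trans ?_
    have h1 : |g (e j) z.1 - f (e j) z.2| ≤ ε + ∑ u, if z.1 u ≠ z.2 u then o u else 0 := by
      calc _ ≤ |g (e j) z.1 - g (e j) z.2| + |g (e j) z.2 - f (e j) z.2| := abs_sub_le _ _ _
        _ ≤ _ := by
          rw [abs_sub_comm (g (e j) z.2), add_comm]
          exact add_le_add (hfg _ _) (hg _ _)
    refine (ENNReal.ofReal_le_ofReal h1).trans ?_
    rw [ENNReal.ofReal_add hε (Finset.sum_nonneg fun u _ => by split_ifs <;> simp [ho0]),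
      ENNReal.ofReal_sum_of_nonneg fun u _ => by split_ifs <;> simp [ho0]]
    refine add_le_add le_rfl (le_of_eq (Finset.sum_congr rfl fun u _ => ?_))
    split_ifs <;> simp
  have hstep : ∀ z : (V → Spin) × (V → Spin),
      expect (coupledStep e g f z) (fun z => if z.1 (e j) ≠ z.2 (e j) then 1 else 0) ≤
        ((k + 1 : ℕ) : ℝ≥0∞)⁻¹ * (k * (if z.1 (e j) ≠ z.2 (e j) then 1 else 0) +
          (ENNReal.ofReal ε + ∑ u, ENNReal.ofReal (o u) * (if z.1 u ≠ z.2 u then 1 else 0))) := by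
    intro z
    rw [coupledStep, expect_bind, expect_uniform]
    refine mul_le_mul' le_rfl ?_
    rw [← Finset.add_sum_erase _ _ (Finset.mem_univ j), add_comm]
    refine add_le_add (le_of_eq ?_) ?_
    · rw [Finset.sum_congr rfl (g := fun _ => if z.1 (e j) ≠ z.2 (e j) then (1 : ℝ≥0∞) else 0),
        Finset.sum_const, Finset.card_erase_of_mem (Finset.mem_univ j), Finset.card_univ,
        Fintype.card_fin, Nat.add_sub_cancel, nsmul_eq_mul]
      intro i hi
      have hij : e j ≠ e i := fun h => Finset.ne_of_mem_erase hi (he.1 h).symm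
      rw [expect_map]
      simp only [update_of_ne hij]
      exact expect_const _ _
    · rw [expect_map]
      refine le_trans (le_of_eq ?_) (hcoin z)
      congr 1
      funext c
      simp only [update_self]
      rcases c with ⟨c, c'⟩
      cases c <;> cases c' <;> simp [spinOf]
  have hk : (0 : ℝ) < (k + 1 : ℕ) := by positivity
  rw [mismatch, expect_bind]
  refine (expect_mono μ hstep).trans ?_
  simp only [expect_const_mul, expect_add, expect_const, expect_sum]
  have hs : ∑ u, ENNReal.ofReal (o u) * mismatch μ u ≤ ENNReal.ofReal (a * m) := by
    calc _ ≤ ∑ u, ENNReal.ofReal (o u) * ENNReal.ofReal m :=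
          Finset.sum_le_sum fun u _ => mul_le_mul' le_rfl (hμ u)
      _ = ENNReal.ofReal (∑ u, o u) * ENNReal.ofReal m := by
          rw [← Finset.sum_mul, ENNReal.ofReal_sum_of_nonneg fun u _ => ho0 u]
      _ ≤ ENNReal.ofReal a * ENNReal.ofReal m := mul_le_mul' (ENNReal.ofReal_le_ofReal hoa) le_rfl
      _ = _ := (ENNReal.ofReal_mul ha0).symm
  calc _ ≤ ((k + 1 : ℕ) : ℝ≥0∞)⁻¹ * (k * ENNReal.ofReal m +
          (ENNReal.ofReal ε + ENNReal.ofReal (a * m))) :=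
        mul_le_mul' le_rfl (add_le_add (mul_le_mul' le_rfl (hμ _)) (add_le_add le_rfl hs))
    _ = _ := by
        rw [← ENNReal.ofReal_natCast k, ← ENNReal.ofReal_natCast (k + 1),
          ← ENNReal.ofReal_inv_of_pos hk, ← ENNReal.ofReal_mul (Nat.cast_nonneg k),
          ← ENNReal.ofReal_add hε (by positivity), ← ENNReal.ofReal_add (by positivity)
          (by positivity), ← ENNReal.ofReal_mul (by positivity)]
        congr 1
        push_cast
        field_simp
        ring

theorem hammingDist_eq_sum (x y : V → Spin) :
    (hammingDist x y : ℝ≥0∞) = ∑ v, if x v ≠ y v then 1 else 0 := by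
  rw [hammingDist, Finset.sum_boole]

/-- Use the independent coupling. This trivial bound serves on the event of bad samples. -/
theorem earthMover_le_card (P Q : PMF (V → Spin)) :
    earthMover P Q ≤ (Fintype.card V : ℝ≥0∞) := by
  refine (iInf₂_le (P.bind fun x => Q.map fun y => (x, y)) ⟨?_, ?_⟩).trans ?_
  · refine (expect_mono _ (G := fun _ => (Fintype.card V : ℝ≥0∞)) fun z => ?_).trans_eq
      (expect_const _ _)
    exact_mod_cast hammingDist_le_card_fintype
  · rw [PMF.map_bind]
    have : ∀ x : V → Spin, PMF.map Prod.fst (PMF.map (fun y => (x, y)) Q) = PMF.pure x := by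
      intro x
      rw [PMF.map_comp]
      exact PMF.map_const Q x
    simp only [this, PMF.bind_pure]
  · rw [PMF.map_bind]
    have : ∀ x : V → Spin, PMF.map Prod.snd (PMF.map (fun y => (x, y)) Q) = Q := by
      intro x
      rw [PMF.map_comp]
      exact PMF.map_id Q
    simp only [this, PMF.bind_const]

/-- The approximate Glauber dynamics for `f` converges to the stationary law `Q` of the dynamics for
`g`, up to the error of the approximation. -/
theorem earthMover_law_le {k : ℕ} {e : Fin (k + 1) → V} (he : Bijective e)
    {Q : PMF (V → Spin)} {g f : V → (V → Spin) → ℝ} (hQ : Q.bind (step e g) = Q)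
    {a ε : ℝ} (ha0 : 0 ≤ a) (ha1 : a < 1) (hε : 0 ≤ ε) (hfg : ∀ v x, |f v x - g v x| ≤ ε)
    (hg : ∀ v, ∃ o : V → ℝ, (∀ u, 0 ≤ o u) ∧ ∑ u, o u ≤ a ∧ ∀ z z' : V → Spin,
      |g v z - g v z'| ≤ ∑ u, if z u ≠ z' u then o u else 0) (x₀ : V → Spin) (T : ℕ) :
    earthMover Q (law e f x₀ T) ≤ ENNReal.ofReal
      ((k + 1 : ℕ) * ((1 - (1 - a) / (k + 1 : ℕ)) ^ T + ε / (1 - a))) := by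
  have hk : (0 : ℝ) < (k + 1 : ℕ) := by positivity
  have hk1 : (1 : ℝ) ≤ (k + 1 : ℕ) := by exact_mod_cast Nat.le_add_left 1 k
  have ha : 0 < 1 - a := by linarith
  set ρ : ℝ := 1 - (1 - a) / (k + 1 : ℕ) with hρ
  have hρ0 : 0 ≤ ρ := by
    rw [hρ, sub_nonneg, div_le_one hk]; linarith
  -- The first chain starts in its stationary law and stays there. A bound per vertex, rather than
  -- on the total, is what row sums of influences can propagate.
  have key : ∀ T, ∃ μ : PMF ((V → Spin) × (V → Spin)), μ.map Prod.fst = Q ∧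
      μ.map Prod.snd = law e f x₀ T ∧
        ∀ v, mismatch μ v ≤ ENNReal.ofReal (ρ ^ T + ε / (1 - a)) := by
    intro T
    induction T with
    | zero =>
      refine ⟨Q.map fun y => (y, x₀), ?_, ?_, fun v => ?_⟩
      · rw [PMF.map_comp]; exact PMF.map_id Q
      · rw [PMF.map_comp]; exact PMF.map_const Q x₀
      · refine (expect_mono _ (G := fun _ => 1) fun z => by split_ifs <;> simp).trans ?_
        rw [expect_const, pow_zero, ← ENNReal.ofReal_one]
        exact ENNReal.ofReal_le_ofReal (by linarith [div_nonneg hε ha.le])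
    | succ T ih =>
      obtain ⟨μ, h1, h2, h3⟩ := ih
      refine ⟨μ.bind (coupledStep e g f), ?_, ?_, fun v => ?_⟩
      · rw [PMF.map_bind]
        simp only [coupledStep_fst]
        conv_rhs => rw [← hQ, ← h1, PMF.bind_map]
        rfl
      · rw [PMF.map_bind, law, ← h2, PMF.bind_map]
        simp only [coupledStep_snd]
        rfl
      · obtain ⟨o, ho0, hoa, ho⟩ := hg v
        refine (mismatch_bind_le he ha0 hε (add_nonneg (pow_nonneg hρ0 T) (div_nonneg hε ha.le))
          hfg ho0 hoa ho h3).trans (ENNReal.ofReal_le_ofReal (le_of_eq ?_))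
        rw [← hρ, pow_succ]
        -- `ε / (1 - a)` is the fixed point of the one-step recursion.
        have : (1 - ρ) * (ε / (1 - a)) = ε / (k + 1 : ℕ) := by
          rw [hρ]; field_simp; ring
        linear_combination -this
  obtain ⟨μ, h1, h2, h3⟩ := key T
  refine (iInf₂_le μ ⟨h1, h2⟩).trans ?_
  have : ∑' z, μ z * (hammingDist z.1 z.2 : ℝ≥0∞) = ∑ v, mismatch μ v := by
    rw [← expect]
    simp only [hammingDist_eq_sum, expect_sum]
    rfl
  rw [this]
  refine (Finset.sum_le_sum fun v _ => h3 v).trans (le_of_eq ?_)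
  rw [Finset.sum_const, Finset.card_univ, ← Fintype.card_of_bijective he, Fintype.card_fin,
    nsmul_eq_mul, ENNReal.ofReal_mul hk.le, ENNReal.ofReal_natCast]

end Dynamics

end Glauber

end

noncomputable section

/-! ### Calculus of laws and running times of randomized programs -/

namespace RandAlg

open Function

variable {Ω α β γ ι : Type}

theorem bind_eq (A : RandAlg Ω α) (f : α → RandAlg Ω β) : A >>= f = A.bind f := rfl

theorem bind_assoc' (A : RandAlg Ω α) (f : α → RandAlg Ω β) (g : β → RandAlg Ω γ) :
    (A.bind f).bind g = A.bind fun a => (f a).bind g := by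
  induction A with
  | ret a => rfl
  | tick next ih => simp only [RandAlg.bind, ih]
  | sample next ih => simp only [RandAlg.bind, ih]
  | rand k next ih => simp only [RandAlg.bind, ih]
  | coin q next ih => simp only [RandAlg.bind, ih]

theorem bind_ret (A : RandAlg Ω α) : A.bind ret = A := by
  induction A with
  | ret a => rfl
  | tick next ih => simp only [RandAlg.bind, ih]
  | sample next ih => simp only [RandAlg.bind, ih]
  | rand k next ih => simp only [RandAlg.bind, ih]
  | coin q next ih => simp only [RandAlg.bind, ih]

theorem HaltsWithin.mono {A : RandAlg Ω α} {s t : ℕ} (h : A.HaltsWithin s) (hst : s ≤ t) :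
    A.HaltsWithin t := by
  induction A generalizing s t with
  | ret a => simp [HaltsWithin]
  | tick next ih =>
    rcases s with _ | s
    · exact h.elim
    · obtain ⟨t, rfl⟩ : ∃ t', t = t' + 1 := ⟨t - 1, by omega⟩
      exact ih (s := s) h (by omega)
  | sample next ih =>
    rcases s with _ | s
    · exact h.elim
    · obtain ⟨t, rfl⟩ : ∃ t', t = t' + 1 := ⟨t - 1, by omega⟩
      exact fun w => ih w (s := s) (h w) (by omega)
  | rand k next ih =>
    rcases s with _ | s
    · exact h.elim
    · obtain ⟨t, rfl⟩ : ∃ t', t = t' + 1 := ⟨t - 1, by omega⟩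
      exact fun w => ih w (s := s) (h w) (by omega)
  | coin q next ih =>
    rcases s with _ | s
    · exact h.elim
    · obtain ⟨t, rfl⟩ : ∃ t', t = t' + 1 := ⟨t - 1, by omega⟩
      exact fun w => ih w (s := s) (h w) (by omega)

/-- `A` is a deterministic computation of `a` in at most `t` steps. -/
inductive Computes : RandAlg Ω α → α → ℕ → Prop
  | ret (a : α) (t : ℕ) : Computes (.ret a) a t
  | tick {A : RandAlg Ω α} {a : α} {t : ℕ} : Computes A a t → Computes (.tick A) a (t + 1)

theorem Computes.mono {A : RandAlg Ω α} {a : α} {s t : ℕ} (h : Computes A a s) (hst : s ≤ t) :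
    Computes A a t := by
  induction h generalizing t with
  | ret a s => exact .ret a t
  | @tick A a s h ih =>
    obtain ⟨t, rfl⟩ : ∃ t', t = t' + 1 := ⟨t - 1, by omega⟩
    exact .tick (ih (by omega))

theorem Computes.bind {A : RandAlg Ω α} {a : α} {s t : ℕ} (h : Computes A a s)
    {f : α → RandAlg Ω β} {b : β} (h' : Computes (f a) b t) : Computes (A >>= f) b (s + t) := by
  induction h with
  | ret a s => exact h'.mono (Nat.le_add_left t s)
  | @tick A a s h ih =>
    rw [Nat.add_right_comm]
    exact .tick (ih h')

theorem Computes.op (a : α) : Computes (op a : RandAlg Ω α) a 1 := .tick (.ret a 0)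

theorem Computes.op_bind {a : α} {f : α → RandAlg Ω β} {b : β} {t : ℕ}
    (h : Computes (f a) b t) : Computes (RandAlg.op a >>= f) b (t + 1) := .tick h

theorem Computes.foldlM {l : List ι} {g : β → ι → RandAlg Ω β} {G : β → ι → β} {t : ℕ}
    (h : ∀ b i, Computes (g b i) (G b i) t) (b : β) :
    Computes (l.foldlM g b) (l.foldl G b) (l.length * t) := by
  induction l generalizing b with
  | nil => exact .ret b _
  | cons i l ih =>
    rw [List.foldlM_cons, List.foldl_cons, List.length_cons]
    exact ((h b i).bind (ih (G b i))).mono (by rw [Nat.succ_mul, Nat.add_comm])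

theorem Computes.law_bind {A : RandAlg Ω α} {a : α} {t : ℕ} (h : Computes A a t)
    (f : α → RandAlg Ω β) (x : ℕ → Ω) : (A.bind f).law x = (f a).law x := by
  induction h with
  | ret a s => rfl
  | tick h ih => exact ih

theorem Computes.halts_bind {A : RandAlg Ω α} {a : α} {s t : ℕ} (h : Computes A a s)
    {f : α → RandAlg Ω β} (h' : (f a).HaltsWithin t) : (A.bind f).HaltsWithin (s + t) := by
  induction h with
  | ret a s => exact h'.mono (Nat.le_add_left t s)
  | @tick A a s h ih =>
    rw [Nat.add_right_comm]
    exact ih h'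

theorem Computes.sumLoop {l : List ι} {g : ι → RandAlg Ω ℝ} {G : ι → ℝ} {t : ℕ}
    (h : ∀ i, Computes (g i) (G i) t) :
    Computes (sumLoop l g) (l.map G).sum (l.length * (t + 1)) := by
  have key := Computes.foldlM (l := l) (g := fun s i => do
      let a ← g i
      RandAlg.op (s + a)) (G := fun s i => s + G i) (t := t + 1)
    (fun s i => (h i).bind (Computes.op _)) 0
  have : ∀ (l : List ι) (s : ℝ), l.foldl (fun s i => s + G i) s = s + (l.map G).sum := by
    intro l
    induction l with
    | nil => simp
    | cons i l ih => intro s; simp [ih, add_assoc]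
  rw [this, zero_add] at key
  exact key

theorem Computes.tabulate [DecidableEq ι] {l : List ι} {g : ι → RandAlg Ω β} {G : ι → β} {t : ℕ}
    (h : ∀ i, Computes (g i) (G i) t) (init : β) :
    Computes (tabulate l g init) (fun i => if i ∈ l then G i else init) (l.length * (t + 1)) := by
  have key := Computes.foldlM (l := l) (g := fun tbl i => do
      let c ← g i
      RandAlg.op (update tbl i c)) (G := fun tbl i => update tbl i (G i)) (t := t + 1)
    (fun s i => (h i).bind (Computes.op _)) (fun _ => init)
  have : ∀ (l : List ι) (s : ι → β), l.foldl (fun tbl i => update tbl i (G i)) s =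
      fun i => if i ∈ l then G i else s i := by
    intro l
    induction l with
    | nil => simp
    | cons i l ih =>
      intro s
      rw [List.foldl_cons, ih]
      funext j
      by_cases hj : j ∈ l
      · simp [hj]
      · by_cases hji : j = i
        · subst hji; simp
        · simp [hj, hji]
  rw [this] at key
  exact key

/-- `A` asks for no samples, its output has law `p`, and it stops after at most `t` steps. -/
structure Realizes (A : RandAlg Ω α) (p : PMF α) (t : ℕ) : Prop where
  law_bind : ∀ {β : Type} (f : α → RandAlg Ω β) (x : ℕ → Ω),
    (A.bind f).law x = p.bind fun a => (f a).law x
  halts_bind : ∀ {β : Type} (f : α → RandAlg Ω β) (s : ℕ), (∀ a, (f a).HaltsWithin s) →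
    (A.bind f).HaltsWithin (t + s)

/-- `Realizes` speaks about arbitrary continuations, so that programs compose by associativity of
`bind`; the continuation `ret` recovers the program itself. -/
theorem Realizes.law {A : RandAlg Ω α} {p : PMF α} {t : ℕ} (h : Realizes A p t) (x : ℕ → Ω) :
    A.law x = p := by
  have := h.law_bind ret x
  rw [bind_ret] at this
  rw [this]
  exact PMF.bind_pure p

theorem Realizes.haltsWithin {A : RandAlg Ω α} {p : PMF α} {t : ℕ} (h : Realizes A p t) :
    A.HaltsWithin t := by
  have := h.halts_bind ret 0 fun a => by simp [HaltsWithin]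
  rwa [bind_ret] at this

theorem Realizes.bind {A : RandAlg Ω α} {p : PMF α} {s t : ℕ} (h : Realizes A p s)
    {g : α → RandAlg Ω β} {q : α → PMF β} (h' : ∀ a, Realizes (g a) (q a) t) :
    Realizes (A >>= g) (p.bind q) (s + t) where
  law_bind f x := by
    rw [bind_eq, bind_assoc', h.law_bind, PMF.bind_bind]
    congr 1
    funext a
    exact (h' a).law_bind f x
  halts_bind f r hr := by
    rw [bind_eq, bind_assoc', add_assoc]
    exact h.halts_bind _ _ fun a => (h' a).halts_bind f r hr

theorem Computes.realizes {A : RandAlg Ω α} {a : α} {t : ℕ} (h : Computes A a t) :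
    Realizes A (PMF.pure a) t where
  law_bind f x := by rw [h.law_bind, PMF.pure_bind]
  halts_bind f s hs := h.halts_bind (hs a)

theorem realizes_flip (q : ℝ) : Realizes (flip q : RandAlg Ω Bool) (uniformBelow q) 1 where
  law_bind f x := rfl
  halts_bind f s hs := by
    rw [add_comm]
    exact fun c => hs c

theorem realizes_rand (k : ℕ) (g : Fin (k + 1) → α) :
    Realizes (rand k fun i => ret (g i) : RandAlg Ω α)
      ((PMF.uniformOfFintype (Fin (k + 1))).map g) 1 where
  law_bind f x := by
    rw [PMF.bind_map]
    rfl
  halts_bind f s hs := by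
    rw [Nat.add_comm 1 s]
    exact fun i => hs (g i)

end RandAlg

/-! ### Laws and costs of the subroutines -/

namespace HighGirth

open RandAlg Ising Function

variable {Ω V : Type} [DecidableEq V]

/-- `Glauber.law` appends the last step, whereas a monadic fold peels off the first one. -/
theorem law_succ' [Fintype V] {k : ℕ} (e : Fin (k + 1) → V) (f : V → (V → Spin) → ℝ) (T : ℕ) :
    ∀ x, Glauber.law e f x (T + 1) = (Glauber.step e f x).bind fun y => Glauber.law e f y T := by
  induction T with
  | zero =>
    intro x
    rw [Glauber.law, Glauber.law, PMF.pure_bind]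
    exact (PMF.bind_pure _).symm
  | succ T ih =>
    intro x
    rw [Glauber.law, ih, PMF.bind_bind]
    rfl

theorem realizes_approxGlauber [Fintype V] (v₀ : V) (rest : List V)
    {f : V → (V → Spin) → RandAlg Ω ℝ} {φ : V → (V → Spin) → ℝ} {t : ℕ}
    (hf : ∀ v x, Computes (f v x) (φ v x) t) (x₀ : V → Spin) (T : ℕ) :
    Realizes (approxGlauber (v₀ :: rest) f x₀ T)
      (Glauber.law (k := rest.length) (fun i => (v₀ :: rest).get i) φ x₀ T) (T * (t + 3)) := by
  have hstep : ∀ x, Realizes (Ω := Ω) (do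
      let v ← rand rest.length fun i => ret ((v₀ :: rest).get i)
      let q ← f v x
      let c ← RandAlg.flip q
      op (update x v (if c then 1 else -1)))
      (Glauber.step (k := rest.length) (fun i => (v₀ :: rest).get i) φ x) (t + 3) := by
    intro x
    have h := (realizes_rand (Ω := Ω) rest.length fun i => (v₀ :: rest).get i).bind fun v =>
      (hf v x).realizes.bind fun q => (realizes_flip q).bind fun c =>
        (Computes.op (update x v (if c then 1 else -1))).realizes
    rw [show t + 3 = 1 + (t + (1 + 1)) by ring]
    convert h using 1
    rw [PMF.bind_map]
    simp only [PMF.pure_bind]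
    rfl
  have key : ∀ (l : List ℕ) (x : V → Spin), Realizes (Ω := Ω) (l.foldlM (fun x _ => do
      let v ← rand rest.length fun i => ret ((v₀ :: rest).get i)
      let q ← f v x
      let c ← RandAlg.flip q
      op (update x v (if c then 1 else -1))) x)
      (Glauber.law (k := rest.length) (fun i => (v₀ :: rest).get i) φ x l.length)
      (l.length * (t + 3)) := by
    intro l
    induction l with
    | nil =>
      intro x
      exact (Computes.ret x _).realizes
    | cons i l ih =>
      intro x
      rw [List.foldlM_cons, List.length_cons, law_succ', Nat.succ_mul, add_comm (l.length * _)]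
      exact (hstep x).bind ih
  have := key (List.range T) x₀
  rw [List.length_range] at this
  exact this

/-- The table of the first samples. -/
def fill {m : ℕ} : List (Fin m) → (Fin m → Ω) → (ℕ → Ω) → Fin m → Ω
  | [], tbl, _ => tbl
  | i :: l, tbl, x => fill l (update tbl i (x 0)) fun j => x (j + 1)

theorem fill_of_notMem {m : ℕ} (l : List (Fin m)) : ∀ (tbl : Fin m → Ω) (x : ℕ → Ω) {i : Fin m},
    i ∉ l → fill l tbl x i = tbl i := by
  induction l with
  | nil => intro tbl x i _; rfl
  | cons j l ih =>
    intro tbl x i hi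
    rw [List.mem_cons, not_or] at hi
    rw [fill, ih _ _ hi.2, update_of_ne hi.1]

theorem fill_getElem {m : ℕ} (l : List (Fin m)) : ∀ (tbl : Fin m → Ω) (x : ℕ → Ω), l.Nodup →
    ∀ (j : ℕ) (hj : j < l.length), fill l tbl x l[j] = x j := by
  induction l with
  | nil => intro tbl x _ j hj; exact absurd hj (Nat.not_lt_zero j)
  | cons i l ih =>
    intro tbl x hl j hj
    rw [List.nodup_cons] at hl
    rw [fill]
    rcases j with _ | j
    · rw [List.getElem_cons_zero, fill_of_notMem l _ _ hl.1, update_self]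
    · rw [List.getElem_cons_succ, ih _ _ hl.2 j]

theorem fill_finRange (m : ℕ) (tbl : Fin m → Ω) (x : ℕ → Ω) :
    fill (List.finRange m) tbl x = fun i : Fin m => x i := by
  funext i
  have := fill_getElem (List.finRange m) tbl x (List.nodup_finRange m) i (by simp)
  simpa using this

/-- Drawing consumes oracle answers, so it is not covered by `Realizes`: the continuation must read
the shifted sequence. Each sample costs one draw, two steps per coordinate and one write. -/
theorem drawSamples_aux {vs : List V} (hvs : ∀ v, v ∈ vs) {m : ℕ} {β : Type}
    (f : (Fin m → V → Spin) → RandAlg (V → Spin) β) (l : List (Fin m)) :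
    ∀ tbl : Fin m → V → Spin,
      (∀ x, ((l.foldlM (fun tbl i => do
        let c ← (do
          let x ← draw
          tabulate vs (fun v => op (x v)) 1)
        op (update tbl i c)) tbl : RandAlg (V → Spin) _).bind f).law x =
          (f (fill l tbl x)).law fun j => x (j + l.length)) ∧
      (∀ s, (∀ X, (f X).HaltsWithin s) → ((l.foldlM (fun tbl i => do
        let c ← (do
          let x ← draw
          tabulate vs (fun v => op (x v)) 1)
        op (update tbl i c)) tbl : RandAlg (V → Spin) _).bind f).HaltsWithin
          (l.length * (2 * vs.length + 2) + s)) := by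
  have htab : ∀ w : V → Spin, Computes (Ω := V → Spin) (tabulate vs (fun v => op (w v)) 1) w
      (vs.length * 2) := by
    intro w
    have := Computes.tabulate (Ω := V → Spin) (l := vs) (fun v => Computes.op (w v)) 1
    simpa [hvs] using this
  induction l with
  | nil => intro tbl; exact ⟨fun x => rfl, fun s hs => (hs tbl).mono (Nat.le_add_left _ _)⟩
  | cons i l ih =>
    intro tbl
    rw [List.foldlM_cons]
    have hc : ∀ w : V → Spin, Computes (Ω := V → Spin) (do
        let c ← tabulate vs (fun v => op (w v)) 1
        op (update tbl i c)) (update tbl i w) (vs.length * 2 + 1) :=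
      fun w => (htab w).bind (Computes.op _)
    constructor
    · intro x
      rw [bind_eq, bind_assoc']
      have h1 := (hc (x 0)).law_bind (fun tbl' => (l.foldlM (fun tbl i => do
        let c ← (do
          let x ← draw
          tabulate vs (fun v => op (x v)) 1)
        op (update tbl i c)) tbl' : RandAlg (V → Spin) _).bind f) fun j => x (j + 1)
      rw [(ih _).1] at h1
      exact h1
    · intro s hs
      rw [bind_eq, bind_assoc', List.length_cons]
      have h1 := fun w => (hc w).halts_bind (f := fun tbl' => (l.foldlM (fun tbl i => do
        let c ← (do
          let x ← draw
          tabulate vs (fun v => op (x v)) 1)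
        op (update tbl i c)) tbl' : RandAlg (V → Spin) _).bind f) ((ih (update tbl i w)).2 s hs)
      have e : (l.length + 1) * (2 * vs.length + 2) + s =
          (vs.length * 2 + 1 + (l.length * (2 * vs.length + 2) + s)) + 1 := by ring
      rw [e]
      exact h1

theorem law_drawSamples_bind {vs : List V} (hvs : ∀ v, v ∈ vs) (m : ℕ) {β : Type}
    (f : (Fin m → V → Spin) → RandAlg (V → Spin) β) (x : ℕ → V → Spin) :
    ((drawSamples vs m).bind f).law x = (f fun i => x i).law fun j => x (j + m) := by
  have := (drawSamples_aux hvs f (List.finRange m) fun _ => 1).1 x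
  rw [fill_finRange, List.length_finRange] at this
  exact this

theorem halts_drawSamples_bind {vs : List V} (hvs : ∀ v, v ∈ vs) (m : ℕ) {β : Type}
    {f : (Fin m → V → Spin) → RandAlg (V → Spin) β} {s : ℕ} (hs : ∀ X, (f X).HaltsWithin s) :
    ((drawSamples vs m).bind f).HaltsWithin (m * (2 * vs.length + 2) + s) := by
  have := (drawSamples_aux hvs f (List.finRange m) fun _ => 1).2 s hs
  rw [List.length_finRange] at this
  exact this

/-- The average of `h` over the samples. -/
def mean {m : ℕ} (X : Fin m → V → Spin) (h : (V → Spin) → ℝ) : ℝ := (∑ i, h (X i)) / m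

/-- The value of the empirical correlation. -/
def corr {m : ℕ} (X : Fin m → V → Spin) (v u : V) : ℝ :=
  (mean X (fun x => spinVal (x v) * spinVal (x u)) -
    mean X (fun x => spinVal (x v)) * mean X (fun x => spinVal (x u))) /
    Real.sqrt ((1 - mean X (fun x => spinVal (x v)) * mean X (fun x => spinVal (x v))) *
      (1 - mean X (fun x => spinVal (x u)) * mean X (fun x => spinVal (x u))))

theorem computes_empiricalCorrelation {m : ℕ} (X : Fin m → V → Spin) (v u : V) :
    Computes (Ω := Ω) (empiricalCorrelation X v u) (corr X v u) (8 * m + 12) := by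
  have h1 : ∀ w, Computes (Ω := Ω) (sumLoop (List.finRange m) fun i => op (spinVal (X i w)))
      (∑ i, spinVal (X i w)) (m * 2) := by
    intro w
    have := Computes.sumLoop (Ω := Ω) (l := List.finRange m)
      fun i => Computes.op (spinVal (X i w))
    rwa [List.length_finRange, ← Fin.sum_univ_def] at this
  have h2 : Computes (Ω := Ω) (sumLoop (List.finRange m) fun i => do
      let a ← op (spinVal (X i v))
      let b ← op (spinVal (X i u))
      op (a * b)) (∑ i, spinVal (X i v) * spinVal (X i u)) (m * 4) := by
    have := Computes.sumLoop (Ω := Ω) (l := List.finRange m) (g := fun i => do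
      let a ← op (spinVal (X i v))
      let b ← op (spinVal (X i u))
      op (a * b))
      fun i => Computes.op_bind (Computes.op_bind (Computes.op (spinVal (X i v) * spinVal (X i u))))
    rwa [List.length_finRange, ← Fin.sum_univ_def] at this
  -- The three sums take `2m`, `2m` and `4m` steps, the closing formula twelve.
  refine Computes.mono ((h1 v).bind ((h1 u).bind (h2.bind (t := 12) ?_))) (by omega)
  exact .op_bind (.op_bind (.op_bind (.op_bind (.op_bind (.op_bind (.op_bind (.op_bind
    (.op_bind (.op_bind (.op_bind (.op _)))))))))))

theorem computes_correlatedWith (vs : List V) (ρ : V → V → ℝ) (ρ₀ : ℝ) (v : V) :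
    ∃ l : List V, Computes (Ω := Ω) (correlatedWith vs ρ ρ₀ v) l (vs.length * 6) ∧
      l.length ≤ vs.length ∧ ∀ u, u ∈ l ↔ u ∈ vs ∧ u ≠ v ∧ ρ₀ ≤ |ρ v u| := by
  refine ⟨vs.foldl (fun l u => if (decide (u ≠ v) && decide (ρ₀ ≤ |ρ v u|)) = true then u :: l
    else l) [], Computes.foldlM (fun l u => ?_) [], ?_⟩
  · refine .op_bind (.op_bind (.op_bind (.op_bind (.op_bind ?_))))
    split_ifs
    · exact .op _
    · exact .ret _ _
  · have key : ∀ (vs l : List V), (vs.foldl (fun l u =>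
        if (decide (u ≠ v) && decide (ρ₀ ≤ |ρ v u|)) = true then u :: l else l) l).length ≤
          vs.length + l.length ∧ ∀ u, u ∈ vs.foldl (fun l u =>
        if (decide (u ≠ v) && decide (ρ₀ ≤ |ρ v u|)) = true then u :: l else l) l ↔
          u ∈ l ∨ (u ∈ vs ∧ u ≠ v ∧ ρ₀ ≤ |ρ v u|) := by
      intro vs
      induction vs with
      | nil => intro l; simp
      | cons w vs ih =>
        intro l
        rw [List.foldl_cons]
        split_ifs with h
        · rw [Bool.and_eq_true, decide_eq_true_iff, decide_eq_true_iff] at h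
          obtain ⟨h1, h2⟩ := ih (w :: l)
          refine ⟨h1.trans (by simp only [List.length_cons]; omega), fun u => (h2 u).trans ?_⟩
          simp only [List.mem_cons]
          constructor
          · rintro ((rfl | h3) | h3)
            · exact Or.inr ⟨Or.inl rfl, h⟩
            · exact Or.inl h3
            · exact Or.inr ⟨Or.inr h3.1, h3.2⟩
          · rintro (h3 | ⟨rfl | h3, h4⟩)
            · exact Or.inl (Or.inr h3)
            · exact Or.inl (Or.inl rfl)
            · exact Or.inr ⟨h3, h4⟩
        · rw [Bool.and_eq_true, decide_eq_true_iff, decide_eq_true_iff] at h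
          obtain ⟨h1, h2⟩ := ih l
          refine ⟨h1.trans (by simp only [List.length_cons]; omega), fun u => (h2 u).trans ?_⟩
          simp only [List.mem_cons]
          constructor
          · rintro (h3 | h3)
            · exact Or.inl h3
            · exact Or.inr ⟨Or.inr h3.1, h3.2⟩
          · rintro (h3 | ⟨rfl | h3, h4⟩)
            · exact Or.inl h3
            · exact absurd h4 h
            · exact Or.inr ⟨h3, h4⟩
    simpa using key vs []

theorem computes_agreesOn (l : List V) (y x : V → Spin) :
    Computes (Ω := Ω) (agreesOn l y x) (decide (∀ u ∈ l, y u = x u)) (l.length * 4) := by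
  have h := Computes.foldlM (Ω := Ω) (l := l) (g := fun acc u => do
    let a ← op (y u)
    let b ← op (x u)
    let e ← op (decide (a = b))
    op (acc && e)) (G := fun acc u => acc && decide (y u = x u))
    (fun b u => Computes.op_bind (.op_bind (.op_bind (.op _)))) true
  have key : ∀ (l : List V) (b : Bool), l.foldl (fun acc u => acc && decide (y u = x u)) b =
      (b && decide (∀ u ∈ l, y u = x u)) := by
    intro l
    induction l with
    | nil => simp
    | cons w l ih =>
      intro b
      rw [List.foldl_cons, ih, Bool.and_assoc, ← Bool.decide_and]
      congr 1
      exact decide_eq_decide.2 (by simp)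
  rw [key, Bool.true_and] at h
  exact h

/-- The value of the empirical conditional probability. -/
def condFreq {m : ℕ} (X : Fin m → V → Spin) (l : List V) (v : V) (x : V → Spin) : ℝ :=
  (∑ i, if (∀ u ∈ l, X i u = x u) ∧ X i v = 1 then 1 else 0) /
    ∑ i, if ∀ u ∈ l, X i u = x u then 1 else 0

theorem computes_empiricalConditional {m : ℕ} (X : Fin m → V → Spin) (l : List V) (v : V)
    (x : V → Spin) :
    Computes (Ω := Ω) (empiricalConditional X l v x) (condFreq X l v x)
      (m * (l.length * 4 + 4) + 1) := by
  have h := Computes.foldlM (Ω := Ω) (l := List.finRange m) (g := fun (c : ℕ × ℕ) i => do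
      let ag ← agreesOn l (X i) x
      if ag then do
        let total ← op (c.2 + 1)
        let s ← op (X i v)
        let pos ← op (decide (s = 1))
        if pos then do
          let ones ← op (c.1 + 1)
          pure (ones, total)
        else pure (c.1, total)
      else pure c)
    (G := fun c i => (c.1 + if (∀ u ∈ l, X i u = x u) ∧ X i v = 1 then 1 else 0,
      c.2 + if ∀ u ∈ l, X i u = x u then 1 else 0)) (t := l.length * 4 + 4) (fun c i => by
    refine (computes_agreesOn l (X i) x).bind ?_
    by_cases hag : ∀ u ∈ l, X i u = x u
    · rw [if_pos (decide_eq_true hag), if_pos hag]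
      refine .op_bind (.op_bind (.op_bind ?_))
      by_cases hs : X i v = 1
      · rw [if_pos (decide_eq_true hs), if_pos ⟨hag, hs⟩]
        exact .op_bind (.ret _ 0)
      · rw [if_neg (by simpa using hs), if_neg fun h => hs h.2]
        exact .ret _ _
    · rw [if_neg (by simpa using hag), if_neg hag, if_neg fun h => hag h.1]
      exact .ret _ _) (0, 0)
  have key : ∀ (L : List (Fin m)) (p q : Fin m → ℕ) (c : ℕ × ℕ),
      L.foldl (fun c i => (c.1 + p i, c.2 + q i)) c = (c.1 + (L.map p).sum, c.2 + (L.map q).sum) := by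
    intro L p q
    induction L with
    | nil => simp
    | cons i L ih => intro c; simp [ih, add_assoc]
  rw [key, ← Fin.sum_univ_def, ← Fin.sum_univ_def, List.length_finRange, zero_add, zero_add] at h
  have h2 := h.bind (f := fun counts => op ((counts.1 : ℝ) / (counts.2 : ℝ))) (Computes.op _)
  push_cast at h2
  exact h2

end HighGirth

end

noncomputable section

/-! ### Law and running time of the whole algorithm -/

namespace HighGirth

open RandAlg Ising Function

variable {n : ℕ}

/-- The part of the algorithm after the samples have been drawn. -/
def afterDraws (n m : ℕ) (S : Finset (Fin n)) (ρ₀ : ℝ) (X : Fin m → S → Spin) :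
    RandAlg (S → Spin) (S → Spin) := do
  let vs : List S := (Finset.univ : Finset S).sort
  let ρ ← tabulate vs (fun v => tabulate vs (fun u => empiricalCorrelation X v u) 0) (fun _ => 0)
  let nbr ← tabulate vs (fun v => correlatedWith vs ρ ρ₀ v) []
  let ln ← op (Real.log n)
  let time ← op (n * ln)
  approxGlauber vs (fun v x => do
    let l ← op (nbr v)
    empiricalConditional X l v x) (fun _ => 1) ⌈time⌉₊

theorem H_eq (n m : ℕ) (S : Finset (Fin n)) (ρ₀ : ℝ) :
    H n m S ρ₀ = (drawSamples ((Finset.univ : Finset S).sort) m).bind (afterDraws n m S ρ₀) := rfl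

/-- Correlations and neighbour lists are deterministic functions of the samples, so they can be
fixed before the randomness of the dynamics enters. -/
theorem computes_tables {m : ℕ} {V : Type} [DecidableEq V] {Ω : Type} {vs : List V}
    (hvs : ∀ v, v ∈ vs) (ρ₀ : ℝ) (X : Fin m → V → Spin) :
    ∃ nbr : V → List V, (∀ v, (nbr v).length ≤ vs.length) ∧
      (∀ v u, u ∈ nbr v ↔ u ≠ v ∧ ρ₀ ≤ |corr X v u|) ∧
      ∀ {β : Type} (f : (V → List V) → RandAlg Ω β) (p : PMF β) (t : ℕ), Realizes (f nbr) p t →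
        Realizes (do
          let ρ ← tabulate vs (fun v => tabulate vs (fun u => empiricalCorrelation X v u) 0)
            (fun _ => 0)
          let nbr ← tabulate vs (fun v => correlatedWith vs ρ ρ₀ v) []
          f nbr) p (vs.length * (vs.length * (8 * m + 13) + 1) +
            (vs.length * (vs.length * 6 + 1) + t)) := by
  choose nbr h1 h2 h3 using computes_correlatedWith (Ω := Ω) vs (corr X) ρ₀
  refine ⟨nbr, h2, fun v u => (h3 v u).trans (by simp [hvs]), fun f p t hf => ?_⟩
  have hρ := Computes.tabulate (Ω := Ω) (l := vs) (fun v => Computes.tabulate (Ω := Ω) (l := vs)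
    (fun u => computes_empiricalCorrelation X v u) 0) (fun _ => 0)
  simp only [hvs, if_true] at hρ
  have hn := Computes.tabulate (Ω := Ω) (l := vs) h1 []
  simp only [hvs, if_true] at hn
  constructor
  · intro γ g x
    rw [bind_eq, bind_assoc', hρ.law_bind, bind_eq, bind_assoc', hn.law_bind, hf.law_bind]
  · intro γ g s hs
    rw [bind_eq, bind_assoc', add_assoc, add_assoc]
    refine hρ.halts_bind ?_
    rw [bind_eq, bind_assoc']
    exact hn.halts_bind (hf.halts_bind g s hs)

theorem realizes_op_bind {Ω α β : Type} {a : α} {f : α → RandAlg Ω β} {p : PMF β} {t : ℕ}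
    (h : Realizes (f a) p t) : Realizes (op a >>= f) p (1 + t) where
  law_bind g x := h.law_bind g x
  halts_bind g s hs := by
    rw [Nat.add_comm 1 t, Nat.add_right_comm]
    exact h.halts_bind g s hs

/-- The time bound covers `S = ∅` as well; the output law is identified only when there is a vertex
to resample. -/
theorem afterDraws_spec (m : ℕ) (S : Finset (Fin n)) (ρ₀ : ℝ) (X : Fin m → S → Spin) :
    ∃ nbr : S → List S, (∀ v u, u ∈ nbr v ↔ u ≠ v ∧ ρ₀ ≤ |corr X v u|) ∧
      ∃ p, Realizes (afterDraws n m S ρ₀ X) p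
        (S.card * (S.card * (8 * m + 13) + 1) + (S.card * (S.card * 6 + 1) +
          (1 + (1 + ⌈(n : ℝ) * Real.log n⌉₊ * (m * (S.card * 4 + 4) + 5))))) ∧
        ∀ (v₀ : S) (rest : List S), (Finset.univ : Finset S).sort = v₀ :: rest →
          p = Glauber.law (k := rest.length) (fun i => (v₀ :: rest).get i)
            (fun v x => condFreq X (nbr v) v x) (fun _ => 1) ⌈(n : ℝ) * Real.log n⌉₊ := by
  have hvs : ∀ v : S, v ∈ (Finset.univ : Finset S).sort := fun v => by
    rw [Finset.mem_sort]; exact Finset.mem_univ v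
  have hlen : ((Finset.univ : Finset S).sort).length = S.card := by
    rw [Finset.length_sort, Finset.card_univ, Fintype.card_coe]
  obtain ⟨nbr, h1, h2, h3⟩ := computes_tables (Ω := S → Spin) hvs ρ₀ X
  refine ⟨nbr, h2, ?_⟩
  rw [hlen] at h1 h3
  have hf : ∀ v x, Computes (Ω := S → Spin) (do
      let l ← op (nbr v)
      empiricalConditional X l v x) (condFreq X (nbr v) v x) (m * (S.card * 4 + 4) + 2) := by
    intro v x
    refine Computes.mono (.op_bind (computes_empiricalConditional X (nbr v) v x)) ?_
    have := Nat.mul_le_mul_left m (Nat.add_le_add_right (Nat.mul_le_mul_right 4 (h1 v)) 4)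
    omega
  have hg : ∃ p, Realizes (approxGlauber (Ω := S → Spin) ((Finset.univ : Finset S).sort)
      (fun v x => do
        let l ← op (nbr v)
        empiricalConditional X l v x) (fun _ => 1) ⌈(n : ℝ) * Real.log n⌉₊) p
      (⌈(n : ℝ) * Real.log n⌉₊ * (m * (S.card * 4 + 4) + 5)) ∧
        ∀ (v₀ : S) (rest : List S), (Finset.univ : Finset S).sort = v₀ :: rest →
          p = Glauber.law (k := rest.length) (fun i => (v₀ :: rest).get i)
            (fun v x => condFreq X (nbr v) v x) (fun _ => 1) ⌈(n : ℝ) * Real.log n⌉₊ := by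
    generalize hl : (Finset.univ : Finset S).sort = vs
    rcases vs with _ | ⟨v₀, rest⟩
    · exact ⟨_, (Computes.ret _ _).realizes, fun v₀ rest h => absurd h (List.cons_ne_nil _ _).symm⟩
    · refine ⟨_, realizes_approxGlauber v₀ rest hf _ _, fun v₁ rest' h => ?_⟩
      obtain ⟨rfl, rfl⟩ := List.cons.inj h
      rfl
  obtain ⟨p, hp, hp'⟩ := hg
  exact ⟨p, h3 _ p _ (realizes_op_bind (realizes_op_bind hp)), hp'⟩

theorem halts_H (n : ℕ) (hn : 0 < n) (S : Finset (Fin n)) (ρ₀ : ℝ) :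
    (H n n S ρ₀).HaltsWithin (100 * n ^ 4) := by
  have hvs : ∀ v : S, v ∈ (Finset.univ : Finset S).sort := fun v => by
    rw [Finset.mem_sort]; exact Finset.mem_univ v
  have hlen : ((Finset.univ : Finset S).sort).length = S.card := by
    rw [Finset.length_sort, Finset.card_univ, Fintype.card_coe]
  rw [H_eq]
  have h := halts_drawSamples_bind hvs n (f := afterDraws n n S ρ₀) fun X =>
    (afterDraws_spec n S ρ₀ X).choose_spec.2.choose_spec.1.haltsWithin
  refine h.mono ?_
  rw [hlen]
  have hS : S.card ≤ n := by simpa using S.card_le_univ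
  -- The crude `ln n ≤ n - 1` suffices for a polynomial bound.
  have hT : ⌈(n : ℝ) * Real.log n⌉₊ ≤ n * n := by
    rw [Nat.ceil_le]
    push_cast
    refine mul_le_mul_of_nonneg_left ?_ (Nat.cast_nonneg n)
    have := Real.log_le_sub_one_of_pos (show (0 : ℝ) < n by exact_mod_cast hn)
    linarith
  calc _ ≤ n * (2 * n + 2) + (n * (n * (8 * n + 13) + 1) + (n * (n * 6 + 1) +
          (1 + (1 + n * n * (n * (n * 4 + 4) + 5))))) := by gcongr
    _ = 4 * n ^ 4 + 12 * n ^ 3 + 26 * n ^ 2 + 4 * n + 2 := by ring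
    _ ≤ 4 * n ^ 4 + 12 * n ^ 4 + 26 * n ^ 4 + 4 * n ^ 4 + 2 * n ^ 4 := by
        have h1 : n ^ 3 ≤ n ^ 4 := Nat.pow_le_pow_right hn (by norm_num)
        have h2 : n ^ 2 ≤ n ^ 4 := Nat.pow_le_pow_right hn (by norm_num)
        have h3 : n ≤ n ^ 4 := Nat.le_self_pow (by norm_num) n
        have h4 : 1 ≤ n ^ 4 := Nat.one_le_pow _ _ hn
        omega
    _ ≤ 100 * n ^ 4 := by omega

/-- The law of the output of the algorithm is that of the approximate Glauber dynamics. -/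
theorem law_H (m : ℕ) {S : Finset (Fin n)} (hS : S.Nonempty) (ρ₀ : ℝ) :
    ∃ (k : ℕ) (e : Fin (k + 1) → S), Bijective e ∧ ∀ x : ℕ → S → Spin,
      ∃ nbr : S → List S,
        (∀ v u, u ∈ nbr v ↔ u ≠ v ∧ ρ₀ ≤ |corr (fun i : Fin m => x i) v u|) ∧
        (H n m S ρ₀).law x = Glauber.law e
          (fun v y => condFreq (fun i : Fin m => x i) (nbr v) v y) (fun _ => 1)
            ⌈(n : ℝ) * Real.log n⌉₊ := by
  have hvs : ∀ v : S, v ∈ (Finset.univ : Finset S).sort := fun v => by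
    rw [Finset.mem_sort]; exact Finset.mem_univ v
  obtain ⟨v₀, rest, hl⟩ : ∃ (v₀ : S) (rest : List S),
      (Finset.univ : Finset S).sort (· ≤ ·) = v₀ :: rest := by
    obtain ⟨v, hv⟩ := hS
    exact List.exists_cons_of_ne_nil (List.ne_nil_of_mem (hvs ⟨v, hv⟩))
  refine ⟨rest.length, fun i => (v₀ :: rest).get i, ⟨?_, ?_⟩, fun x => ?_⟩
  · have := Finset.sort_nodup (Finset.univ : Finset S) (· ≤ ·)
    rw [hl] at this
    exact List.nodup_iff_injective_get.1 this
  · intro v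
    have := hvs v
    rw [hl] at this
    exact List.get_of_mem this
  · obtain ⟨nbr, h1, p, h2, h3⟩ := afterDraws_spec m S ρ₀ fun i : Fin m => x i
    refine ⟨nbr, h1, ?_⟩
    rw [H_eq, law_drawSamples_bind hvs, h2.law, h3 v₀ rest hl]

end HighGirth

end

noncomputable section

namespace HighGirth

open Ising Function Gibbs

/-! ### Finitely many empirical means that control the algorithm -/

section Tests

variable {n : ℕ} {M : Matrix (Fin n) (Fin n) ℝ} {θ : Fin n → ℝ} {S : Finset (Fin n)}

/-- The expectation of a function of the visible spins. -/
def visAvg (M : Matrix (Fin n) (Fin n) ℝ) (θ : Fin n → ℝ) (h : (S → Spin) → ℝ) : ℝ :=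
  avg (weight M θ) Finset.univ (fun _ => 1) fun y => h fun i => y i

/-- The indicator of the visible configurations that agree with `y` on `l`. -/
def match_ (l : Finset S) (y x : S → Spin) : ℝ := if ∀ u ∈ l, x u = y u then 1 else 0

theorem match_eq_agree (l : Finset S) (y : S → Spin) (z : Fin n → Spin) :
    match_ l y (fun i => z i) = agree (l.map (Embedding.subtype _)) (extend y) z := by
  rw [match_, agree]
  congr 1
  simp only [Finset.mem_map, Embedding.subtype_apply, forall_exists_index, and_imp, eq_iff_iff]
  constructor
  · rintro h _ u hu rfl
    rw [extend_coe]
    exact h u hu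
  · intro h u hu
    rw [← extend_coe y u]
    exact h u u hu rfl

/-- The test functions whose empirical means determine the behaviour of the algorithm, for given
sets `B v` of vertices. -/
def tests (B : S → Finset S) : Finset ((S → Spin) → ℝ) :=
  (Finset.univ.image fun u : S => fun x : S → Spin => spinVal (x u)) ∪
    ((Finset.univ.image fun p : S × S => fun x : S → Spin => spinVal (x p.1) * spinVal (x p.2)) ∪
      (Finset.univ.biUnion fun v : S =>
        ((B v).powerset ×ˢ (B v).powerset).image
            (fun q => match_ q.1 fun u => if u ∈ q.2 then 1 else -1) ∪
          ((B v).powerset ×ˢ (B v).powerset).image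
            (fun q x => up v x * match_ q.1 (fun u => if u ∈ q.2 then 1 else -1) x)))

/-- A pattern on a subset of `B v` is encoded by two subsets of `B v`, its domain and its plus
spins, whence at most `4 ^ K` patterns per vertex. -/
theorem card_tests_le {B : S → Finset S} {K : ℕ} (hB : ∀ v, (B v).card ≤ K) :
    (tests B).card ≤ n + (n * n + n * (2 * 4 ^ K)) := by
  have hS : Fintype.card S ≤ n := by simpa using S.card_le_univ
  have h1 : ∀ v, ((B v).powerset ×ˢ (B v).powerset).card ≤ 4 ^ K := by
    intro v
    rw [Finset.card_product, Finset.card_powerset, ← mul_pow]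
    exact Nat.pow_le_pow_right (by norm_num) (hB v)
  refine (Finset.card_union_le _ _).trans (add_le_add ?_ ((Finset.card_union_le _ _).trans
    (add_le_add ?_ (Finset.card_biUnion_le.trans ?_))))
  · exact Finset.card_image_le.trans (by rwa [Finset.card_univ])
  · refine Finset.card_image_le.trans ?_
    rw [Finset.card_univ, Fintype.card_prod]
    exact Nat.mul_le_mul hS hS
  · refine (Finset.sum_le_sum (g := fun _ => 2 * 4 ^ K) fun v _ => ?_).trans ?_
    · refine (Finset.card_union_le _ _).trans ?_
      have := (Finset.card_image_le (f := fun q : Finset S × Finset S => match_ q.1 fun u =>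
        if u ∈ q.2 then 1 else -1)).trans (h1 v)
      have := (Finset.card_image_le (f := fun (q : Finset S × Finset S) x => up v x *
        match_ q.1 (fun u => if u ∈ q.2 then 1 else -1) x)).trans (h1 v)
      omega
    · rw [Finset.sum_const, Finset.card_univ, smul_eq_mul]
      exact Nat.mul_le_mul_right _ hS

theorem match_nonneg (l : Finset S) (y x : S → Spin) : 0 ≤ match_ l y x := by
  unfold match_; split_ifs <;> norm_num

theorem match_le_one (l : Finset S) (y x : S → Spin) : match_ l y x ≤ 1 := by
  unfold match_; split_ifs <;> norm_num

theorem abs_tests_le {B : S → Finset S} {h : (S → Spin) → ℝ} (hh : h ∈ tests B) (x : S → Spin) :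
    |h x| ≤ 1 := by
  simp only [tests, Finset.mem_union, Finset.mem_image, Finset.mem_univ, true_and,
    Finset.mem_biUnion] at hh
  rcases hh with ⟨u, rfl⟩ | ⟨p, rfl⟩ | ⟨v, ⟨q, -, rfl⟩ | ⟨q, -, rfl⟩⟩
  · exact (abs_spinVal _).le
  · rw [abs_mul, abs_spinVal, abs_spinVal, mul_one]
  · rw [abs_of_nonneg (match_nonneg _ _ _)]
    exact match_le_one _ _ _
  · rw [abs_of_nonneg (mul_nonneg (up_nonneg v x) (match_nonneg _ _ _))]
    exact mul_le_one₀ (up_le_one v x) (match_nonneg _ _ _) (match_le_one _ _ _)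

theorem spin_mem_tests (B : S → Finset S) (u : S) :
    (fun x : S → Spin => spinVal (x u)) ∈ tests B :=
  Finset.mem_union_left _ (Finset.mem_image_of_mem _ (Finset.mem_univ u))

theorem spin_mul_mem_tests (B : S → Finset S) (v u : S) :
    (fun x : S → Spin => spinVal (x v) * spinVal (x u)) ∈ tests B :=
  Finset.mem_union_right _ (Finset.mem_union_left _
    (Finset.mem_image_of_mem (fun p : S × S => fun x : S → Spin => spinVal (x p.1) * spinVal (x p.2))
      (Finset.mem_univ (v, u))))

theorem match_mem_tests (B : S → Finset S) {v : S} {l : Finset S} (hl : l ⊆ B v) (y : S → Spin) :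
    match_ l y ∈ tests B ∧ (fun x => up v x * match_ l y x) ∈ tests B := by
  have h1 : match_ l y = match_ l fun u => if u ∈ l.filter (fun u => y u = 1) then 1 else -1 := by
    funext x
    rw [match_, match_]
    congr 1
    refine propext (forall₂_congr fun u hu => ?_)
    rcases spin_cases (y u) with h | h <;> simp [h, hu]
  rw [h1]
  have h2 : (l, l.filter fun u => y u = 1) ∈ (B v).powerset ×ˢ (B v).powerset :=
    Finset.mem_product.2 ⟨Finset.mem_powerset.2 hl,
      Finset.mem_powerset.2 ((Finset.filter_subset _ _).trans hl)⟩
  constructor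
  · exact Finset.mem_union_right _ (Finset.mem_union_right _ (Finset.mem_biUnion.2
      ⟨v, Finset.mem_univ v, Finset.mem_union_left _ (Finset.mem_image.2 ⟨_, h2, rfl⟩)⟩))
  · exact Finset.mem_union_right _ (Finset.mem_union_right _ (Finset.mem_biUnion.2
      ⟨v, Finset.mem_univ v, Finset.mem_union_right _ (Finset.mem_image.2 ⟨_, h2, rfl⟩)⟩))

/-- The empirical covariance is within `3t ≤ ρ₀ c / 2` of the true one, and the empirical standard
deviations have product between `c` and 1. So passing the threshold forces a true covariance of at
least `ρ₀ c - 3t`, and failing it one of at most `ρ₀ + 3t`. -/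
theorem corr_threshold {mv mu mvu Mv Mu Mvu t c ρ₀ : ℝ} (hMv : |Mv| ≤ 1)
    (hmu : |mu| ≤ 1) (hmv : |mv| ≤ 1) (hMu : |Mu| ≤ 1) (h1 : |mv - Mv| ≤ t) (h2 : |mu - Mu| ≤ t)
    (h3 : |mvu - Mvu| ≤ t)
    (hc : 0 < c) (hv : 2 * c ≤ 1 - Mv ^ 2) (hu : 2 * c ≤ 1 - Mu ^ 2) (hρ : 0 < ρ₀) (hρ1 : ρ₀ ≤ 1)
    (ht : 6 * t ≤ ρ₀ * c) :
    (ρ₀ ≤ |(mvu - mv * mu) / Real.sqrt ((1 - mv * mv) * (1 - mu * mu))| →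
      ρ₀ * c / 2 ≤ |Mvu - Mv * Mu|) ∧
    (¬ ρ₀ ≤ |(mvu - mv * mu) / Real.sqrt ((1 - mv * mv) * (1 - mu * mu))| →
      |Mvu - Mv * Mu| ≤ 2 * ρ₀) := by
  have ht0 : 0 ≤ t := (abs_nonneg _).trans h1
  have htc : 6 * t ≤ c := ht.trans (by nlinarith)
  have hcov : |(mvu - mv * mu) - (Mvu - Mv * Mu)| ≤ 3 * t := by
    have e : (mvu - mv * mu) - (Mvu - Mv * Mu) = (mvu - Mvu) - mu * (mv - Mv) - Mv * (mu - Mu) := by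
      ring
    rw [e]
    have a1 : |mu * (mv - Mv)| ≤ t := by
      rw [abs_mul]; nlinarith [abs_nonneg (mv - Mv), abs_nonneg mu]
    have a2 : |Mv * (mu - Mu)| ≤ t := by
      rw [abs_mul]; nlinarith [abs_nonneg (mu - Mu), abs_nonneg Mv]
    rw [abs_le] at h3 a1 a2 ⊢
    constructor <;> linarith [h3.1, h3.2, a1.1, a1.2, a2.1, a2.2]
  have hvar : ∀ {m M' : ℝ}, |m| ≤ 1 → |M'| ≤ 1 → |m - M'| ≤ t → 2 * c ≤ 1 - M' ^ 2 →
      c ≤ 1 - m * m ∧ 1 - m * m ≤ 1 := by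
    intro m M' hm hM' hmM hM
    refine ⟨?_, by nlinarith [mul_self_nonneg m]⟩
    have e : m * m - M' ^ 2 = (m - M') * (m + M') := by ring
    have a1 : |(m - M') * (m + M')| ≤ t * 2 := by
      rw [abs_mul]
      refine mul_le_mul hmM ((abs_add_le _ _).trans (by linarith)) (abs_nonneg _) ht0
    have := (abs_le.1 a1).2
    linarith
  obtain ⟨v1, v2⟩ := hvar hmv hMv h1 hv
  obtain ⟨u1, u2⟩ := hvar hmu hMu h2 hu
  set sd := Real.sqrt ((1 - mv * mv) * (1 - mu * mu))
  have sd1 : c ≤ sd := by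
    refine Real.le_sqrt_of_sq_le ?_
    rw [sq]
    exact mul_le_mul v1 u1 hc.le (hc.le.trans v1)
  have sd2 : sd ≤ 1 := Real.sqrt_le_one.2 (mul_le_one₀ v2 (hc.le.trans u1) u2)
  have sd0 : 0 < sd := hc.trans_le sd1
  rw [abs_div, abs_of_pos sd0, le_div_iff₀ sd0, not_le]
  have a1 := abs_sub_abs_le_abs_sub (mvu - mv * mu) (Mvu - Mv * Mu)
  have a2 := abs_sub_abs_le_abs_sub (Mvu - Mv * Mu) (mvu - mv * mu)
  rw [abs_sub_comm (Mvu - Mv * Mu) (mvu - mv * mu)] at a2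
  have a3 : ρ₀ * c ≤ ρ₀ * sd := mul_le_mul_of_nonneg_left sd1 hρ.le
  have a4 : ρ₀ * sd ≤ ρ₀ * 1 := mul_le_mul_of_nonneg_left sd2 hρ.le
  have a5 : ρ₀ * c ≤ ρ₀ := by
    have : c ≤ 1 := by nlinarith [sq_nonneg Mv]
    nlinarith
  constructor <;> intro h <;> linarith

/-- The denominator stays above `p / 2`, and `N₁ - g N` is at most `2t + δ p` in absolute value. -/
theorem ratio_bound {N₁ N p₁ p g t δ π : ℝ} (h1 : |N₁ - p₁| ≤ t) (h2 : |N - p| ≤ t)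
    (h3 : |p₁ - g * p| ≤ δ * p) (hg0 : 0 ≤ g) (hg1 : g ≤ 1) (hδ : 0 ≤ δ) (hπ : 0 < π)
    (hp : π ≤ p) (ht : 2 * t ≤ π) : |N₁ / N - g| ≤ 4 * t / π + 2 * δ := by
  have ht0 : 0 ≤ t := (abs_nonneg _).trans h1
  have hN : p / 2 ≤ N := by linarith [(abs_le.1 h2).1]
  have hp0 : 0 < p := hπ.trans_le hp
  have hN0 : 0 < N := by linarith
  have e : N₁ / N - g = (N₁ - p₁ + (p₁ - g * p) - g * (N - p)) / N := by
    field_simp; ring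
  rw [e, abs_div, abs_of_pos hN0, div_le_iff₀ hN0]
  have a1 : |g * (N - p)| ≤ t := by
    rw [abs_mul, abs_of_nonneg hg0]; nlinarith [abs_nonneg (N - p)]
  have a2 : |N₁ - p₁ + (p₁ - g * p) - g * (N - p)| ≤ 2 * t + δ * p := by
    rw [abs_le] at h1 h3 a1 ⊢
    constructor <;> linarith [h1.1, h1.2, h3.1, h3.2, a1.1, a1.2]
  refine a2.trans ?_
  have a3 : 2 * t ≤ 4 * t / π * N := by
    rw [div_mul_eq_mul_div, le_div_iff₀ hπ]
    have : π / 2 ≤ N := by linarith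
    nlinarith
  nlinarith

theorem mean_abs_le {m : ℕ} {V : Type} (X : Fin m → V → Spin) {h : (V → Spin) → ℝ}
    (hh : ∀ x, |h x| ≤ 1) : |mean X h| ≤ 1 := by
  rw [mean, abs_div, Nat.abs_cast]
  refine div_le_one_of_le₀ ((Finset.abs_sum_le_sum_abs _ _).trans ?_) (Nat.cast_nonneg m)
  refine (Finset.sum_le_sum fun i _ => hh (X i)).trans ?_
  simp

theorem condFreq_eq {m : ℕ} (hm : 0 < m) (X : Fin m → S → Spin) {l : List S} {l' : Finset S}
    (hl : ∀ u, u ∈ l' ↔ u ∈ l) (v : S) (y : S → Spin) :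
    condFreq X l v y = mean X (fun x => up v x * match_ l' y x) / mean X (match_ l' y) := by
  have hm' : (m : ℝ) ≠ 0 := by exact_mod_cast hm.ne'
  rw [condFreq, mean, mean, div_div_div_cancel_right₀ hm']
  congr 1
  · refine Finset.sum_congr rfl fun i _ => ?_
    simp only [match_, hl, up]
    by_cases h2 : X i v = 1 <;> simp [h2]
  · refine Finset.sum_congr rfl fun i _ => ?_
    simp only [match_, hl]
    split_ifs <;> rfl

/-- If the empirical means of the test functions are accurate, then so are the empirical conditional
probabilities that the algorithm uses. -/
theorem exists_tests {b α r d ρ₀ t δ : ℝ} {R ℓ L K : ℕ} (h : Tame b α M θ) (hg : Girth r M)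
    (hd0 : 0 ≤ d) (hdeg : ∀ i, ((Finset.univ.filter fun j => M i j ≠ 0).card : ℝ) ≤ d)
    (hR : (R : ℝ) + ℓ ≤ r) (hρ : 0 < ρ₀) (hρ1 : ρ₀ ≤ 1) (ht : 6 * t ≤ ρ₀ * floor b α)
    (hL : 1 / 2 ^ L < ρ₀ * floor b α / 2) (hK : (d + 1) ^ L ≤ K) (htK : 2 * t ≤ floor b α ^ K)
    (hδ : 1 / 2 ^ ℓ + (d + 1) ^ ℓ * ((8 / floor b α) ^ (ℓ + 1) *
      (2 * ρ₀ + 32 * (2 / 2 ^ R)) / (2 * floor b α)) ≤ δ) (S : Finset (Fin n)) :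
    ∃ 𝓕 : Finset ((S → Spin) → ℝ), 𝓕.card ≤ n + (n * n + n * (2 * 4 ^ K)) ∧
      (∀ f ∈ 𝓕, ∀ x, |f x| ≤ 1) ∧
      ∀ {m : ℕ} (_ : 0 < m) (X : Fin m → S → Spin),
        (∀ f ∈ 𝓕, |mean X f - visAvg M θ f| ≤ t) → ∀ nbr : S → List S,
          (∀ v u, u ∈ nbr v ↔ u ≠ v ∧ ρ₀ ≤ |corr X v u|) → ∀ v y,
            |condFreq X (nbr v) v y - conditional M θ v y| ≤ 4 * t / floor b α ^ K + 2 * δ := by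
  classical
  set c := floor b α with hcdef
  have hc : 0 < c := floor_pos b α
  have hw := weight_pos M θ
  set x₀ : Fin n → Spin := fun _ => 1 with hx₀
  let C : S → S → ℝ := fun u v => cov (weight M θ) Finset.univ x₀ u (spinAt v)
  have hC : ∀ u v : S, C u v = visAvg M θ (fun x : S → Spin => spinVal (x u) * spinVal (x v)) -
      visAvg M θ (fun x : S → Spin => spinVal (x u)) *
        visAvg M θ (fun x : S → Spin => spinVal (x v)) := fun u v => rfl
  have hCsymm : ∀ u v, C u v = C v u := fun u v => by
    rw [hC, hC, mul_comm (visAvg M θ fun x : S → Spin => spinVal (x u))]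
    simp only [mul_comm]
  -- The random sets `S_v` are to be confined to these deterministic ones, defined by true
  -- covariances, so that the family of test functions does not depend on the samples.
  let B : S → Finset S := fun v => Finset.univ.filter fun u => u ≠ v ∧ ρ₀ * c / 2 ≤ |C v u|
  have hBcard : ∀ v, (B v).card ≤ K := by
    intro v
    have h1 : ((B v).map (Embedding.subtype _)) ⊆
        Finset.univ.filter fun j => Reach M L (v : Fin n) j := by
      intro j hj
      obtain ⟨u, hu, rfl⟩ := Finset.mem_map.1 hj
      refine Finset.mem_filter.2 ⟨Finset.mem_univ _, ?_⟩
      -- Beyond distance `L` the covariance is at most `2 ^ (-L)`, below the threshold in `B v`;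
      -- thus `B v` lies in a ball.
      by_contra hr
      have h2 := (Finset.mem_filter.1 hu).2.2
      have h3 := h.abs_cov_le_of_not_reach L (T := {(v : Fin n)}) (a := u)
        (fun t ht => by rw [Finset.mem_singleton.1 ht]; exact hr) Finset.univ x₀
        (f := spinAt (v : Fin n)) (fun y => (abs_spinAt _ y).le) fun y i s hi => by
          rw [spinAt, spinAt, update_of_ne fun e => hi (Finset.mem_singleton.2 e.symm)]
      rw [Finset.card_singleton, Nat.cast_one] at h3
      rw [hCsymm] at h2
      exact absurd (h2.trans h3) (not_le.2 hL)
    have h2 := Finset.card_le_card h1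
    rw [Finset.card_map] at h2
    have h3 : ((B v).card : ℝ) ≤ K := by
      calc ((B v).card : ℝ) ≤ _ := by exact_mod_cast h2
        _ ≤ (d + 1) ^ L := card_reach_le h.symm h.diag hd0 hdeg L v
        _ ≤ K := hK
    exact_mod_cast h3
  refine ⟨tests B, card_tests_le hBcard, fun f hf => abs_tests_le hf, ?_⟩
  intro m hm X hX nbr hnbr v y
  set l : Finset S := (nbr v).toFinset with hl
  have hlmem : ∀ u, u ∈ l ↔ u ∈ nbr v := fun u => List.mem_toFinset
  have hthr : ∀ u : S, (ρ₀ ≤ |corr X v u| → ρ₀ * c / 2 ≤ |C v u|) ∧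
      (¬ ρ₀ ≤ |corr X v u| → |C v u| ≤ 2 * ρ₀) := by
    intro u
    rw [hC]
    have hs : ∀ u : S, |visAvg M θ (fun x : S → Spin => spinVal (x u))| ≤ 1 := fun u =>
      avg_abs_le hw fun y _ => (abs_spinVal _).le
    have hvar : ∀ u : S, 2 * c ≤ 1 - visAvg M θ (fun x : S → Spin => spinVal (x u)) ^ 2 := fun u =>
      h.variance_ge x₀ u
    exact corr_threshold (hs v) (mean_abs_le X fun x => (abs_spinVal _).le)
      (mean_abs_le X fun x => (abs_spinVal _).le) (hs u) (hX _ (spin_mem_tests B v))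
      (hX _ (spin_mem_tests B u)) (hX _ (spin_mul_mem_tests B v u)) hc (hvar v) (hvar u) hρ hρ1 ht
  have hlB : l ⊆ B v := by
    intro u hu
    have h1 := (hnbr v u).1 ((hlmem u).1 hu)
    exact Finset.mem_filter.2 ⟨Finset.mem_univ u, h1.1, (hthr u).1 h1.2⟩
  set l' : Finset (Fin n) := l.map (Embedding.subtype _) with hl'
  have hl'S : l' ⊆ S.erase v := by
    intro j hj
    obtain ⟨u, hu, rfl⟩ := Finset.mem_map.1 hj
    have h1 := (hnbr v u).1 ((hlmem u).1 hu)
    exact Finset.mem_erase.2 ⟨fun e => h1.1 (Subtype.ext e), u.2⟩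
  have hbias : ∀ z, (∀ u ∈ l', z u = extend y u) →
      |avg (weight M θ) (hidden S v) z (up (v : Fin n)) -
        avg (weight M θ) (hidden S v) (extend y) (up (v : Fin n))| ≤ δ := by
    intro z hz
    refine (h.abs_conditional_sub_le hg hd0 hdeg hR x₀ (κ := 2 * ρ₀) (by linarith) ?_ hz).trans hδ
    intro u hu huv hul
    have h1 : (⟨u, hu⟩ : S) ∉ nbr v := fun h1 =>
      hul (Finset.mem_map.2 ⟨⟨u, hu⟩, (hlmem _).2 h1, rfl⟩)
    have h2 := (hthr ⟨u, hu⟩).2 fun h2 => h1 ((hnbr v _).2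
      ⟨fun e => huv (congrArg Subtype.val e), h2⟩)
    rw [hCsymm] at h2
    exact h2
  have hp := abs_avg_up_mul_agree_sub_le hl'S (x₀ := x₀) hbias
  have hδ0 : 0 ≤ δ := (abs_nonneg _).trans (hbias (extend y) fun u _ => rfl)
  obtain ⟨ht1, ht2⟩ := match_mem_tests B hlB y
  have e1 : visAvg M θ (match_ l y) =
      avg (weight M θ) Finset.univ x₀ (agree l' (extend y)) :=
    avg_congr fun z _ => match_eq_agree l y z
  have e2 : visAvg M θ (fun x => up v x * match_ l y x) =
      avg (weight M θ) Finset.univ x₀ (fun z => up (v : Fin n) z * agree l' (extend y) z) :=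
    avg_congr fun z _ => by
      change up v (fun i : S => z i) * match_ l y (fun i : S => z i) = _
      rw [match_eq_agree]
      rfl
  have hcK : c ^ K ≤ avg (weight M θ) Finset.univ x₀ (agree l' (extend y)) := by
    refine le_trans ?_ (h.floor_pow_le l' (extend y) x₀)
    refine pow_le_pow_of_le_one hc.le ?_ ?_
    · linarith [floor_le_half h (v : Fin n)]
    · rw [hl', Finset.card_map]
      exact (Finset.card_le_card hlB).trans (hBcard v)
  rw [condFreq_eq hm X hlmem v y]
  have hc1 := hX _ ht1
  have hc2 := hX _ ht2
  rw [e1] at hc1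
  rw [e2] at hc2
  exact ratio_bound hc2 hc1 hp (conditional_mem v y).1 (conditional_mem v y).2 hδ0 (pow_pos hc K)
    hcK htK

end Tests

end HighGirth

end

noncomputable section

namespace HighGirth

open Ising Function Gibbs RandAlg ProbabilityTheory

instance : MeasurableSingletonClass Spin :=
  ⟨fun s => by
    have h : ({s} : Set Spin) = Units.val ⁻¹' {(s : ℤ)} := by
      ext t
      simp [Units.ext_iff]
    rw [h]
    exact comap_measurable _ (measurableSet_singleton _)⟩

/-! ### Concentration of empirical means -/

section Hoeffding

variable {n : ℕ} {S : Finset (Fin n)}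

/-- The law of the sequence of samples. -/
abbrev samples (Q : PMF (S → Spin)) : Measure (ℕ → S → Spin) :=
  Measure.infinitePi fun _ : ℕ => Q.toMeasure

/-- A centred variable with values in an interval of length 2 is sub-Gaussian with parameter 1. -/
theorem hoeffding_upper (Q : PMF (S → Spin)) {f : (S → Spin) → ℝ} (hf : ∀ x, |f x| ≤ 1) (m : ℕ)
    {t : ℝ} (ht : 0 ≤ t) :
    (samples Q).real {x | m * t ≤ ∑ i ∈ Finset.range m, (f (x i) - ∑ z, (Q z).toReal * f z)} ≤
      Real.exp (-(m * t ^ 2) / 2) := by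
  have hfm : Measurable f := measurable_of_finite f
  have hint : ∫ z, f z ∂Q.toMeasure = ∑ z, (Q z).toReal * f z := by
    rw [PMF.integral_eq_sum]
    simp only [smul_eq_mul]
  have h1 : HasSubgaussianMGF (fun z => f z - ∑ z, (Q z).toReal * f z)
      ((‖(1 : ℝ) - (-1)‖₊ / 2) ^ 2) Q.toMeasure := by
    rw [← hint]
    exact hasSubgaussianMGF_of_mem_Icc hfm.aemeasurable
      (ae_of_all _ fun x => ⟨(abs_le.1 (hf x)).1, (abs_le.1 (hf x)).2⟩)
  have hc : ((‖(1 : ℝ) - (-1)‖₊ / 2) ^ 2 : NNReal) = 1 := by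
    have : ‖(1 : ℝ) - (-1)‖₊ = 2 := by
      ext
      norm_num
    rw [this]
    simp
  rw [hc] at h1
  have hind : iIndepFun (fun (i : ℕ) (x : ℕ → S → Spin) => f (x i) - ∑ z, (Q z).toReal * f z)
      (samples Q) :=
    iIndepFun_infinitePi (P := fun _ : ℕ => Q.toMeasure)
      (X := fun _ z => f z - ∑ z, (Q z).toReal * f z) fun _ => hfm.sub_const _
  have h2 : ∀ i < m, HasSubgaussianMGF
      (fun x : ℕ → S → Spin => f (x i) - ∑ z, (Q z).toReal * f z) 1 (samples Q) := by
    intro i _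
    refine HasSubgaussianMGF.of_map (Y := fun x : ℕ → S → Spin => x i)
      (X := fun z => f z - ∑ z, (Q z).toReal * f z) (measurable_pi_apply i).aemeasurable ?_
    rwa [show Measure.map (fun x : ℕ → S → Spin => x i) (samples Q) = Q.toMeasure from
      Measure.infinitePi_map_eval _ i]
  have h3 := HasSubgaussianMGF.measure_sum_range_ge_le_of_iIndepFun hind h2
    (mul_nonneg (Nat.cast_nonneg m) ht)
  refine h3.trans (le_of_eq ?_)
  congr 1
  rcases Nat.eq_zero_or_pos m with rfl | hm
  · simp
  · have : (m : ℝ) ≠ 0 := by exact_mod_cast hm.ne'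
    simp only [NNReal.coe_one, mul_one]
    field_simp

theorem hoeffding_mean (Q : PMF (S → Spin)) {f : (S → Spin) → ℝ} (hf : ∀ x, |f x| ≤ 1) {m : ℕ}
    (hm : 0 < m) {t : ℝ} (ht : 0 ≤ t) :
    samples Q {x | ¬ |mean (fun i : Fin m => x i) f - ∑ z, (Q z).toReal * f z| ≤ t} ≤
      ENNReal.ofReal (2 * Real.exp (-(m * t ^ 2) / 2)) := by
  have hm' : (0 : ℝ) < m := by exact_mod_cast hm
  set E := ∑ z, (Q z).toReal * f z with hE
  have hE' : ∑ z, (Q z).toReal * (fun z => -f z) z = -E := by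
    rw [hE, ← Finset.sum_neg_distrib]
    exact Finset.sum_congr rfl fun z _ => mul_neg _ _
  have h1 := hoeffding_upper Q hf m ht
  have h2 := hoeffding_upper Q (f := fun z => -f z) (fun x => by rw [abs_neg]; exact hf x) m ht
  rw [hE'] at h2
  rw [← hE] at h1
  clear_value E
  have hsum : ∀ x : ℕ → S → Spin, ∑ i ∈ Finset.range m, (f (x i) - E) =
      m * (mean (fun i : Fin m => x i) f - E) := by
    intro x
    rw [mean, Finset.sum_sub_distrib, Finset.sum_const, Finset.card_range, nsmul_eq_mul,
      Finset.sum_range]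
    field_simp
  have hsub : {x : ℕ → S → Spin | ¬ |mean (fun i : Fin m => x i) f - E| ≤ t} ⊆
      {x | m * t ≤ ∑ i ∈ Finset.range m, (f (x i) - E)} ∪
        {x | m * t ≤ ∑ i ∈ Finset.range m, (-f (x i) - -E)} := by
    intro x hx
    rw [Set.mem_ofPred_eq, not_le, lt_abs] at hx
    have hneg : ∑ i ∈ Finset.range m, (-f (x i) - -E) =
        -∑ i ∈ Finset.range m, (f (x i) - E) :=
      (Finset.sum_congr rfl fun i _ => by ring).trans (Finset.sum_neg_distrib _)
    rw [Set.mem_union, Set.mem_ofPred_eq, Set.mem_ofPred_eq, hneg, hsum]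
    rcases hx with hx | hx
    · left; nlinarith
    · right; nlinarith
  refine (measure_mono hsub).trans ((measure_union_le _ _).trans ?_)
  rw [two_mul, ENNReal.ofReal_add (Real.exp_pos _).le (Real.exp_pos _).le]
  refine add_le_add ?_ ?_
  · rw [← ENNReal.ofReal_toReal (measure_ne_top (samples Q) _)]
    exact ENNReal.ofReal_le_ofReal h1
  · rw [← ENNReal.ofReal_toReal (measure_ne_top (samples Q) _)]
    exact ENNReal.ofReal_le_ofReal h2

end Hoeffding

/-! ### The learning error for fixed parameters -/

section Error

variable {n : ℕ} {M : Matrix (Fin n) (Fin n) ℝ} {θ : Fin n → ℝ} {S : Finset (Fin n)}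

theorem learningError_le_card (A : RandAlg (S → Spin) (S → Spin)) (Q : PMF (S → Spin)) :
    A.learningError Q ≤ n := by
  refine (lintegral_mono fun x => Glauber.earthMover_le_card Q (A.law x)).trans ?_
  rw [lintegral_const, measure_univ, mul_one, Fintype.card_coe]
  exact_mod_cast (by simpa using S.card_le_univ : S.card ≤ n)

theorem bind_censored {k : ℕ} (e : Fin (k + 1) → S) :
    (censored S M θ).bind (Glauber.step e (conditional M θ)) = censored S M θ := by
  refine Glauber.bind_step e fun v => Glauber.bind_siteStep (fun z => conditional_mem v z)
    (fun z s => ?_) fun z => censored_update z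
  -- The spin at `v` and the default values at hidden vertices are irrelevant: all these vertices
  -- are free in `hidden S v`.
  refine avg_boundary (fun i hi => ?_) _
  rw [mem_hidden, not_or, not_not] at hi
  rw [Gibbs.extend, Gibbs.extend, dif_pos hi.2, dif_pos hi.2,
    update_of_ne fun e => hi.1 (congrArg Subtype.val e)]

/-- Use `1 - x ≤ exp (-x)`: with `k + 1 ≤ n` vertices, `n ln n` steps amount to at least `ln n`
sweeps. -/
theorem contraction_le {a : ℝ} (ha1 : a < 1) (ha0 : 0 ≤ a) {k : ℕ} (hn : 0 < n)
    (hk : k + 1 ≤ n) :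
    (1 - (1 - a) / (k + 1 : ℕ)) ^ ⌈(n : ℝ) * Real.log n⌉₊ ≤
      Real.exp (-((1 - a) * Real.log n)) := by
  have hk0 : (0 : ℝ) < (k + 1 : ℕ) := by positivity
  have hk1 : (1 : ℝ) ≤ (k + 1 : ℕ) := by exact_mod_cast Nat.le_add_left 1 k
  have hkn : ((k + 1 : ℕ) : ℝ) ≤ n := by exact_mod_cast hk
  have hlog : 0 ≤ Real.log n := Real.log_nonneg (by exact_mod_cast hn)
  have h0 : 0 ≤ 1 - (1 - a) / (k + 1 : ℕ) := by
    rw [sub_nonneg, div_le_one hk0]; linarith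
  have h1 : 1 - (1 - a) / (k + 1 : ℕ) ≤ Real.exp (-((1 - a) / (k + 1 : ℕ))) := by
    have := Real.add_one_le_exp (-((1 - a) / ((k + 1 : ℕ) : ℝ)))
    linarith
  refine (pow_le_pow_left₀ h0 h1 _).trans ?_
  rw [← Real.exp_nat_mul]
  refine Real.exp_le_exp.2 ?_
  rw [mul_neg, neg_le_neg_iff, ← mul_div_assoc, le_div_iff₀ hk0]
  have h2 : ((k + 1 : ℕ) : ℝ) * Real.log n ≤ ⌈(n : ℝ) * Real.log n⌉₊ :=
    (mul_le_mul_of_nonneg_right hkn hlog).trans (Nat.le_ceil _)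
  nlinarith

/-- The learning error for given parameters of the analysis. -/
theorem learningError_le {b α r d ρ₀ t δ : ℝ} {R ℓ L K : ℕ} (hn : 0 < n) (h : Tame b α M θ)
    (hg : Girth r M) (hd0 : 0 ≤ d)
    (hdeg : ∀ i, ((Finset.univ.filter fun j => M i j ≠ 0).card : ℝ) ≤ d)
    (hR : (R : ℝ) + ℓ ≤ r) (hρ : 0 < ρ₀) (hρ1 : ρ₀ ≤ 1) (ht0 : 0 ≤ t)
    (ht : 6 * t ≤ ρ₀ * floor b α)
    (hL : 1 / 2 ^ L < ρ₀ * floor b α / 2) (hK : (d + 1) ^ L ≤ K) (htK : 2 * t ≤ floor b α ^ K)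
    (hδ : 1 / 2 ^ ℓ + (d + 1) ^ ℓ * ((8 / floor b α) ^ (ℓ + 1) *
      (2 * ρ₀ + 32 * (2 / 2 ^ R)) / (2 * floor b α)) ≤ δ) (S : Finset (Fin n)) :
    (H n n S ρ₀).learningError (censored S M θ) ≤ ENNReal.ofReal (n *
      (Real.exp (-((1 - 2 * α) * Real.log n)) +
        (4 * t / floor b α ^ K + 2 * δ) / (1 - 2 * α) +
          (n + (n * n + n * (2 * 4 ^ K))) * (2 * Real.exp (-(n * t ^ 2) / 2)))) := by
  have hc := floor_pos b α
  have hα : 0 < 1 - 2 * α := by linarith [h.lt_half]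
  have hδ0 : 0 ≤ δ := le_trans (by positivity) hδ
  set Q := censored S M θ with hQ
  obtain ⟨𝓕, hcard, hbd, h𝓕⟩ := exists_tests h hg hd0 hdeg hR hρ hρ1 ht hL hK htK hδ S
  set ε := 4 * t / floor b α ^ K + 2 * δ with hε
  have hε0 : 0 ≤ ε := by positivity
  set C := (n : ℝ) * (Real.exp (-((1 - 2 * α) * Real.log n)) + ε / (1 - 2 * α)) with hC
  have hC0 : 0 ≤ C := by positivity
  let bad : Set (ℕ → S → Spin) :=
    ⋃ f ∈ 𝓕, {x | ¬ |mean (fun i : Fin n => x i) f - ∑ z, (Q z).toReal * f z| ≤ t}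
  have hbad : samples Q bad ≤ ENNReal.ofReal
      ((n + (n * n + n * (2 * 4 ^ K))) * (2 * Real.exp (-(n * t ^ 2) / 2))) := by
    refine (measure_biUnion_finset_le 𝓕 _).trans ?_
    refine (Finset.sum_le_sum fun f hf => hoeffding_mean Q (hbd f hf) hn ht0).trans ?_
    rw [Finset.sum_const, nsmul_eq_mul, ← ENNReal.ofReal_natCast,
      ← ENNReal.ofReal_mul (Nat.cast_nonneg _)]
    refine ENNReal.ofReal_le_ofReal (mul_le_mul_of_nonneg_right ?_ (by positivity))
    exact_mod_cast hcard
  have hSn : S.card ≤ n := by simpa using S.card_le_univ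
  have hgood : ∀ x, x ∉ bad → earthMover Q ((H n n S ρ₀).law x) ≤ ENNReal.ofReal C := by
    intro x hx
    rcases S.eq_empty_or_nonempty with hS | hS
    · refine (Glauber.earthMover_le_card Q _).trans ?_
      rw [Fintype.card_coe, hS, Finset.card_empty, Nat.cast_zero]
      exact zero_le
    · obtain ⟨k, e, he, hlaw⟩ := law_H n hS ρ₀
      obtain ⟨nbr, hnbr, hx'⟩ := hlaw x
      have hk : k + 1 ≤ n := by
        have := Fintype.card_of_bijective he
        rw [Fintype.card_fin, Fintype.card_coe] at this
        omega
      have hmean : ∀ f ∈ 𝓕, |mean (fun i : Fin n => x i) f - visAvg M θ f| ≤ t := by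
        intro f hf
        by_contra hcon
        refine hx (Set.mem_biUnion hf ?_)
        rw [visAvg, ← sum_censored] at hcon
        exact hcon
      have hfg := h𝓕 hn (fun i : Fin n => x i) hmean nbr hnbr
      rw [hx']
      refine (Glauber.earthMover_law_le he (bind_censored e) (a := 2 * α)
        (by linarith [h.nonneg]) (by linarith) hε0 hfg (fun v => h.conditional_contract v) _
        _).trans (ENNReal.ofReal_le_ofReal ?_)
      rw [hC]
      have h1 := contraction_le (a := 2 * α) (by linarith) (by linarith [h.nonneg]) hn hk
      have hkn : ((k + 1 : ℕ) : ℝ) ≤ n := by exact_mod_cast hk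
      have hbase : (0 : ℝ) ≤ 1 - (1 - 2 * α) / (k + 1 : ℕ) := by
        rw [sub_nonneg, div_le_one (by positivity)]
        have : (1 : ℝ) ≤ (k + 1 : ℕ) := by exact_mod_cast Nat.le_add_left 1 k
        linarith [h.nonneg]
      exact mul_le_mul hkn (add_le_add h1 le_rfl)
        (add_nonneg (pow_nonneg hbase _) (by positivity)) (Nat.cast_nonneg n)
  have hpt : ∀ x, earthMover Q ((H n n S ρ₀).law x) ≤
      ENNReal.ofReal C + bad.indicator (fun _ => (n : ℝ≥0∞)) x := by
    intro x
    by_cases hx : x ∈ bad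
    · rw [Set.indicator_of_mem hx]
      refine ((Glauber.earthMover_le_card Q _).trans ?_).trans le_add_self
      rw [Fintype.card_coe]
      exact_mod_cast hSn
    · exact (hgood x hx).trans le_self_add
  calc (H n n S ρ₀).learningError Q ≤
        ∫⁻ x, ENNReal.ofReal C + bad.indicator (fun _ => (n : ℝ≥0∞)) x ∂samples Q :=
        lintegral_mono hpt
    _ = ENNReal.ofReal C + ∫⁻ x, bad.indicator (fun _ => (n : ℝ≥0∞)) x ∂samples Q := by
        rw [lintegral_add_left measurable_const, lintegral_const, measure_univ, mul_one]
    -- Only the inequality is used here, so measurability of the bad event is not needed.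
    _ ≤ ENNReal.ofReal C + n * samples Q bad :=
        add_le_add le_rfl (lintegral_indicator_const_le _ _)
    _ ≤ ENNReal.ofReal C + n * ENNReal.ofReal
          ((n + (n * n + n * (2 * 4 ^ K))) * (2 * Real.exp (-(n * t ^ 2) / 2))) := by gcongr
    _ = _ := by
        rw [← ENNReal.ofReal_natCast n, ← ENNReal.ofReal_mul (Nat.cast_nonneg n),
          ← ENNReal.ofReal_add hC0 (by positivity), hC]
        congr 1
        ring

end Error

end HighGirth

end

noncomputable section

/-! ### Choice of parameters and asymptotics -/

namespace HighGirth

open Ising Gibbs RandAlg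

theorem floor_le_one_half {b α : ℝ} (h : 0 ≤ b + α) : floor b α ≤ 1 / 2 := by
  rw [floor, one_div, ← Real.sigmoid_zero]
  exact Real.sigmoid_le (by linarith)

theorem tame_of_isAdmissible {n : ℕ} {b d r : ℝ} {M : Matrix (Fin n) (Fin n) ℝ} {θ : Fin n → ℝ}
    (hb : 0 < b) (hd : 0 < d) (hbd : b * d < 1 / 2) (h : IsAdmissible b d r M θ) :
    Tame b (b * d) M θ where
  symm := h.symm
  diag := h.diag
  bias_le := h.bias_le
  lt_half := hbd
  nonneg := (mul_pos hb hd).le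
  row_sum i := by
    calc ∑ j, |M i j| = ∑ j ∈ Finset.univ.filter fun j => M i j ≠ 0, |M i j| := by
          rw [Finset.sum_filter]
          refine Finset.sum_congr rfl fun j _ => ?_
          by_cases hj : M i j = 0 <;> simp [hj]
      _ ≤ (Finset.univ.filter fun j => M i j ≠ 0).card • b :=
          Finset.sum_le_card_nsmul _ _ _ fun j _ => h.entry_le i j
      _ ≤ b * d := by
          rw [nsmul_eq_mul, mul_comm]
          exact mul_le_mul_of_nonneg_left (h.sparse i) hb.le

theorem tendsto_exp_neg_div {a : ℝ} (ha : 0 < a) :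
    Tendsto (fun y : ℝ => Real.exp (-(y / a))) atTop (nhds 0) :=
  Real.tendsto_exp_neg_atTop_nhds_zero.comp (tendsto_id.atTop_div_const ha)

/-- At `y = ln n` this says that the accuracy `n ^ (-1/4)` is fine enough for the correlation
threshold `1 / ln ln n`. -/
theorem eventually_log_mul_exp_le {c : ℝ} (hc : 0 < c) :
    ∀ᶠ y : ℝ in atTop, 6 * Real.exp (-(y / 4)) * Real.log y ≤ c := by
  have h := ((Real.tendsto_pow_mul_exp_neg_atTop_nhds_zero 1).comp
    (tendsto_id.atTop_div_const (show (0 : ℝ) < 4 by norm_num))).eventually_le_const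
      (show (0 : ℝ) < c / 24 by positivity)
  filter_upwards [h, eventually_gt_atTop 0] with y hy hy0
  simp only [Function.comp, id, pow_one] at hy
  have h1 : Real.log y ≤ y := (Real.log_le_sub_one_of_pos hy0).trans (by linarith)
  have h2 := mul_le_mul_of_nonneg_left h1 (Real.exp_pos (-(y / 4))).le
  nlinarith

/-- At `y = ln n` this gives `(4 / c) ^ K ≤ n ^ (1/8)` when `K` is bounded by a power of `ln ln n`.
-/
theorem eventually_pow_log_le (p : ℕ) (A l : ℝ) :
    ∀ᶠ y : ℝ in atTop, ((A * Real.log y) ^ p + 1) * l ≤ y / 8 := by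
  have h1 : (fun y : ℝ => ((A * Real.log y) ^ p + 1) * l) =o[atTop] (id : ℝ → ℝ) := by
    have h2 : (fun y : ℝ => (A * Real.log y) ^ p) =o[atTop] (id : ℝ → ℝ) := by
      simp only [mul_pow]
      exact Real.isLittleO_pow_log_id_atTop.const_mul_left _
    have h3 := h2.add (isLittleO_const_id_atTop (1 : ℝ))
    exact (h3.const_mul_left l).congr_left fun y => mul_comm _ _
  filter_upwards [h1.bound (show (0 : ℝ) < 1 / 8 by norm_num), eventually_ge_atTop 0] with y hy hy0
  rw [id, Real.norm_of_nonneg hy0] at hy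
  linarith [Real.le_norm_self (((A * Real.log y) ^ p + 1) * l)]

/-- At `y = ln n` the Hoeffding tail `exp (-√n / 2)` is at most `n ^ (-3)`. -/
theorem eventually_le_exp_half : ∀ᶠ y : ℝ in atTop, 6 * y ≤ Real.exp (y / 2) := by
  have h := ((Real.tendsto_pow_mul_exp_neg_atTop_nhds_zero 1).comp
    (tendsto_id.atTop_div_const (show (0 : ℝ) < 2 by norm_num))).eventually_le_const
      (show (0 : ℝ) < 1 / 12 by norm_num)
  filter_upwards [h] with y hy
  simp only [Function.comp, id, pow_one] at hy
  rw [Real.exp_neg, ← div_eq_mul_inv, div_le_iff₀ (Real.exp_pos _)] at hy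
  linarith

/-- A union bound over polynomially many events, at the sampling accuracy `n ^ (-1/4)`. -/
theorem union_bound_le {y ε B : ℝ} {K : ℕ} (h6 : 6 * y ≤ Real.exp (y / 2))
    (hε : 8 * Real.exp (-y) ≤ ε) (hy : 0 ≤ y) (hB : B ≤ Real.exp y) (hK : 4 ^ K ≤ B) :
    (Real.exp y + (Real.exp y * Real.exp y + Real.exp y * (2 * 4 ^ K))) *
      (2 * Real.exp (-(Real.exp y * Real.exp (-(y / 4)) ^ 2) / 2)) ≤ ε := by
  have h1 : Real.exp y * Real.exp (-(y / 4)) ^ 2 = Real.exp (y / 2) := by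
    rw [← Real.exp_nat_mul, ← Real.exp_add]
    congr 1
    push_cast
    ring
  have h2 : 1 ≤ Real.exp y := Real.one_le_exp hy
  have h3 : Real.exp y + (Real.exp y * Real.exp y + Real.exp y * (2 * 4 ^ K)) ≤
      4 * Real.exp (2 * y) := by
    rw [two_mul y, Real.exp_add]
    nlinarith [mul_le_mul_of_nonneg_left (hK.trans hB) (Real.exp_pos y).le]
  have h4 : Real.exp (-Real.exp (y / 2) / 2) ≤ Real.exp (-(3 * y)) :=
    Real.exp_le_exp.2 (by linarith)
  rw [h1]
  calc _ ≤ 4 * Real.exp (2 * y) * (2 * Real.exp (-(3 * y))) := by gcongr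
    _ = 8 * Real.exp (-y) := by
        rw [show -y = 2 * y + -(3 * y) by ring, Real.exp_add]
        ring
    _ ≤ ε := hε

theorem eventually_learningError_le {b d : ℝ} (hb : 0 < b) (hd : 0 < d) (hbd : b * d < 1 / 2)
    {r : ℕ → ℝ} (hr : Tendsto r atTop atTop) {ε : ℝ} (hε : 0 < ε) :
    ∀ᶠ n : ℕ in atTop, ∀ (M : Matrix (Fin n) (Fin n) ℝ) (θ : Fin n → ℝ),
      IsAdmissible b d (r n) M θ → ∀ S : Finset (Fin n),
        (H n n S (1 / Real.log (Real.log n))).learningError (censored S M θ) ≤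
          ENNReal.ofReal (ε * n) := by
  set α := b * d with hα
  have hα0 : 0 < α := mul_pos hb hd
  set c := floor b α with hcdef
  have hc : 0 < c := floor_pos b α
  have hc2 : c ≤ 1 / 2 := floor_le_one_half (by linarith)
  have hκ : 0 < 1 - 2 * α := by linarith
  set δ := ε * (1 - 2 * α) / 8 with hδ
  have hδ0 : 0 < δ := by positivity
  -- The order of choice matters: `δ` from `ε`, then the radius `ℓ`, which fixes the loss `D` in
  -- comparing covariances, then `R`, large enough to beat `D`. None depends on `n`, so the girth
  -- eventually exceeds `R + ℓ`.
  obtain ⟨ℓ, hℓ⟩ := exists_pow_lt_of_lt_one (show 0 < δ / 2 by positivity)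
    (show (1 / 2 : ℝ) < 1 by norm_num)
  set D := (d + 1) ^ ℓ * (8 / c) ^ (ℓ + 1) / (2 * c) with hD
  have hD0 : 0 < D := by positivity
  clear_value c δ D
  obtain ⟨R, hR⟩ := exists_pow_lt_of_lt_one (show 0 < δ / 4 / (D * 64) by positivity)
    (show (1 / 2 : ℝ) < 1 by norm_num)
  -- With `d + 1 < 2 ^ p`, a ball of radius `L` has at most `(2 ^ L) ^ p` points, a power of `ln ln
  -- n` for the `L` below.
  obtain ⟨p, hp⟩ := pow_unbounded_of_one_lt (d + 1) (show (1 : ℝ) < 2 by norm_num)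
  have hlogn : Tendsto (fun n : ℕ => Real.log n) atTop atTop :=
    Real.tendsto_log_atTop.comp tendsto_natCast_atTop_atTop
  have hexp := fun (a : ℝ) (ha : 0 < a) (e : ℝ) (he : 0 < e) =>
    hlogn.eventually ((tendsto_exp_neg_div ha).eventually_le_const he)
  filter_upwards [eventually_gt_atTop 0, hr.eventually_ge_atTop ((R : ℝ) + ℓ),
    (Real.tendsto_log_atTop.comp hlogn).eventually_ge_atTop 1,
    (Real.tendsto_log_atTop.comp hlogn).eventually_ge_atTop (8 * D / δ),
    hlogn.eventually (eventually_log_mul_exp_le hc),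
    hlogn.eventually (eventually_pow_log_le p (4 / c) (Real.log (4 / c))),
    hlogn.eventually eventually_le_exp_half, hlogn.eventually_ge_atTop 0,
    hexp 8 (by norm_num) (1 / 2) (by norm_num),
    hexp 8 (by norm_num) (ε * (1 - 2 * α) / 16) (by positivity),
    hexp 1 (by norm_num) (ε / 32) (by positivity),
    hexp (1 - 2 * α)⁻¹ (by positivity) (ε / 4) (by positivity)]
    with n hn hrn hs1 hs2 hE1 hE2 hE3 hy0 hE4 hE5 hE6 hE7 M θ hM S
  simp only [Function.comp] at hs1 hs2
  set y := Real.log n with hy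
  set s := Real.log y with hs
  clear_value s
  have hs0 : 0 < s := by linarith
  have hn' : Real.exp y = n := Real.exp_log (by exact_mod_cast hn)
  have h2s : 1 ≤ 2 * s / c := by rw [le_div_iff₀ hc]; linarith
  -- The radius `L = k + 1` is the least with `2 ^ (-L) < ρ₀ c / 2`, where `ρ₀ = 1 / s`; minimality
  -- keeps `2 ^ L` at most `4 s / c`.
  obtain ⟨k, hk1, hk2⟩ := exists_nat_pow_near h2s (show (1 : ℝ) < 2 by norm_num)
  set K := ⌈(4 / c * s) ^ p⌉₊ with hK
  have hK1 : (K : ℝ) ≤ (4 / c * s) ^ p + 1 := (Nat.ceil_lt_add_one (by positivity)).le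
  have h4c : (4 : ℝ) ≤ 4 / c := by rw [le_div_iff₀ hc]; nlinarith
  have hKy : (4 / c) ^ K ≤ Real.exp (y / 8) := by
    rw [← Real.exp_log (show 0 < 4 / c by positivity), ← Real.exp_nat_mul]
    refine Real.exp_le_exp.2 (le_trans (mul_le_mul_of_nonneg_right hK1 ?_) hE2)
    exact Real.log_nonneg (by linarith)
  have h4K : (4 : ℝ) ^ K ≤ Real.exp (y / 8) := (pow_le_pow_left₀ (by norm_num) h4c K).trans hKy
  have hcK : 0 < c ^ K := by positivity
  have hcK1 : 1 ≤ c ^ K * Real.exp (y / 8) := by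
    refine le_trans ?_ (mul_le_mul_of_nonneg_left hKy hcK.le)
    rw [← mul_pow, mul_div_cancel₀ _ hc.ne']
    exact one_le_pow₀ (by norm_num)
  have hsplit : Real.exp (-(y / 4)) = Real.exp (-(y / 8)) * Real.exp (-(y / 8)) := by
    rw [← Real.exp_add]; congr 1; ring
  have hcK2 : Real.exp (-(y / 8)) ≤ c ^ K := by
    rwa [Real.exp_neg, inv_le_iff_one_le_mul₀ (Real.exp_pos _)]
  have he8 := Real.exp_pos (-(y / 8))
  have htK : 2 * Real.exp (-(y / 4)) ≤ c ^ K := by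
    rw [hsplit]; nlinarith
  have htK' : 4 * Real.exp (-(y / 4)) / c ^ K ≤ ε * (1 - 2 * α) / 4 := by
    rw [div_le_iff₀ hcK, hsplit]
    have h1 : 4 * Real.exp (-(y / 8)) ≤ ε * (1 - 2 * α) / 4 := by linarith
    have := mul_le_mul h1 hcK2 he8.le (by positivity)
    linarith
  have hmain := learningError_le (b := b) (α := α) (r := r n) (d := d) (ρ₀ := 1 / s)
    (t := Real.exp (-(y / 4))) (δ := δ) (R := R) (ℓ := ℓ) (L := k + 1) (K := K) hn
    (tame_of_isAdmissible hb hd hbd hM) hM.girth hd.le hM.sparse hrn (by positivity)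
    (by rw [div_le_one hs0]; exact hs1) (Real.exp_pos _).le
    (by rw [one_div, inv_mul_eq_div, le_div_iff₀ hs0, ← hcdef]; exact hE1)
    (by
      rw [← hcdef, div_lt_iff₀ (by positivity)]
      rw [div_lt_iff₀ hc] at hk2
      field_simp
      linarith)
    (by
      calc (d + 1) ^ (k + 1) ≤ (2 ^ p) ^ (k + 1) := by gcongr
        _ = (2 ^ (k + 1)) ^ p := by rw [← pow_mul, ← pow_mul, mul_comm]
        _ ≤ (4 / c * s) ^ p := by
            refine pow_le_pow_left₀ (by positivity) ?_ p
            calc (2 : ℝ) ^ (k + 1) = 2 * 2 ^ k := by ring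
              _ ≤ 2 * (2 * s / c) := by gcongr
              _ = 4 / c * s := by ring
        _ ≤ K := Nat.le_ceil _) (hcdef ▸ htK)
    (by
      rw [← hcdef]
      have h1 : (1 : ℝ) / 2 ^ ℓ ≤ δ / 2 := by rw [← one_div_pow]; exact hℓ.le
      have h2 : D * 64 * (1 / 2) ^ R ≤ δ / 4 := by
        rw [mul_comm]
        exact ((lt_div_iff₀ (by positivity)).1 hR).le
      have h3 : 2 * D / s ≤ δ / 4 := by
        rw [div_le_iff₀ hs0]
        rw [div_le_iff₀ hδ0] at hs2
        linarith
      calc _ = 1 / 2 ^ ℓ + (2 * D / s + D * 64 * (1 / 2) ^ R) := by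
            rw [hD, one_div_pow]
            ring
        _ ≤ δ := by linarith) S
  refine hmain.trans (ENNReal.ofReal_le_ofReal ?_)
  rw [← hcdef, mul_comm ε]
  refine mul_le_mul_of_nonneg_left ?_ (Nat.cast_nonneg n)
  -- The budget: `ε / 4` for mixing, `ε / 2` for the conditional probabilities (half sampling error,
  -- half neglected vertices), `ε / 4` for bad samples.
  have h1 : Real.exp (-((1 - 2 * α) * y)) ≤ ε / 4 := by
    rwa [div_inv_eq_mul, mul_comm] at hE7
  have h2 : (4 * Real.exp (-(y / 4)) / c ^ K + 2 * δ) / (1 - 2 * α) ≤ ε / 2 := by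
    rw [div_le_iff₀ hκ, hδ]
    linarith
  have h3 := union_bound_le (K := K) hE3 (ε := ε / 4)
    (by rw [div_one] at hE6; linarith) hy0
    (Real.exp_le_exp.2 (by linarith : y / 8 ≤ y)) h4K
  rw [hn'] at h3
  linarith

/-- The largest learning error over all admissible models on `n` vertices. -/
def worstError (b d r : ℝ) (n : ℕ) : ℝ≥0∞ :=
  ⨆ (M : Matrix (Fin n) (Fin n) ℝ) (θ : Fin n → ℝ) (_ : IsAdmissible b d r M θ)
    (S : Finset (Fin n)),
    (H n n S (1 / Real.log (Real.log n))).learningError (censored S M θ)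

theorem worstError_ne_top (b d r : ℝ) (n : ℕ) : worstError b d r n ≠ ∞ :=
  ne_top_of_le_ne_top (ENNReal.natCast_ne_top n) (iSup_le fun _ => iSup_le fun _ =>
    iSup_le fun _ => iSup_le fun _ => learningError_le_card _ _)

theorem le_worstError {b d r : ℝ} {n : ℕ} {M : Matrix (Fin n) (Fin n) ℝ} {θ : Fin n → ℝ}
    (h : IsAdmissible b d r M θ) (S : Finset (Fin n)) :
    (H n n S (1 / Real.log (Real.log n))).learningError (censored S M θ) ≤ worstError b d r n :=
  le_iSup_of_le M (le_iSup_of_le θ (le_iSup_of_le h (le_iSup_of_le S le_rfl)))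

/-- The eventual bound holds for all admissible models on `n` vertices at once, so it passes to the
supremum. -/
theorem worstError_isLittleO {b d : ℝ} (hb : 0 < b) (hd : 0 < d) (hbd : b * d < 1 / 2)
    {r : ℕ → ℝ} (hr : Tendsto r atTop atTop) :
    (fun n => (worstError b d (r n) n).toReal) =o[atTop] fun n : ℕ => (n : ℝ) := by
  refine IsLittleO.of_bound fun ε hε => ?_
  filter_upwards [eventually_learningError_le hb hd hbd hr hε] with n hn
  rw [Real.norm_of_nonneg ENNReal.toReal_nonneg, Real.norm_of_nonneg (Nat.cast_nonneg n)]
  exact ENNReal.toReal_le_of_le_ofReal (by positivity) (iSup_le fun M => iSup_le fun θ =>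
    iSup_le fun h => iSup_le fun S => hn M θ h S)

end HighGirth

end

theorem mainTheorem2 :
    -- polynomial running time, uniformly over everything
    (∃ C k : ℕ, ∀ n : ℕ, 0 < n → ∀ S : Finset (Fin n),
      (HighGirth.H n n S (1 / Real.log (Real.log n))).HaltsWithin (C * n ^ k)) ∧
    -- earth-mover error `o(n)`; the error function depends only on `b`, `d` and `r`
    (∀ b d : ℝ, 0 < b → 0 < d → b * d < 1 / 2 →
      ∀ r : ℕ → ℝ, Tendsto r atTop atTop →
        ∃ err : ℕ → ℝ, err =o[atTop] (fun n : ℕ => (n : ℝ)) ∧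
          ∀ n : ℕ, 0 < n → ∀ (M : Matrix (Fin n) (Fin n) ℝ) (θ : Fin n → ℝ),
            Ising.IsAdmissible b d (r n) M θ → ∀ S : Finset (Fin n),
              (HighGirth.H n n S (1 / Real.log (Real.log n))).learningError
                (Ising.censored S M θ) ≤ ENNReal.ofReal (err n)) := by
  refine ⟨⟨100, 4, fun n hn S => HighGirth.halts_H n hn S _⟩, fun b d hb hd hbd r hr =>
    ⟨_, HighGirth.worstError_isLittleO hb hd hbd hr, fun n _ M θ h S => ?_⟩⟩
  rw [ENNReal.ofReal_toReal (HighGirth.worstError_ne_top b d (r n) n)]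
  exact HighGirth.le_worstError h S
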